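/- Setting. Let $\mathcal U$ be a separable metric space (with its Borel $\sigma$-algebra), $\mathcal V=\mathcal U\times\mathcal U$, and let $G_n:\mathcal U\to(0,\infty)$, $n\ge 0$, be measurable potentials. Level $0$ is given by an initial law $\eta^0_0$ on $\mathcal U$ and Markov kernels $M^0_{p}$, $p\ge 1$, on $\mathcal U$; write $\gamma^0_{n,1}$ for $\gamma_n$ below with these data. For each level $l\ge1$ there are an initial law $\eta^l_0$ on $\mathcal V$ and Markov kernels $M^l_p$, $p\ge1$, on $\mathcal V$ whose coordinate marginals are Markov kernels on $\mathcal U$: the law of the first (fine) coordinate under $M^l_p((u_1,u_2),\cdot)$ is $M^l_{p,1}(u_1,\cdot)$ and the law of the second (coarse) coordinate is $M^l_{p,2}(u_2,\cdot)$. Put $\gamma_{n}(du_n)=\int \prod_{p<n}G_p(u_p)\,\eta_{0}(du_0)\prod_{p=1}^nM_{p}(u_{p-1},du_p)$ and $\eta_{n}=\gamma_{n}/\gamma_{n}(1)$; for $j\in\{1,2\}$ this gives $\gamma^l_{n,j},\eta^l_{n,j}$ from the $j$-th marginals of $\eta^l_0$ and $M^l_p$. Algorithm. Level $0$ is a particle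 filter with $N_0$ particles with multinomial resampling (weights proportional to $G_p$) at each time. Level $l\ge 1$ is a coupled particle filter with $N_l$ pairs: the initial pairs are i.i.d. from $\eta_0^l$. Given the pairs $(u_{i,1},u_{i,2})_{i\le N_l}$ at time $p$, let $w_{i,j}=G_p(u_{i,j})/\sum_kG_p(u_{k,j})$; each new pair is obtained, independently, by drawing ancestors $(I_1,I_2)$ (with probability $\alpha=\sum_i w_{i,1}\wedge w_{i,2}$: $I_1=I_2$ drawn proportionally to $w_{\cdot,1}\wedge w_{\cdot,2}$; otherwise $I_1,I_2$ independent, drawn proportionally to $w_{\cdot,j}-w_{\cdot,1}\wedge w_{\cdot,2}$, $j=1,2$), and then sampling from $M^l_{p+1}((u_{I_1,1},u_{I_2,2}),\cdot)$. The $L+1$ filters are independent; $\eta_{p,j}^{N_l}$ are the (marginal) empirical measures of the particles before resampling at time $p$, and $\gamma^{N_l}_{n,j}(1)=\prod_{p=0}^{n-1}\eta^{N_l}_{p,j}(G_p)$. Assumption (A). There are $c>1$, $C>0$ with $c^{-1}<G_n(x)<c$ and $|G_n(x)-G_n(x')|\le C|x-x'|$ for all $n,x,x'$ ($|x-x'|$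 is the distance); and for each $n\ge1$ there is $C_n>0$ such that for all levels $l\ge1$, $j\in\{1,2\}$, $u,u'$ and all bounded Lipschitz $\varphi$, $|M^l_{n,j}(\varphi)(u)-M^l_{n,j}(\varphi)(u')|\le C_n\|\varphi\|_\infty|u-u'|$. Constants. For the level-$l$ filter with $N_l$ pairs $(U^i_{p,1},U^i_{p,2})$ let $$B_l(n)=\Big(\sum_{p=0}^n\big\{\mathbb E[(|U^1_{p,1}-U^1_{p,2}|\wedge1)^2]^{1/2}+\|\eta^l_{p,1}-\eta^l_{p,2}\|_{\rm tv}\big\}+\sum_{p=1}^n|||M^l_{p,1}-M^l_{p,2}|||\Big)^2,$$ where $\|\mu-\nu\|_{\rm tv}=\sup_A|\mu(A)-\nu(A)|$ and $|||M-M'|||$ is the supremum of $|M(\varphi)(u)-M'(\varphi)(u)|$ over $u\in\mathcal U$ and Lipschitz $\varphi$ with $\|\varphi\|_\infty\le1$. Given positive constants $\kappa_0,\kappa_1,\dots$ let $\overline B_l(0)=\kappa_0B_l(0)$ and, for $n\ge1$, $$\overline B_l(n)=\kappa_n\big[B_l(n-1)+\overline B_l(n-1)+\|\eta^l_{n-1,1}-\eta^l_{n-1,2}\|_{\rm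 tv}^2+(\gamma^l_{n-1,1}(1)-\gamma^l_{n-1,2}(1))^2\big].$$ (These depend on $N_l$ through the expectation.) Write $$\mathrm{MSE}_L(z)=\mathbb E\Big[\Big(\gamma_{n,1}^{N_0}(1)\prod_{l=1}^L\frac{\gamma_{n,1}^{N_l}(1)}{\gamma_{n,2}^{N_l}(1)}-z\Big)^2\Big],\qquad z_L=\gamma_{n,1}^{0}(1)\prod_{l=1}^L\frac{\gamma_{n,1}^{l}(1)}{\gamma_{n,2}^{l}(1)}.$$ Theorem. (1) General levels. Assume (A) and fix $\kappa$. For all $n\ge1$ and $S\in\mathbb R$ there is $C(n)=C(n,S)<\infty$ such that for all $L\ge1$ and $N_0,\dots,N_L\ge1$ with $\sum_{l=1}^L\big(\overline B_l(n)^{1/2}+|\gamma^l_{n,1}(1)-\gamma^l_{n,2}(1)|\big)\le S$, $$\mathrm{MSE}_L(z_L)\le C(n)\Big(\frac1{\sqrt{N_0}}+\sum_{l=1}^L\frac{\overline B_l(n)^{1/2}+|\gamma^l_{n,1}(1)-\gamma^l_{n,2}(1)|}{\sqrt{N_l}}\Big)^2.\qquad(*)$$ (2) Euler levels. Let $dX_t=a(X_t)dt+b(X_t)dW_t$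 on $\mathbb R^d$ with globally Lipschitz $a:\mathbb R^d\to\mathbb R^d$, $b:\mathbb R^d\to\mathbb R^{d\times d}$ and $\mathbb E|X_0|^p<\infty$ for all $p\ge1$ (for instance $X_0=x_0$), and let $G_n(x)=G(x,y_{n+1})>0$ for fixed data $y_1,y_2,\ldots$ in $\mathbb R^s$. Let $h_l=2^{-l}$ and let $Q^l$ be the kernel of $2^l$ Euler steps $x\mapsto x+h_la(x)+\sqrt{h_l}\,b(x)\xi$, $\xi\sim\mathcal N_d(0,I_d)$. Let $M^l$, $l\ge1$, be the coupling of $Q^l$ (fine) and $Q^{l-1}$ (coarse) in which each coarse step is driven by the sum $\sqrt{h_l}(\xi_{2m}+\xi_{2m+1})$ of the two corresponding fine increments. Level $l\ge1$ has transitions $M^l$ and initial law that of a draw from $M^l((X_0,X_0),\cdot)$; level $0$ uses $Q^0$ in the same way. Assume (A). Then: (a) for every $\kappa$ and every $n\ge1$ there is $C(n)<\infty$ such that $(*)$ holds for all $L\ge1$ and all $N_0,\dots,N_L\ge1$; (b) for every $n\ge1$ there is $C(n)<\infty$ such that for each $\varepsilon\in(0,1)$, with $L=\lceil\log_2(1/\varepsilon)\rceil$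 (so $h_L\le\varepsilon$), there are $N_0,\dots,N_L\ge1$ whose cost per observation time satisfies $\sum_{l=0}^LN_lh_l^{-1}\le C(n)\varepsilon^{-2.5}$, and for every $z\in\mathbb R$ $$\mathrm{MSE}_L(z)\le(\varepsilon+|p^L(y_{1:n})-z|)^2,$$ where $p^L(y_{1:n})$ is the marginal likelihood of the level-$L$ Euler approximation. In particular the mean square error relative to $p^L(y_{1:n})$ is at most $\varepsilon^2$, and it is $O(\varepsilon^2)$ relative to any $z$ for which the discretization bias $|p^L(y_{1:n})-z|$ is $O(h_L)$. -/

import Mathlib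

open MeasureTheory ProbabilityTheory Finset
open scoped ENNReal

noncomputable section

namespace MLPF

section Kernels

variable {α β ι : Type*} [MeasurableSpace α] [MeasurableSpace β]

/-- The mixture `a ↦ ∑ i, q i a • K i a` of finitely many kernels, with measurable weights `q`. -/
def mixture [Fintype ι] (q : ι → α → ℝ) (hq : ∀ i, Measurable (q i)) (K : ι → Kernel α β) :
    Kernel α β where
  toFun a := ∑ i, ENNReal.ofReal (q i a) • K i a
  measurable' := by
    refine Measure.measurable_of_measurable_coe _ fun s hs => ?_
    simp only [Measure.coe_finsetSum, Finset.sum_apply, Measure.smul_apply, smul_eq_mul]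
    refine Finset.measurable_sum _ fun i _ => ?_
    exact ((hq i).ennreal_ofReal).mul ((K i).measurable_coe hs)

theorem isMarkovKernel_mixture [Fintype ι] (q : ι → α → ℝ) (hq : ∀ i, Measurable (q i))
    (K : ι → Kernel α β) [∀ i, IsMarkovKernel (K i)] (h0 : ∀ i a, 0 ≤ q i a)
    (h1 : ∀ a, ∑ i, q i a = 1) : IsMarkovKernel (mixture q hq K) := by
  refine ⟨fun a => ⟨?_⟩⟩
  change (∑ i, ENNReal.ofReal (q i a) • K i a) Set.univ = 1
  simp only [Measure.coe_finsetSum, Finset.sum_apply, Measure.smul_apply, smul_eq_mul,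
    measure_univ, mul_one]
  rw [← ENNReal.ofReal_sum_of_nonneg fun i _ => h0 i a, h1, ENNReal.ofReal_one]

/-- The kernel that draws, given `a`, an i.i.d. family with common law `K a`. -/
def iidKernel (ι : Type*) [Fintype ι] (K : Kernel α β) [IsMarkovKernel K] :
    Kernel α (ι → β) where
  toFun a := Measure.pi fun _ : ι => K a
  measurable' := by
    refine Measurable.measure_of_isPiSystem_of_isProbabilityMeasure
      generateFrom_pi.symm isPiSystem_pi ?_
    rintro _ ⟨s, hs, rfl⟩
    simp only [Measure.pi_pi]
    exact Finset.measurable_prod _ fun i _ => K.measurable_coe (hs i (Set.mem_univ i))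

instance (ι : Type*) [Fintype ι] (K : Kernel α β) [IsMarkovKernel K] :
    IsMarkovKernel (iidKernel ι K) :=
  ⟨fun a => inferInstanceAs (IsProbabilityMeasure (Measure.pi fun _ : ι => K a))⟩

theorem isMarkovKernel_pow (K : Kernel α α) [IsMarkovKernel K] (n : ℕ) :
    IsMarkovKernel (K ^ n) := by
  induction n with
  | zero => rw [pow_zero]; exact inferInstanceAs (IsMarkovKernel (Kernel.id : Kernel α α))
  | succ n ih => rw [pow_succ]; exact inferInstanceAs (IsMarkovKernel ((K ^ n) ∘ₖ K))

theorem map_pow_eq (K : Kernel α α) (Q : Kernel β β) (f : α → β) (hf : Measurable f)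
    (h : ∀ a, (K a).map f = Q (f a)) (n : ℕ) (a : α) : ((K ^ n) a).map f = (Q ^ n) (f a) := by
  have h' : K.map f = Q.comap f hf := by
    ext1 a; rw [Kernel.map_apply _ hf, Kernel.comap_apply, h]
  have key : (K ^ n).map f = (Q ^ n).comap f hf := by
    induction n with
    | zero =>
      ext1 a
      rw [Kernel.map_apply _ hf, Kernel.comap_apply, pow_zero, pow_zero]
      change (Kernel.id a).map f = Kernel.id (f a)
      rw [Kernel.id_apply, Kernel.id_apply]
      exact Measure.map_dirac' hf a
    | succ n ih =>
      rw [pow_succ', pow_succ']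
      change (K ∘ₖ (K ^ n)).map f = (Q ∘ₖ (Q ^ n)).comap f hf
      rw [Kernel.map_comp, h', ← Kernel.comp_map, ih]
      ext1 a
      simp [Kernel.comp_apply]
  rw [← Kernel.map_apply _ hf, key, Kernel.comap_apply]

/-- The law on paths `ℕ → β` of the Markov chain with initial law `μ` whose transition from time
`p` to time `p + 1` is `K p`. -/
def chainLaw (μ : Measure β) (K : ℕ → Kernel β β) [∀ p, IsMarkovKernel (K p)] :
    Measure (ℕ → β) :=
  Kernel.trajMeasure (X := fun _ => β) μ
    (fun p => (K p).comap (fun h : (i : Iic p) → β => h ⟨p, mem_Iic.2 le_rfl⟩)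
      (measurable_pi_apply _))

instance (μ : Measure β) [IsProbabilityMeasure μ] (K : ℕ → Kernel β β)
    [∀ p, IsMarkovKernel (K p)] : IsProbabilityMeasure (chainLaw μ K) := by
  unfold chainLaw; infer_instance

/-- Total variation distance `sup_A |μ(A) - ν(A)|`. -/
def tvDist (μ ν : Measure α) : ℝ :=
  sSup {r | ∃ A, MeasurableSet A ∧ r = |μ.real A - ν.real A|}

/-- `|||K - Q|||`: the supremum, over bounded Lipschitz functions `φ` with `‖φ‖ ≤ 1` (supremum norm)
and over all points `u`, of `|K(φ)(u) - Q(φ)(u)|`. -/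
def kernelDist {U : Type*} [MetricSpace U] [MeasurableSpace U] (K Q : Kernel U U) : ℝ :=
  sSup {r | ∃ (φ : U → ℝ) (u : U), (∀ x, |φ x| ≤ 1) ∧ (∃ k, LipschitzWith k φ) ∧
    r = |∫ x, φ x ∂(K u) - ∫ x, φ x ∂(Q u)|}

end Kernels

section Resampling

variable {ι : Type*} [Fintype ι]

/-- Normalized weights. -/
def weight (g : ι → ℝ) (i : ι) : ℝ := g i / ∑ j, g j

/-- The law of the pair of ancestors in coupled resampling: with probability
`∑ s, w₁ s ∧ w₂ s` a common index is drawn proportionally to `w₁ ∧ w₂`; otherwise the two indices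
are drawn independently, proportionally to `w₁ - w₁ ∧ w₂` and to `w₂ - w₁ ∧ w₂`. -/
def couplingProb [DecidableEq ι] (w₁ w₂ : ι → ℝ) (p : ι × ι) : ℝ :=
  (if p.1 = p.2 then min (w₁ p.1) (w₂ p.1) else 0) +
    (1 - ∑ s, min (w₁ s) (w₂ s)) *
      (((w₁ p.1 - min (w₁ p.1) (w₂ p.1)) / ∑ s, (w₁ s - min (w₁ s) (w₂ s))) *
        ((w₂ p.2 - min (w₁ p.2) (w₂ p.2)) / ∑ s, (w₂ s - min (w₁ s) (w₂ s))))

theorem weight_nonneg {g : ι → ℝ} (hg : ∀ i, 0 < g i) (i : ι) : 0 ≤ weight g i :=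
  div_nonneg (hg i).le (Finset.sum_nonneg fun j _ => (hg j).le)

theorem sum_weight [Nonempty ι] {g : ι → ℝ} (hg : ∀ i, 0 < g i) : ∑ i, weight g i = 1 := by
  unfold weight
  rw [← Finset.sum_div]
  exact div_self (Finset.sum_pos (fun i _ => hg i) Finset.univ_nonempty).ne'

theorem couplingProb_nonneg [DecidableEq ι] {w₁ w₂ : ι → ℝ} (h₁ : ∀ i, 0 ≤ w₁ i)
    (h₂ : ∀ i, 0 ≤ w₂ i) (s₁ : ∑ i, w₁ i = 1) (p : ι × ι) : 0 ≤ couplingProb w₁ w₂ p := by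
  unfold couplingProb
  have hα : ∑ s, min (w₁ s) (w₂ s) ≤ 1 := s₁ ▸ Finset.sum_le_sum fun i _ => min_le_left _ _
  refine add_nonneg ?_ (mul_nonneg (by linarith) (mul_nonneg ?_ ?_))
  · split_ifs
    · exact le_min (h₁ _) (h₂ _)
    · exact le_rfl
  · exact div_nonneg (by simp) (Finset.sum_nonneg fun i _ => by simp)
  · exact div_nonneg (by simp) (Finset.sum_nonneg fun i _ => by simp)

theorem sum_couplingProb [DecidableEq ι] {w₁ w₂ : ι → ℝ}
    (s₁ : ∑ i, w₁ i = 1) (s₂ : ∑ i, w₂ i = 1) : ∑ p, couplingProb w₁ w₂ p = 1 := by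
  unfold couplingProb
  rw [Fintype.sum_prod_type]
  simp only [Finset.sum_add_distrib, ← Finset.mul_sum, ← Finset.sum_mul, ← Finset.sum_div,
    Finset.sum_ite_eq, Finset.mem_univ, if_true, Finset.sum_sub_distrib, s₁, s₂]
  by_cases h : 1 - ∑ s, min (w₁ s) (w₂ s) = 0
  · rw [h]; simp; linarith
  · rw [div_self h]; ring

end Resampling

section ParticleFilters

variable {U : Type*} [MeasurableSpace U]

/-- The potentials `G_n`, `n ≥ 0`. -/
structure Potentials (U : Type*) [MeasurableSpace U] where
  /-- the value `G_n(u)` -/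
  val : ℕ → U → ℝ
  measurable : ∀ n, Measurable (val n)
  pos : ∀ n u, 0 < val n u

/-- One time step of the particle filter: given the particles `x` at time `p`, a
new particle is obtained by choosing an ancestor with probability proportional to `G_p` and moving
it with the kernel `K`. -/
def moveKernel (G : Potentials U) (p N : ℕ) (K : Kernel U U) : Kernel (Fin N → U) U :=
  mixture (fun i x => weight (fun j => G.val p (x j)) i)
    (fun i => ((G.measurable p).comp (measurable_pi_apply i)).div
      (Finset.measurable_sum _ fun j _ => (G.measurable p).comp (measurable_pi_apply j)))
    (fun i => K.comap (fun x => x i) (measurable_pi_apply i))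

instance (G : Potentials U) (p N : ℕ) [NeZero N] (K : Kernel U U) [IsMarkovKernel K] :
    IsMarkovKernel (moveKernel G p N K) :=
  isMarkovKernel_mixture _ _ _ (fun i x => weight_nonneg (fun j => G.pos p (x j)) i)
    (fun x => sum_weight fun j => G.pos p (x j))

theorem measurable_couplingProb (G : Potentials U) (p N : ℕ) (q : Fin N × Fin N) :
    Measurable fun x : Fin N → U × U =>
      couplingProb (weight fun j => G.val p (x j).1) (weight fun j => G.val p (x j).2) q := by
  have hG := G.measurable p
  unfold couplingProb weight
  refine Measurable.add ?_ ?_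
  · split_ifs
    · fun_prop
    · exact measurable_const
  · fun_prop

/-- One time step of the coupled particle filter: given the pairs `x` at time `p`, a new
pair is obtained by choosing a pair of ancestors `(i, j)` by coupled resampling, and moving
`(u_{i,1}, u_{j,2})` with the coupled kernel `K`. -/
def coupledMoveKernel (G : Potentials U) (p N : ℕ) (K : Kernel (U × U) (U × U)) :
    Kernel (Fin N → U × U) (U × U) :=
  mixture
    (fun (q : Fin N × Fin N) x =>
      couplingProb (weight fun j => G.val p (x j).1) (weight fun j => G.val p (x j).2) q)
    (fun q => measurable_couplingProb G p N q)
    (fun q => K.comap (fun x => ((x q.1).1, (x q.2).2)) (by fun_prop))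

instance (G : Potentials U) (p N : ℕ) [NeZero N] (K : Kernel (U × U) (U × U))
    [IsMarkovKernel K] : IsMarkovKernel (coupledMoveKernel G p N K) :=
  isMarkovKernel_mixture _ _ _
    (fun q x => couplingProb_nonneg (weight_nonneg fun j => G.pos p (x j).1)
      (weight_nonneg fun j => G.pos p (x j).2) (sum_weight fun j => G.pos p (x j).1) q)
    (fun x => sum_couplingProb (sum_weight fun j => G.pos p (x j).1)
      (sum_weight fun j => G.pos p (x j).2))

/-- The unnormalized measures `γ_n` of the Feynman-Kac model with initial law `μ`, potentials
`G_p` and transitions `K p` from time `p` to time `p + 1`. -/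
def unnormalized (G : Potentials U) (μ : Measure U) (K : ℕ → Kernel U U) : ℕ → Measure U
  | 0 => μ
  | n + 1 => ((unnormalized G μ K n).withDensity fun u => ENNReal.ofReal (G.val n u)).bind (K n)

/-- The normalizing constant `γ_n(1)`. -/
def normConst (G : Potentials U) (μ : Measure U) (K : ℕ → Kernel U U) (n : ℕ) : ℝ :=
  (unnormalized G μ K n).real Set.univ

/-- The predictor `η_n = γ_n / γ_n(1)`. -/
def predictor (G : Potentials U) (μ : Measure U) (K : ℕ → Kernel U U) (n : ℕ) : Measure U :=
  (unnormalized G μ K n Set.univ)⁻¹ • unnormalized G μ K n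

/-- The estimate `γ_n^N(1) = ∏_{p < n} η_p^N(G_p)` from a path `ω` of an `N`-particle system. -/
def normEst (G : Potentials U) (n N : ℕ) (ω : ℕ → Fin N → U) : ℝ :=
  ∏ p ∈ range n, (1 / (N : ℝ)) * ∑ i, G.val p (ω p i)

/-- A Feynman-Kac model for a single particle filter. -/
structure Single (U : Type*) [MeasurableSpace U] where
  /-- the initial law -/
  init : Measure U
  [isProb : IsProbabilityMeasure init]
  /-- `M p` is the transition from time `p` to time `p + 1` -/
  M : ℕ → Kernel U U
  [isMarkov : ∀ p, IsMarkovKernel (M p)]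

attribute [instance] Single.isProb Single.isMarkov

/-- A coupled Feynman-Kac model: a pair of models, a fine and a coarse one, with coupled initial
laws and coupled transitions. -/
structure Coupled (U : Type*) [MeasurableSpace U] where
  /-- the initial law `η_0` -/
  init : Measure (U × U)
  [isProb : IsProbabilityMeasure init]
  /-- `M p` is the coupled transition from time `p` to time `p + 1` -/
  M : ℕ → Kernel (U × U) (U × U)
  [isMarkov : ∀ p, IsMarkovKernel (M p)]
  /-- the fine transitions (`j = 1`) -/
  M₁ : ℕ → Kernel U U
  [isMarkov₁ : ∀ p, IsMarkovKernel (M₁ p)]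
  /-- the coarse transitions (`j = 2`) -/
  M₂ : ℕ → Kernel U U
  [isMarkov₂ : ∀ p, IsMarkovKernel (M₂ p)]
  map_fst : ∀ p v, (M p v).map Prod.fst = M₁ p v.1
  map_snd : ∀ p v, (M p v).map Prod.snd = M₂ p v.2

attribute [instance] Coupled.isProb Coupled.isMarkov Coupled.isMarkov₁ Coupled.isMarkov₂

namespace Single

variable (F : Single U) (G : Potentials U)

/-- The law of the particle filter with `N` particles. -/
def law (N : ℕ) [NeZero N] : Measure (ℕ → Fin N → U) :=
  chainLaw (Measure.pi fun _ => F.init) fun p => iidKernel (Fin N) (moveKernel G p N (F.M p))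

/-- `γ_n(1)`. -/
def Z (n : ℕ) : ℝ := normConst G F.init F.M n

end Single

namespace Coupled

variable (F : Coupled U) (G : Potentials U)

/-- The law of the coupled particle filter with `N` pairs of particles. -/
def law (N : ℕ) [NeZero N] : Measure (ℕ → Fin N → U × U) :=
  chainLaw (Measure.pi fun _ => F.init) fun p =>
    iidKernel (Fin N) (coupledMoveKernel G p N (F.M p))

instance (N : ℕ) [NeZero N] : IsProbabilityMeasure (F.law G N) := by
  unfold law; infer_instance

/-- `η_{n,1}` and `η_{n,2}`. -/
def η₁ (n : ℕ) : Measure U := predictor G (F.init.map Prod.fst) F.M₁ n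

def η₂ (n : ℕ) : Measure U := predictor G (F.init.map Prod.snd) F.M₂ n

/-- `γ_{n,1}(1)` and `γ_{n,2}(1)`. -/
def Z₁ (n : ℕ) : ℝ := normConst G (F.init.map Prod.fst) F.M₁ n

def Z₂ (n : ℕ) : ℝ := normConst G (F.init.map Prod.snd) F.M₂ n

end Coupled

end ParticleFilters

section Constants

variable {U : Type*} [MetricSpace U] [MeasurableSpace U]

/-- `B(n)` for the coupled particle filter with `N` pairs of particles:
`(∑_{p=0}^{n} {E[(|U_{p,1}^1 - U_{p,2}^1| ∧ 1)²]^{1/2} + ‖η_{p,1} - η_{p,2}‖_tv}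
  + ∑_{p=1}^{n} |||M_{p,1} - M_{p,2}|||)²`. -/
def Coupled.B (F : Coupled U) (G : Potentials U) (N : ℕ) [NeZero N] (n : ℕ) : ℝ :=
  (∑ p ∈ range (n + 1),
      (Real.sqrt (∫ ω, (min (dist (ω p 0).1 (ω p 0).2) 1) ^ 2 ∂(F.law G N)) +
        tvDist (F.η₁ G p) (F.η₂ G p)) +
    ∑ p ∈ range n, kernelDist (F.M₁ p) (F.M₂ p)) ^ 2

/-- `B̄(0) = κ₀ B(0)` and
`B̄(n+1) = κ_{n+1} (B(n) + B̄(n) + ‖η_{n,1} - η_{n,2}‖_tv² + (γ_{n,1}(1) - γ_{n,2}(1))²)`,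
with given constants `κ`. -/
def Coupled.Bbar (F : Coupled U) (G : Potentials U) (κ : ℕ → ℝ) (N : ℕ) [NeZero N] : ℕ → ℝ
  | 0 => κ 0 * F.B G N 0
  | n + 1 => κ (n + 1) * (F.B G N n + Coupled.Bbar F G κ N n +
      tvDist (F.η₁ G n) (F.η₂ G n) ^ 2 + (F.Z₁ G n - F.Z₂ G n) ^ 2)

/-- A multilevel model: common potentials, a single model for level `0`, and a coupled model for
each level `l ≥ 1`; `pair l` is the coupled model of level `l + 1`. -/
structure Model (U : Type*) [MeasurableSpace U] where
  G : Potentials U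
  base : Single U
  pair : ℕ → Coupled U

namespace Model

variable (m : Model U)

/-- Assumption (A): the potentials are bounded above and below and Lipschitz, uniformly in time, and
the transitions of all pairs map bounded Lipschitz functions to Lipschitz functions, with a
constant that is proportional to the supremum norm and uniform in the level. -/
def AssumptionA : Prop :=
  (∃ c > 1, ∃ C > 0, ∀ n x x', c⁻¹ < m.G.val n x ∧ m.G.val n x < c ∧
    |m.G.val n x - m.G.val n x'| ≤ C * dist x x') ∧
  ∀ p, ∃ C > 0, ∀ l, ∀ K ∈ ({(m.pair l).M₁ p, (m.pair l).M₂ p} : Set (Kernel U U)),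
    ∀ (φ : U → ℝ) (b : ℝ), (∀ x, |φ x| ≤ b) → (∃ k, LipschitzWith k φ) →
      ∀ u u', |∫ x, φ x ∂(K u) - ∫ x, φ x ∂(K u')| ≤ C * b * dist u u'

/-- The sample space of one single particle filter (level `0`, `N 0` particles) and `L` coupled
particle filters (levels `l = 1, …, L`, with `N l` pairs). -/
abbrev Sample (U : Type*) (N : ℕ → ℕ+) (L : ℕ) : Type _ :=
  (ℕ → Fin (N 0) → U) × ((l : Fin L) → ℕ → Fin (N (l + 1)) → U × U)

/-- The law of the multilevel particle filter: the `L + 1` filters are independent. -/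
def law (N : ℕ → ℕ+) (L : ℕ) : Measure (Sample U N L) :=
  (m.base.law m.G (N 0)).prod (Measure.pi fun l : Fin L => (m.pair l).law m.G (N (l + 1)))

/-- The biased, non-negative estimator
`γ_{n,1}^{N_0}(1) ∏_{l=1}^{L} γ_{n,1}^{N_l}(1) / γ_{n,2}^{N_l}(1)`. -/
def estimator (n : ℕ) (N : ℕ → ℕ+) (L : ℕ) (ω : Sample U N L) : ℝ :=
  normEst m.G n (N 0) ω.1 *
    ∏ l : Fin L, normEst m.G n (N (l + 1)) (fun p i => (ω.2 l p i).1) /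
      normEst m.G n (N (l + 1)) (fun p i => (ω.2 l p i).2)

/-- The deterministic counterpart `γ_{n,1}^{0}(1) ∏_{l=1}^{L} γ_{n,1}^{l}(1) / γ_{n,2}^{l}(1)`. -/
def target (n L : ℕ) : ℝ :=
  m.base.Z m.G n * ∏ l ∈ range L, (m.pair l).Z₁ m.G n / (m.pair l).Z₂ m.G n

/-- The mean square error of the estimator, relative to the reference value `z`. -/
def mse (n : ℕ) (N : ℕ → ℕ+) (L : ℕ) (z : ℝ) : ℝ :=
  ∫ ω, (m.estimator n N L ω - z) ^ 2 ∂(m.law N L)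

/-- `B̄_l(n)^{1/2} + |γ_{n,1}^l(1) - γ_{n,2}^l(1)|` for the level `l + 1`. -/
def levelError (κ : ℕ → ℝ) (n : ℕ) (N : ℕ → ℕ+) (l : ℕ) : ℝ :=
  Real.sqrt ((m.pair l).Bbar m.G κ (N (l + 1)) n) + |(m.pair l).Z₁ m.G n - (m.pair l).Z₂ m.G n|

/-- `N_0^{-1/2} + ∑_{l=1}^{L} (B̄_l(n)^{1/2} + |γ_{n,1}^l(1) - γ_{n,2}^l(1)|) / N_l^{1/2}`. -/
def rate (κ : ℕ → ℝ) (n : ℕ) (N : ℕ → ℕ+) (L : ℕ) : ℝ :=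
  1 / Real.sqrt (N 0) + ∑ l ∈ range L, m.levelError κ n N l / Real.sqrt (N (l + 1))

end Model

end Constants

section Euler

/-- `ℝ^d` with the Euclidean norm. -/
abbrev Rd (d : ℕ) : Type := EuclideanSpace ℝ (Fin d)

/-- A diffusion `dX = a(X) dt + b(X) dW` on `ℝ^d` with globally Lipschitz coefficients and an
initial law with finite moments, observed at the times `k = 1, 2, …` through `y k ∈ ℝ^s` with
likelihood `g x y`. -/
structure Diffusion (d s : ℕ) where
  a : Rd d → Rd d
  b : Rd d → Rd d →L[ℝ] Rd d
  lipschitz_a : ∃ k, LipschitzWith k a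
  lipschitz_b : ∃ k, LipschitzWith k b
  init : Measure (Rd d)
  [isProb : IsProbabilityMeasure init]
  moments : ∀ p : ℝ, 1 ≤ p → Integrable (fun x => ‖x‖ ^ p) init
  g : Rd d → Rd s → ℝ
  y : ℕ → Rd s
  measurable_g : ∀ n, Measurable fun x => g x (y n)
  pos_g : ∀ n x, 0 < g x (y n)

attribute [instance] Diffusion.isProb

namespace Diffusion

variable {d s : ℕ} (D : Diffusion d s)

/-- One Euler step of length `h` with standard Gaussian noise `ξ`. -/
def eulerMap (h : ℝ) (x ξ : Rd d) : Rd d := x + h • D.a x + Real.sqrt h • D.b x ξ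

/-- Two fine Euler steps of length `h` with noises `ξ.1`, `ξ.2`, and one coarse Euler step of length
`2 * h` driven by the same Brownian increment `√h (ξ.1 + ξ.2)`. -/
def pairMap (h : ℝ) (v : Rd d × Rd d) (ξ : Rd d × Rd d) : Rd d × Rd d :=
  (D.eulerMap h (D.eulerMap h v.1 ξ.1) ξ.2,
    v.2 + (2 * h) • D.a v.2 + Real.sqrt h • D.b v.2 (ξ.1 + ξ.2))

theorem continuous_eulerMap (h : ℝ) : Continuous fun q : Rd d × Rd d => D.eulerMap h q.1 q.2 := by
  obtain ⟨k, hk⟩ := D.lipschitz_a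
  obtain ⟨k', hk'⟩ := D.lipschitz_b
  have ha := hk.continuous
  have hb := hk'.continuous
  unfold eulerMap
  fun_prop

theorem continuous_pairMap (h : ℝ) :
    Continuous fun q : (Rd d × Rd d) × (Rd d × Rd d) => D.pairMap h q.1 q.2 := by
  obtain ⟨k, hk⟩ := D.lipschitz_a
  obtain ⟨k', hk'⟩ := D.lipschitz_b
  have ha := hk.continuous
  have hb := hk'.continuous
  unfold pairMap eulerMap
  fun_prop

/-- The transition kernel of one Euler step of length `h`. -/
def eulerKernel (h : ℝ) : Kernel (Rd d) (Rd d) :=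
  (Kernel.id ×ₖ Kernel.const _ (stdGaussian (Rd d))).map fun q => D.eulerMap h q.1 q.2

/-- The transition kernel of two fine steps and one coarse step, coupled. -/
def pairKernel (h : ℝ) : Kernel (Rd d × Rd d) (Rd d × Rd d) :=
  (Kernel.id ×ₖ
    Kernel.const _ ((stdGaussian (Rd d)).prod (stdGaussian (Rd d)))).map
      fun q => D.pairMap h q.1 q.2

instance (h : ℝ) : IsMarkovKernel (D.eulerKernel h) := by
  unfold eulerKernel
  exact Kernel.IsMarkovKernel.map _ (D.continuous_eulerMap h).measurable

instance (h : ℝ) : IsMarkovKernel (D.pairKernel h) := by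
  unfold pairKernel
  exact Kernel.IsMarkovKernel.map _ (D.continuous_pairMap h).measurable

/-- The step size `h_l = 2^{-l}`. -/
def h (l : ℕ) : ℝ := ((2 : ℝ) ^ l)⁻¹

/-- `Q^l`: `2^l` Euler steps of length `h_l`. -/
def Q (l : ℕ) : Kernel (Rd d) (Rd d) := D.eulerKernel (h l) ^ (2 ^ l)

/-- The coupled kernel with marginals `Q^{l+1}` and `Q^l`. -/
def coupledQ (l : ℕ) : Kernel (Rd d × Rd d) (Rd d × Rd d) := D.pairKernel (h (l + 1)) ^ (2 ^ l)

instance (l : ℕ) : IsMarkovKernel (D.Q l) := isMarkovKernel_pow _ _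

instance (l : ℕ) : IsMarkovKernel (D.coupledQ l) := isMarkovKernel_pow _ _

theorem eulerKernel_apply (h : ℝ) (x : Rd d) :
    D.eulerKernel h x = (stdGaussian (Rd d)).map fun ξ => D.eulerMap h x ξ := by
  have hm := (D.continuous_eulerMap h).measurable
  rw [eulerKernel, Kernel.map_apply _ hm, Kernel.prod_apply, Kernel.id_apply, Kernel.const_apply,
    Measure.dirac_prod, Measure.map_map hm (by fun_prop)]
  rfl

theorem pairKernel_apply (h : ℝ) (v : Rd d × Rd d) :
    D.pairKernel h v =
      ((stdGaussian (Rd d)).prod (stdGaussian (Rd d))).map fun ξ => D.pairMap h v ξ := by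
  have hm := (D.continuous_pairMap h).measurable
  rw [pairKernel, Kernel.map_apply _ hm, Kernel.prod_apply, Kernel.id_apply, Kernel.const_apply,
    Measure.dirac_prod, Measure.map_map hm (by fun_prop)]
  rfl

theorem pairKernel_map_fst (h : ℝ) (v : Rd d × Rd d) :
    (D.pairKernel h v).map Prod.fst = (D.eulerKernel h ^ 2) v.1 := by
  have hc := D.continuous_eulerMap h
  have hp := D.continuous_pairMap h
  have hp' : Measurable fun ξ => D.pairMap h v ξ :=
    (hp.comp (Continuous.prodMk continuous_const continuous_id)).measurable
  have hcx : ∀ x, Measurable fun ξ => D.eulerMap h x ξ := fun x =>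
    (hc.comp (Continuous.prodMk continuous_const continuous_id)).measurable
  rw [D.pairKernel_apply, Measure.map_map measurable_fst hp', pow_two]
  change _ = (D.eulerKernel h ∘ₖ D.eulerKernel h) v.1
  ext t ht
  rw [Measure.map_apply (measurable_fst.comp hp') ht,
    Measure.prod_apply ((measurable_fst.comp hp') ht), Kernel.comp_apply' _ _ _ ht,
    D.eulerKernel_apply h v.1, lintegral_map (Kernel.measurable_coe _ ht) (hcx _)]
  refine lintegral_congr fun ξ => ?_
  rw [D.eulerKernel_apply, Measure.map_apply (hcx _) ht]
  rfl

theorem stdGaussian_add :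
    ((stdGaussian (Rd d)).prod (stdGaussian (Rd d))).map (fun ξ => ξ.1 + ξ.2) =
      (stdGaussian (Rd d)).map fun ξ => Real.sqrt 2 • ξ := by
  change (stdGaussian (Rd d)).conv (stdGaussian (Rd d)) = _
  have : IsProbabilityMeasure ((stdGaussian (Rd d)).map fun ξ => Real.sqrt 2 • ξ) :=
    Measure.isProbabilityMeasure_map (by fun_prop)
  refine Measure.ext_of_charFun ?_
  ext t
  rw [charFun_conv, charFun_map_smul, charFun_stdGaussian, charFun_stdGaussian, ← Complex.exp_add,
    norm_smul, Real.norm_eq_abs, abs_of_nonneg (Real.sqrt_nonneg 2)]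
  congr 1
  have h2 : ((Real.sqrt 2 : ℝ) : ℂ) ^ 2 = 2 := by
    rw [← Complex.ofReal_pow, Real.sq_sqrt (by norm_num)]; norm_num
  push_cast
  rw [mul_pow, h2]
  ring

theorem pairKernel_map_snd (h : ℝ) (v : Rd d × Rd d) :
    (D.pairKernel h v).map Prod.snd = D.eulerKernel (2 * h) v.2 := by
  have hp' : Measurable fun ξ => D.pairMap h v ξ :=
    ((D.continuous_pairMap h).comp (Continuous.prodMk continuous_const continuous_id)).measurable
  have hadd : Measurable fun ξ : Rd d × Rd d => ξ.1 + ξ.2 := by fun_prop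
  have hf : Measurable fun z : Rd d =>
      v.2 + (2 * h) • D.a v.2 + Real.sqrt h • D.b v.2 z := by fun_prop
  rw [D.pairKernel_apply, Measure.map_map measurable_snd hp']
  change ((stdGaussian (Rd d)).prod (stdGaussian (Rd d))).map
    ((fun z : Rd d => v.2 + (2 * h) • D.a v.2 + Real.sqrt h • D.b v.2 z) ∘
      fun ξ => ξ.1 + ξ.2) = _
  rw [← Measure.map_map hf hadd, stdGaussian_add, Measure.map_map hf (by fun_prop),
    D.eulerKernel_apply]
  congr 1
  ext1 ξ
  simp only [Function.comp_apply, eulerMap, map_smul, smul_smul]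
  rw [mul_comm (Real.sqrt h), ← Real.sqrt_mul (by norm_num : (0 : ℝ) ≤ 2)]

theorem coupledQ_map_fst (l : ℕ) (v : Rd d × Rd d) :
    (D.coupledQ l v).map Prod.fst = D.Q (l + 1) v.1 := by
  rw [coupledQ, map_pow_eq _ _ _ measurable_fst (D.pairKernel_map_fst _), Q, ← pow_mul,
    ← pow_succ']

theorem coupledQ_map_snd (l : ℕ) (v : Rd d × Rd d) :
    (D.coupledQ l v).map Prod.snd = D.Q l v.2 := by
  have h1 : 2 * h (l + 1) = h l := by unfold h; rw [pow_succ]; field_simp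
  rw [coupledQ, map_pow_eq _ _ _ measurable_snd (D.pairKernel_map_snd _), Q, h1]

/-- The potentials `G_n(x) = g(x, y_{n+1})`. -/
def potentials : Potentials (Rd d) where
  val n x := D.g x (D.y (n + 1))
  measurable n := D.measurable_g (n + 1)
  pos n := D.pos_g (n + 1)

/-- The level `l` model: time `p` is the observation time `p + 1`, so that the initial law is the
law of the Euler approximation of `X_1`. -/
def single (l : ℕ) : Single (Rd d) where
  init := D.init.bind (D.Q l)
  M _ := D.Q l

/-- The coupled model of the levels `l + 1` (fine) and `l` (coarse), both started from the same
`X_0`. -/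
def coupled (l : ℕ) : Coupled (Rd d) where
  init := (D.init.map fun x => (x, x)).bind (D.coupledQ l)
  isProb := by
    have : IsProbabilityMeasure (D.init.map fun x : Rd d => (x, x)) :=
      Measure.isProbabilityMeasure_map (by fun_prop)
    infer_instance
  M _ := D.coupledQ l
  M₁ _ := D.Q (l + 1)
  M₂ _ := D.Q l
  map_fst _ := D.coupledQ_map_fst l
  map_snd _ := D.coupledQ_map_snd l

/-- The multilevel model of the Euler approximations. -/
def model : Model (Rd d) where
  G := D.potentials
  base := D.single 0
  pair := D.coupled

/-- The marginal likelihood `p^l(y_{1:n})` of the level `l` Euler approximation. -/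
def likelihood (l n : ℕ) : ℝ := (D.single l).Z D.potentials n

end Diffusion

/-- The cost `∑_{l=0}^{L} N_l h_l^{-1}` of the multilevel particle filter per observation time. -/
def cost (N : ℕ → ℕ+) (L : ℕ) : ℝ := ∑ l ∈ range (L + 1), (N l : ℝ) * (Diffusion.h l)⁻¹

end Euler

end MLPF

end

/-! All errors are measured in L², with explicit constants. Given the particles at time p, those at
time p+1 are i.i.d., so an average of f over them misses its limit by at most ‖f(particle)‖/√N plus
the norm of the error of the conditional mean (`L2Le.avg_bind`). The conditional mean of φ is a
ratio of averages; minus its limit it equals avg(ψ)/avg(G_p), where ψ = G_p(M_p φ − η_{p+1}(φ)) has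
mean zero under η_p. So the error for φ at time p+1 reduces to the error for ψ at time p, and
induction gives the rate N^{-1/2} (`Projects.l2Le_avg_sub`).

For pairs the same scheme is applied to the difference of the two empirical measures. The
fluctuation term now involves φ(U₁) − φ(U₂), which has the size of the truncated distance of a pair.
The difference A₁/g₁ − A₂/g₂ of the two conditional errors expands into differences at time p,
covered by induction because (A) keeps ψ bounded and Lipschitz, and into single-filter errors
multiplied by the distance of the predictors or of the transitions. Hence the error is N^{-1/2}
times an accumulated discrepancy (`PairBounds.l2Le_avg_sub_avg`). Normalizing constants are products
of averages, so their ratio obeys the same kind of bound, with |γ₁(1) − γ₂(1)| added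
(`PairBounds.l2Le_ratio_sub`). `PairBounds` leaves open how the discrepancies are estimated.

The filters are independent, so L² norms of factors multiply. If the factor errors are at most s_l
with sum at most S, and the limits at most 1 + s_l, then all products stay below exp(2S), and
replacing the factors by their limits one at a time gives the multilevel error
(`Model.l2Le_estimator_sub`). For general levels the discrepancies are bounded by B̄, and s_l is a
multiple of the level error.

For Euler levels the discrepancies are instead estimated directly on bounded Lipschitz functions.
The function |x − y|² + h(1 + |x|²) grows by a factor 1 + O(h) per coupled step, so one transition
separates a pair by O(√h). Coupled resampling separates the ancestors only with a probability of the
order of the mean truncated distance. The mean truncated distance therefore stays O(√h), and its L²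
norm O(h^{1/4}), at all times. The factor errors are O(h_l^{1/4}/√N_l), hence summable: this removes
the hypothesis on S. Minimizing ∑ N_l/h_l for a given ∑ h_l^{1/4}/√N_l leads to N_l proportional to
h_l^{5/6}, and to the cost ε^{-5/2}. -/

set_option linter.unusedSectionVars false

noncomputable section

namespace MLPF

/-! ### Calculus of explicit L² bounds -/

section SecondMoments

variable {α β : Type*} [MeasurableSpace α] [MeasurableSpace β] {μ : Measure α}
  {f g : α → ℝ} {r s b : ℝ}

/-- `f` is measurable and its norm in `L²(μ)` is at most `r`. -/
structure L2Le (μ : Measure α) (f : α → ℝ) (r : ℝ) : Prop where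
  meas : Measurable f
  nonneg : 0 ≤ r
  bound : ∫⁻ x, ENNReal.ofReal (f x ^ 2) ∂μ ≤ ENNReal.ofReal (r ^ 2)

theorem eLpNorm_two_sq (μ : Measure α) (f : α → ℝ) :
    eLpNorm f 2 μ ^ 2 = ∫⁻ x, ENNReal.ofReal (f x ^ 2) ∂μ := by
  have h := eLpNorm_nnreal_pow_eq_lintegral (μ := μ) (f := f) (p := 2) (by norm_num)
  have h2 : ((2 : NNReal) : ℝ) = ((2 : ℕ) : ℝ) := by norm_num
  rw [h2, ENNReal.rpow_natCast] at h
  refine Eq.trans (by simpa using h) (lintegral_congr fun x => ?_)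
  rw [← ofReal_norm, ← ENNReal.ofReal_pow (norm_nonneg _), Real.norm_eq_abs, sq_abs]

theorem l2Le_iff (hf : Measurable f) (hr : 0 ≤ r) :
    L2Le μ f r ↔ eLpNorm f 2 μ ≤ ENNReal.ofReal r := by
  have : eLpNorm f 2 μ ≤ ENNReal.ofReal r ↔
      ∫⁻ x, ENNReal.ofReal (f x ^ 2) ∂μ ≤ ENNReal.ofReal (r ^ 2) := by
    rw [← eLpNorm_two_sq, ENNReal.ofReal_pow hr]
    exact (ENNReal.pow_le_pow_left_iff two_ne_zero).symm
  rw [this]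
  exact ⟨fun h => h.bound, fun h => ⟨hf, hr, h⟩⟩

namespace L2Le

theorem eLpNorm_le (h : L2Le μ f r) : eLpNorm f 2 μ ≤ ENNReal.ofReal r :=
  (l2Le_iff h.meas h.nonneg).1 h

theorem memLp (h : L2Le μ f r) : MemLp f 2 μ :=
  ⟨h.meas.aestronglyMeasurable, h.eLpNorm_le.trans_lt ENNReal.ofReal_lt_top⟩

theorem integrable [IsFiniteMeasure μ] (h : L2Le μ f r) : Integrable f μ :=
  h.memLp.integrable (by norm_num)

theorem weaken (h : L2Le μ f r) (hrs : r ≤ s) : L2Le μ f s :=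
  ⟨h.meas, h.nonneg.trans hrs, h.bound.trans (ENNReal.ofReal_le_ofReal
    (pow_le_pow_left₀ h.nonneg hrs 2))⟩

theorem mono (h : L2Le μ f r) (hg : Measurable g) (hgf : ∀ x, |g x| ≤ |f x|) : L2Le μ g r :=
  ⟨hg, h.nonneg, (lintegral_mono fun x => ENNReal.ofReal_le_ofReal
    (sq_le_sq.2 (hgf x))).trans h.bound⟩

theorem add (hf : L2Le μ f r) (hg : L2Le μ g s) : L2Le μ (fun x => f x + g x) (r + s) := by
  refine (l2Le_iff (hf.meas.add hg.meas) (add_nonneg hf.nonneg hg.nonneg)).2 ?_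
  refine (eLpNorm_add_le hf.meas.aestronglyMeasurable hg.meas.aestronglyMeasurable
    (by norm_num)).trans ?_
  rw [ENNReal.ofReal_add hf.nonneg hg.nonneg]
  exact add_le_add hf.eLpNorm_le hg.eLpNorm_le

theorem neg (hf : L2Le μ f r) : L2Le μ (fun x => -f x) r :=
  hf.mono hf.meas.neg fun x => by rw [abs_neg]

theorem sub (hf : L2Le μ f r) (hg : L2Le μ g s) : L2Le μ (fun x => f x - g x) (r + s) := by
  simpa [sub_eq_add_neg] using hf.add hg.neg

theorem const_mul (hf : L2Le μ f r) (c : ℝ) : L2Le μ (fun x => c * f x) (|c| * r) := by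
  refine ⟨hf.meas.const_mul c, mul_nonneg (abs_nonneg c) hf.nonneg, ?_⟩
  simp_rw [mul_pow, sq_abs, ENNReal.ofReal_mul (sq_nonneg c)]
  rw [lintegral_const_mul _ ((hf.meas.pow_const 2).ennreal_ofReal)]
  gcongr
  exact hf.bound

theorem mul_of_abs_le (hf : L2Le μ f r) (hg : Measurable g) (hb : 0 ≤ b) (hgb : ∀ x, |g x| ≤ b) :
    L2Le μ (fun x => g x * f x) (b * r) := by
  have h := (hf.const_mul b).mono (hg.mul hf.meas) fun x => by
    rw [Pi.mul_apply, abs_mul, abs_mul, abs_of_nonneg hb]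
    exact mul_le_mul_of_nonneg_right (hgb x) (abs_nonneg _)
  rwa [abs_of_nonneg hb] at h

theorem of_abs_le_mul (hf : L2Le μ f r) (hg : Measurable g) (hb : 0 ≤ b)
    (hgf : ∀ x, |g x| ≤ b * |f x|) : L2Le μ g (b * r) := by
  have h := (hf.const_mul b).mono hg fun x => by
    rw [abs_mul, abs_of_nonneg hb]; exact hgf x
  rwa [abs_of_nonneg hb] at h

theorem of_abs_le [IsProbabilityMeasure μ] (hf : Measurable f) (hb : 0 ≤ b)
    (hfb : ∀ x, |f x| ≤ b) : L2Le μ f b := by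
  refine ⟨hf, hb, ?_⟩
  calc _ ≤ ∫⁻ _, ENNReal.ofReal (b ^ 2) ∂μ := lintegral_mono fun x => ENNReal.ofReal_le_ofReal
        (sq_le_sq.2 (by rw [abs_of_nonneg hb]; exact hfb x))
    _ = _ := by simp

theorem const [IsProbabilityMeasure μ] (c : ℝ) : L2Le μ (fun _ => c) |c| :=
  of_abs_le measurable_const (abs_nonneg c) fun _ => le_rfl

theorem abs_integral_le [IsProbabilityMeasure μ] (h : L2Le μ f r) : |∫ x, f x ∂μ| ≤ r := by
  have h1 := eLpNorm_le_eLpNorm_of_exponent_le (μ := μ) (p := 1) (q := 2) (by norm_num)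
    h.meas.aestronglyMeasurable
  have h2 : ENNReal.ofReal |∫ x, f x ∂μ| ≤ ENNReal.ofReal r := by
    rw [← Real.norm_eq_abs, ofReal_norm]
    refine (enorm_integral_le_lintegral_enorm f).trans ?_
    rw [← eLpNorm_one_eq_lintegral_enorm]
    exact h1.trans h.eLpNorm_le
  exact (ENNReal.ofReal_le_ofReal_iff h.nonneg).1 h2

theorem integrable_sq (h : L2Le μ f r) : Integrable (fun x => f x ^ 2) μ :=
  h.memLp.integrable_sq

theorem integral_sq_le (h : L2Le μ f r) : ∫ x, f x ^ 2 ∂μ ≤ r ^ 2 := by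
  rw [integral_eq_lintegral_of_nonneg_ae (.of_forall fun x => sq_nonneg _)
    (h.meas.pow_const 2).aestronglyMeasurable]
  exact ENNReal.toReal_le_of_le_ofReal (sq_nonneg r) h.bound

theorem of_integral_sq_le (hf : Measurable f) (hr : 0 ≤ r) (hi : Integrable (fun x => f x ^ 2) μ)
    (h : ∫ x, f x ^ 2 ∂μ ≤ r ^ 2) : L2Le μ f r := by
  refine ⟨hf, hr, ?_⟩
  rw [← ofReal_integral_eq_lintegral_ofReal hi (.of_forall fun x => sq_nonneg _)]
  exact ENNReal.ofReal_le_ofReal h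

theorem congr (h : L2Le μ f r) (hfg : ∀ x, f x = g x) : L2Le μ g r := by
  rwa [← (funext hfg : f = g)]

end L2Le

theorem l2Le_map_iff {T : α → β} (hT : Measurable T) {f : β → ℝ} (hf : Measurable f) :
    L2Le (μ.map T) f r ↔ L2Le μ (fun x => f (T x)) r := by
  have : ∫⁻ x, ENNReal.ofReal (f x ^ 2) ∂(μ.map T) = ∫⁻ x, ENNReal.ofReal (f (T x) ^ 2) ∂μ :=
    lintegral_map (hf.pow_const 2).ennreal_ofReal hT
  exact ⟨fun h => ⟨hf.comp hT, h.nonneg, this ▸ h.bound⟩, fun h => ⟨hf, h.nonneg, this ▸ h.bound⟩⟩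

end SecondMoments

/-! ### Mixtures, path laws and averages of conditionally i.i.d. particles -/

section Kernels

variable {α β ι : Type*} [MeasurableSpace α] [MeasurableSpace β]

theorem lintegral_mixture [Fintype ι] (q : ι → α → ℝ) (hq : ∀ i, Measurable (q i))
    (K : ι → Kernel α β) (a : α) (f : β → ℝ≥0∞) :
    ∫⁻ y, f y ∂(mixture q hq K a) = ∑ i, ENNReal.ofReal (q i a) * ∫⁻ y, f y ∂(K i a) := by
  change ∫⁻ y, f y ∂(∑ i, ENNReal.ofReal (q i a) • K i a) = _
  rw [lintegral_finsetSum_measure]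
  simp only [lintegral_smul_measure, smul_eq_mul]

theorem integral_mixture [Fintype ι] (q : ι → α → ℝ) (hq : ∀ i, Measurable (q i))
    (K : ι → Kernel α β) (h0 : ∀ i a, 0 ≤ q i a) (a : α) (f : β → ℝ)
    (hf : ∀ i, Integrable f (K i a)) :
    ∫ y, f y ∂(mixture q hq K a) = ∑ i, q i a * ∫ y, f y ∂(K i a) := by
  change ∫ y, f y ∂(∑ i, ENNReal.ofReal (q i a) • K i a) = _
  rw [integral_finsetSum_measure fun i _ => (hf i).smul_measure ENNReal.ofReal_ne_top]
  simp only [integral_smul_measure, smul_eq_mul, ENNReal.toReal_ofReal (h0 _ a)]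

theorem chainLaw_map_zero (μ : Measure β) [IsProbabilityMeasure μ] (K : ℕ → Kernel β β)
    [∀ p, IsMarkovKernel (K p)] : (chainLaw μ K).map (fun ω => ω 0) = μ := by
  have h : (chainLaw μ K).map (Preorder.frestrictLe 0) =
      μ.map (MeasurableEquiv.piUnique (fun _ : Iic 0 => β)).symm := by
    rw [chainLaw, Kernel.trajMeasure, Measure.map_comp _ _ (by fun_prop),
      Kernel.traj_map_frestrictLe, Kernel.partialTraj_self, Measure.id_comp]
  have h2 : (fun ω : ℕ → β => ω 0) =
      MeasurableEquiv.piUnique (fun _ : Iic 0 => β) ∘ Preorder.frestrictLe 0 := rfl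
  rw [h2, ← Measure.map_map (MeasurableEquiv.measurable _) (by fun_prop), h,
    MeasurableEquiv.map_map_symm]

/-- The trajectory kernel looks only at the last coordinate of the past, so the joint law of past
and next state projects to a one-step recursion of the time marginals. Only these marginals of the
path law enter the error estimates. -/
theorem chainLaw_map_succ (μ : Measure β) [IsProbabilityMeasure μ] (K : ℕ → Kernel β β)
    [∀ p, IsMarkovKernel (K p)] (p : ℕ) :
    (chainLaw μ K).map (fun ω => ω (p + 1)) = ((chainLaw μ K).map fun ω => ω p).bind (K p) := by
  have h := Kernel.map_frestrictLe_trajMeasure_compProd_eq_map_trajMeasure (X := fun _ => β)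
    (μ₀ := μ) (κ := fun p => (K p).comap (fun h : (i : Iic p) → β => h ⟨p, mem_Iic.2 le_rfl⟩)
      (measurable_pi_apply _)) (a := p)
  change ((chainLaw μ K).map (Preorder.frestrictLe p)).compProd _ = (chainLaw μ K).map _ at h
  have h2 : (chainLaw μ K).map (fun ω => ω (p + 1)) =
      ((chainLaw μ K).map (fun ω => (Preorder.frestrictLe p ω, ω (p + 1)))).map Prod.snd := by
    rw [Measure.map_map (by fun_prop) (by fun_prop)]; rfl
  rw [h2, ← h]
  have h3 : (chainLaw μ K).map (fun ω => ω p) = ((chainLaw μ K).map (Preorder.frestrictLe p)).map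
      (fun h : (i : Iic p) → β => h ⟨p, mem_Iic.2 le_rfl⟩) := by
    rw [Measure.map_map (by fun_prop) (by fun_prop)]; rfl
  have : IsProbabilityMeasure ((chainLaw μ K).map (Preorder.frestrictLe (π := fun _ => β) p)) :=
    Measure.isProbabilityMeasure_map (by fun_prop)
  change Measure.snd _ = _
  rw [Measure.snd_compProd, h3]
  ext t ht
  have hm : Measurable fun h : (i : Iic p) → β => h ⟨p, mem_Iic.2 le_rfl⟩ := by fun_prop
  rw [Measure.bind_apply ht (Kernel.aemeasurable _), Measure.bind_apply ht (Kernel.aemeasurable _),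
    lintegral_map (Kernel.measurable_coe _ ht) hm]
  rfl

section Averages

variable {N : ℕ}

variable {γ : Type*}

/-- The integral of `f` against the empirical measure of `y`. -/
def avg (f : γ → ℝ) (y : Fin N → γ) : ℝ := (1 / (N : ℝ)) * ∑ i, f (y i)

theorem measurable_avg {f : β → ℝ} (hf : Measurable f) :
    Measurable fun y : Fin N → β => avg f y := by
  unfold avg; fun_prop

theorem avg_sub (f g : γ → ℝ) (y : Fin N → γ) : avg (fun x => f x - g x) y = avg f y - avg g y := by
  simp only [avg, sum_sub_distrib, mul_sub]

theorem avg_const_mul (c : ℝ) (f : γ → ℝ) (y : Fin N → γ) :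
    avg (fun x => c * f x) y = c * avg f y := by
  simp only [avg, ← mul_sum]; ring

theorem avg_const [NeZero N] (c : ℝ) (y : Fin N → γ) : avg (fun _ => c) y = c := by
  have : (N : ℝ) ≠ 0 := NeZero.ne _
  simp [avg, this]

theorem avg_mono {f g : γ → ℝ} (h : ∀ x, f x ≤ g x) (y : Fin N → γ) : avg f y ≤ avg g y := by
  unfold avg
  gcongr
  exact h _

theorem le_avg [NeZero N] {f : γ → ℝ} {b : ℝ} (h : ∀ x, b ≤ f x) (y : Fin N → γ) :
    b ≤ avg f y := (avg_const b y).symm.trans_le (avg_mono h y)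

theorem avg_le [NeZero N] {f : γ → ℝ} {b : ℝ} (h : ∀ x, f x ≤ b) (y : Fin N → γ) :
    avg f y ≤ b := (avg_mono h y).trans_eq (avg_const b y)

theorem abs_avg_le [NeZero N] {f : γ → ℝ} {b : ℝ} (h : ∀ x, |f x| ≤ b) (y : Fin N → γ) :
    |avg f y| ≤ b :=
  abs_le.2 ⟨le_avg (fun x => (abs_le.1 (h x)).1) y, avg_le (fun x => (abs_le.1 (h x)).2) y⟩

/-- The mean square error of an average of i.i.d. variables. -/
theorem lintegral_avg_sub_sq_le [NeZero N] {ν : Measure β} [IsProbabilityMeasure ν] {f : β → ℝ}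
    (hf : Measurable f) (h2 : MemLp f 2 ν) (t : ℝ) :
    ∫⁻ y, ENNReal.ofReal ((avg f y - t) ^ 2) ∂(Measure.pi fun _ : Fin N => ν) ≤
      (∫⁻ x, ENNReal.ofReal (f x ^ 2) ∂ν) * ENNReal.ofReal (1 / N) +
        ENNReal.ofReal ((∫ x, f x ∂ν - t) ^ 2) := by
  have hN : (N : ℝ) ≠ 0 := NeZero.ne _
  set P := Measure.pi fun _ : Fin N => ν with hP
  have hfi : ∀ i : Fin N, MemLp (fun y : Fin N → β => f (y i)) 2 P := fun i =>
    h2.comp_measurePreserving (measurePreserving_eval (fun _ => ν) i)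
  have hS : MemLp (∑ i : Fin N, fun y : Fin N → β => f (y i)) 2 P := memLp_finsetSum' _ fun i _ => hfi i
  have havg : (fun y : Fin N → β => avg f y) =
      fun y => (1 / (N : ℝ)) * (∑ i : Fin N, fun y : Fin N → β => f (y i)) y := by
    ext y; simp [avg]
  have hA : MemLp (fun y : Fin N → β => avg f y) 2 P := havg ▸ hS.const_mul _
  have hmean : ∫ y, avg f y ∂P = ∫ x, f x ∂ν := by
    unfold avg
    rw [integral_const_mul, integral_finsetSum _ fun i _ => (hfi i).integrable (by norm_num)]
    have : ∀ i : Fin N, ∫ y, f (y i) ∂P = ∫ x, f x ∂ν := fun i => by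
      have h := integral_map (μ := P) (measurable_pi_apply i).aemeasurable
        (hf.aestronglyMeasurable (μ := P.map fun y => y i))
      rw [← h]
      exact congrArg (fun m => ∫ x, f x ∂m) (measurePreserving_eval (fun _ : Fin N => ν) i).map_eq
    simp [this]; field_simp
  have hvar : Var[fun y : Fin N → β => avg f y; P] = (1 / N) * Var[f; ν] := by
    rw [havg, variance_const_mul, variance_sum_pi fun _ => h2]
    simp; field_simp
  have hvar2 := variance_eq_sub hA
  have hvar3 := variance_eq_sub h2
  have hsq : ∫ y, (avg f y - t) ^ 2 ∂P =
      (∫ y, avg f y ^ 2 ∂P) - 2 * t * (∫ y, avg f y ∂P) + t ^ 2 := by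
    have : ∀ y : Fin N → β, (avg f y - t) ^ 2 = avg f y ^ 2 - 2 * t * avg f y + t ^ 2 := fun y => by ring
    simp_rw [this]
    have hi := hA.integrable (by norm_num : (1 : ℝ≥0∞) ≤ 2)
    have h1 : Integrable (fun y => avg f y ^ 2 - 2 * t * avg f y) P :=
      hA.integrable_sq.sub (hi.const_mul (2 * t))
    rw [integral_add h1 (integrable_const _), integral_sub hA.integrable_sq (hi.const_mul _),
      integral_const_mul]
    simp
  have hint : Integrable (fun y : Fin N → β => (avg f y - t) ^ 2) P :=
    (hA.sub (memLp_const t)).integrable_sq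
  rw [← ofReal_integral_eq_lintegral_ofReal hint (.of_forall fun _ => sq_nonneg _),
    ← ofReal_integral_eq_lintegral_ofReal h2.integrable_sq (.of_forall fun _ => sq_nonneg _),
    ← ENNReal.ofReal_mul (integral_nonneg fun _ => sq_nonneg _),
    ← ENNReal.ofReal_add (by positivity) (sq_nonneg _)]
  refine ENNReal.ofReal_le_ofReal ?_
  simp only [Pi.pow_apply] at hvar2 hvar3
  rw [hmean] at hsq hvar2
  -- Bias and variance: the variance of f is its second moment minus the squared mean, and the
  -- latter is dropped.
  have : 0 ≤ (1 / (N : ℝ)) * (∫ x, f x ∂ν) ^ 2 := by positivity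
  rw [hsq, show ∫ y, avg f y ^ 2 ∂P = Var[fun y => avg f y; P] + (∫ x, f x ∂ν) ^ 2 by
    linarith, hvar, hvar3]
  linarith

/-- Averages of i.i.d. variables whose law is chosen at random. -/
theorem L2Le.avg_bind [NeZero N] {m : Measure α} [IsProbabilityMeasure m] (K : Kernel α β)
    [IsMarkovKernel K] {f : β → ℝ} {r s t : ℝ} (hr : L2Le (m.bind K) f r)
    (hs : L2Le m (fun x => ∫ y, f y ∂(K x) - t) s) :
    L2Le (m.bind (iidKernel (Fin N) K)) (fun y => avg f y - t) (r / Real.sqrt N + s) := by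
  have hN : (0 : ℝ) < N := by exact_mod_cast Nat.pos_of_neZero N
  have hmf := (hr.meas.pow_const 2).ennreal_ofReal
  have hrs : 0 ≤ r / Real.sqrt N := div_nonneg hr.nonneg (Real.sqrt_nonneg _)
  refine ⟨(measurable_avg hr.meas).sub_const t, add_nonneg hrs hs.nonneg, ?_⟩
  have hb := hr.bound
  rw [Measure.lintegral_bind (Kernel.aemeasurable _) hmf.aemeasurable] at hb
  have hmK : Measurable fun x => ∫⁻ y, ENNReal.ofReal (f y ^ 2) ∂(K x) := hmf.lintegral_kernel
  -- Only the averaged second moment is known to be finite; almost every conditional law then has a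
  -- finite one, which the variance bound requires.
  have hae := ae_lt_top hmK (hb.trans_lt ENNReal.ofReal_lt_top).ne
  have hmf2 := ((measurable_avg (N := N) hr.meas).sub_const t).pow_const 2 |>.ennreal_ofReal
  rw [Measure.lintegral_bind (Kernel.aemeasurable _) hmf2.aemeasurable]
  calc _ ≤ ∫⁻ x, ((∫⁻ y, ENNReal.ofReal (f y ^ 2) ∂(K x)) * ENNReal.ofReal (1 / N) +
        ENNReal.ofReal ((∫ y, f y ∂(K x) - t) ^ 2)) ∂m := by
        refine lintegral_mono_ae ?_
        filter_upwards [hae] with x hx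
        refine lintegral_avg_sub_sq_le hr.meas ⟨hr.meas.aestronglyMeasurable, ?_⟩ t
        rw [← eLpNorm_two_sq] at hx
        exact lt_top_iff_ne_top.2 fun h => by simp [h] at hx
    _ = (∫⁻ x, (∫⁻ y, ENNReal.ofReal (f y ^ 2) ∂(K x)) ∂m) * ENNReal.ofReal (1 / N) +
        ∫⁻ x, ENNReal.ofReal ((∫ y, f y ∂(K x) - t) ^ 2) ∂m := by
        rw [lintegral_add_left (hmK.mul_const _), lintegral_mul_const _ hmK]
    _ ≤ ENNReal.ofReal (r ^ 2) * ENNReal.ofReal (1 / N) + ENNReal.ofReal (s ^ 2) := by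
        gcongr
        exact hs.bound
    _ = ENNReal.ofReal ((r / Real.sqrt N) ^ 2 + s ^ 2) := by
        rw [← ENNReal.ofReal_mul (sq_nonneg _), ← ENNReal.ofReal_add (by positivity) (sq_nonneg _),
          div_pow, Real.sq_sqrt hN.le]
        congr 2; ring
    _ ≤ _ := ENNReal.ofReal_le_ofReal (by nlinarith [mul_nonneg hrs hs.nonneg])

theorem L2Le.avg_pi [NeZero N] {ν : Measure β} [IsProbabilityMeasure ν] {f : β → ℝ} {r : ℝ}
    (hr : L2Le ν f r) : L2Le (Measure.pi fun _ : Fin N => ν) (fun y => avg f y - ∫ x, f x ∂ν)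
      (r / Real.sqrt N) := by
  have hN : (0 : ℝ) < N := by exact_mod_cast Nat.pos_of_neZero N
  refine ⟨(measurable_avg hr.meas).sub_const _, div_nonneg hr.nonneg (Real.sqrt_nonneg _), ?_⟩
  refine (lintegral_avg_sub_sq_le hr.meas hr.memLp _).trans ?_
  rw [sub_self, div_pow, Real.sq_sqrt hN.le, div_eq_mul_one_div (r ^ 2),
    ENNReal.ofReal_mul (sq_nonneg r)]
  simp only [ne_eq, OfNat.ofNat_ne_zero, not_false_eq_true, zero_pow, ENNReal.ofReal_zero, add_zero]
  gcongr
  exact hr.bound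

theorem map_eval_iidKernel (K : Kernel α β) [IsMarkovKernel K] (m : Measure α) (i : Fin N) :
    (m.bind (iidKernel (Fin N) K)).map (fun y => y i) = m.bind K := by
  ext t ht
  have hm : MeasurableSet ((fun y : Fin N → β => y i) ⁻¹' t) := measurable_pi_apply i ht
  rw [Measure.map_apply (measurable_pi_apply i) ht, Measure.bind_apply hm (Kernel.aemeasurable _),
    Measure.bind_apply ht (Kernel.aemeasurable _)]
  refine lintegral_congr fun x => ?_
  exact (measurePreserving_eval (fun _ : Fin N => K x) i).measure_preimage ht.nullMeasurableSet

end Averages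

end Kernels

/-! ### Feynman-Kac flows with bounded potentials, and weighted test functions -/

/-- The potentials take values between `c⁻¹` and `c`, where `c ≥ 1`. -/
structure Potentials.Bounded {U : Type*} [MeasurableSpace U] (G : Potentials U) (c : ℝ) : Prop where
  one_le : 1 ≤ c
  lower : ∀ n u, c⁻¹ ≤ G.val n u
  upper : ∀ n u, G.val n u ≤ c

section FeynmanKac

variable {U : Type*} [MeasurableSpace U] {G : Potentials U} {c : ℝ} {μ : Measure U}
  [IsProbabilityMeasure μ] {M : ℕ → Kernel U U} [∀ p, IsMarkovKernel (M p)]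

theorem Potentials.Bounded.pos (hG : G.Bounded c) : 0 < c := one_pos.trans_le hG.one_le

theorem Potentials.Bounded.abs_le (hG : G.Bounded c) (n : ℕ) (u : U) : |G.val n u| ≤ c := by
  rw [abs_of_pos (G.pos n u)]; exact hG.upper n u

theorem integral_bind_kernel {α β : Type*} [MeasurableSpace α] [MeasurableSpace β]
    {m : Measure α} {K : Kernel α β} {f : β → ℝ} (hf : Integrable f (m.bind K)) :
    ∫ y, f y ∂(m.bind K) = ∫ x, ∫ y, f y ∂(K x) ∂m := by
  rw [Measure.comp_eq_comp_const_apply] at hf ⊢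
  rw [Kernel.integral_comp hf, Kernel.const_apply]

theorem lintegral_unnormalized_succ (n : ℕ) {f : U → ℝ≥0∞} (hf : Measurable f) :
    ∫⁻ u, f u ∂(unnormalized G μ M (n + 1)) =
      ∫⁻ u, ENNReal.ofReal (G.val n u) * ∫⁻ y, f y ∂(M n u) ∂(unnormalized G μ M n) := by
  rw [unnormalized, Measure.lintegral_bind (Kernel.aemeasurable _) hf.aemeasurable,
    lintegral_withDensity_eq_lintegral_mul _ (G.measurable n).ennreal_ofReal hf.lintegral_kernel]
  rfl

theorem unnormalized_succ_univ (n : ℕ) : unnormalized G μ M (n + 1) Set.univ =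
    ∫⁻ u, ENNReal.ofReal (G.val n u) ∂(unnormalized G μ M n) := by
  rw [← lintegral_one, lintegral_unnormalized_succ n measurable_const]
  simp

theorem isFiniteMeasure_unnormalized (hG : G.Bounded c) (n : ℕ) :
    IsFiniteMeasure (unnormalized G μ M n) := by
  induction n with
  | zero => rw [unnormalized]; infer_instance
  | succ n ih =>
    refine ⟨?_⟩
    rw [unnormalized_succ_univ]
    calc _ ≤ ∫⁻ _, ENNReal.ofReal c ∂(unnormalized G μ M n) :=
          lintegral_mono fun u => ENNReal.ofReal_le_ofReal (hG.upper n u)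
      _ < ⊤ := by
          rw [lintegral_const]
          exact ENNReal.mul_lt_top ENNReal.ofReal_lt_top (measure_lt_top _ _)

theorem ofReal_inv_mul_unnormalized_le (hG : G.Bounded c) (n : ℕ) :
    ENNReal.ofReal c⁻¹ * unnormalized G μ M n Set.univ ≤ unnormalized G μ M (n + 1) Set.univ := by
  rw [unnormalized_succ_univ, ← lintegral_const]
  exact lintegral_mono fun u => ENNReal.ofReal_le_ofReal (hG.lower n u)

theorem unnormalized_univ_ne_zero (hG : G.Bounded c) (n : ℕ) :
    unnormalized G μ M n Set.univ ≠ 0 := by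
  induction n with
  | zero => rw [unnormalized]; simp
  | succ n ih =>
    refine fun h => ih ?_
    have h2 := ofReal_inv_mul_unnormalized_le (μ := μ) (M := M) hG n
    rw [h, nonpos_iff_eq_zero, mul_eq_zero] at h2
    exact h2.resolve_left (ENNReal.ofReal_pos.2 (inv_pos.2 hG.pos)).ne'

theorem isProbabilityMeasure_predictor (hG : G.Bounded c) (n : ℕ) :
    IsProbabilityMeasure (predictor G μ M n) := by
  have := isFiniteMeasure_unnormalized (μ := μ) (M := M) hG n
  refine ⟨?_⟩
  rw [predictor, Measure.smul_apply, smul_eq_mul]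
  exact ENNReal.inv_mul_cancel (unnormalized_univ_ne_zero hG n) (measure_ne_top _ _)

theorem normConst_pos (hG : G.Bounded c) (n : ℕ) : 0 < normConst G μ M n := by
  have := isFiniteMeasure_unnormalized (μ := μ) (M := M) hG n
  exact ENNReal.toReal_pos (unnormalized_univ_ne_zero hG n) (measure_ne_top _ _)

theorem normConst_zero : normConst G μ M 0 = 1 := by simp [normConst, unnormalized]

theorem predictor_zero : predictor G μ M 0 = μ := by simp [predictor, unnormalized]

theorem integral_predictor (n : ℕ) (f : U → ℝ) : ∫ u, f u ∂(predictor G μ M n) =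
    (normConst G μ M n)⁻¹ * ∫ u, f u ∂(unnormalized G μ M n) := by
  rw [predictor, integral_smul_measure, ENNReal.toReal_inv, smul_eq_mul]; rfl

theorem integral_unnormalized (hG : G.Bounded c) (n : ℕ) (f : U → ℝ) :
    ∫ u, f u ∂(unnormalized G μ M n) = normConst G μ M n * ∫ u, f u ∂(predictor G μ M n) := by
  rw [integral_predictor, ← mul_assoc, mul_inv_cancel₀ (normConst_pos hG n).ne', one_mul]

theorem integrable_unnormalized_iff (hG : G.Bounded c) (n : ℕ) {f : U → ℝ} :
    Integrable f (predictor G μ M n) ↔ Integrable f (unnormalized G μ M n) := by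
  have := isFiniteMeasure_unnormalized (μ := μ) (M := M) hG n
  exact integrable_smul_measure (ENNReal.inv_ne_zero.2 (measure_ne_top _ _))
    (ENNReal.inv_ne_top.2 (unnormalized_univ_ne_zero hG n))

theorem integral_unnormalized_succ (n : ℕ) {f : U → ℝ}
    (hf : Integrable f (unnormalized G μ M (n + 1))) :
    ∫ u, f u ∂(unnormalized G μ M (n + 1)) =
      ∫ u, G.val n u * ∫ y, f y ∂(M n u) ∂(unnormalized G μ M n) := by
  rw [unnormalized] at hf ⊢
  rw [integral_bind_kernel hf, integral_withDensity_eq_integral_toReal_smul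
    (G.measurable n).ennreal_ofReal (.of_forall fun _ => ENNReal.ofReal_lt_top)]
  simp only [ENNReal.toReal_ofReal (G.pos n _).le, smul_eq_mul]

theorem normConst_succ (hG : G.Bounded c) (n : ℕ) : normConst G μ M (n + 1) =
    normConst G μ M n * ∫ u, G.val n u ∂(predictor G μ M n) := by
  have := isFiniteMeasure_unnormalized (μ := μ) (M := M) hG (n + 1)
  have h := integral_unnormalized_succ (G := G) (μ := μ) (M := M) n (f := fun _ => 1)
    (integrable_const _)
  simp only [integral_const, probReal_univ, smul_eq_mul, mul_one] at h
  rw [← integral_unnormalized hG, ← h]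
  rfl

theorem integrable_val (hG : G.Bounded c) (ν : Measure U) [IsFiniteMeasure ν] (n : ℕ) :
    Integrable (G.val n) ν :=
  .of_bound (G.measurable n).aestronglyMeasurable c (.of_forall fun u => by
    rw [Real.norm_eq_abs]; exact hG.abs_le n u)

theorem le_integral_val (hG : G.Bounded c) (ν : Measure U) [IsProbabilityMeasure ν] (n : ℕ) :
    c⁻¹ ≤ ∫ u, G.val n u ∂ν := by
  have h := integral_mono (integrable_const c⁻¹) (integrable_val hG ν n) (hG.lower n)
  simpa using h

theorem integral_val_le (hG : G.Bounded c) (ν : Measure U) [IsProbabilityMeasure ν] (n : ℕ) :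
    ∫ u, G.val n u ∂ν ≤ c := by
  have h := integral_mono (integrable_val hG ν n) (integrable_const c) (hG.upper n)
  simpa using h

theorem integral_predictor_succ (hG : G.Bounded c) (n : ℕ) {f : U → ℝ}
    (hf : Integrable f (predictor G μ M (n + 1))) :
    ∫ u, f u ∂(predictor G μ M (n + 1)) =
      (∫ u, G.val n u * ∫ y, f y ∂(M n u) ∂(predictor G μ M n)) /
        ∫ u, G.val n u ∂(predictor G μ M n) := by
  rw [integral_predictor, integral_unnormalized_succ n ((integrable_unnormalized_iff hG _).1 hf),
    normConst_succ hG, integral_unnormalized hG]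
  have := (normConst_pos (μ := μ) (M := M) hG n).ne'
  field_simp

/-- One factor `c` bounds the potential, the other the ratio of successive total masses. Stated for
lower integrals, it propagates moments before their finiteness is known. -/
theorem lintegral_predictor_succ_le (hG : G.Bounded c) (n : ℕ) {f : U → ℝ≥0∞}
    (hf : Measurable f) : ∫⁻ u, f u ∂(predictor G μ M (n + 1)) ≤
      ENNReal.ofReal (c ^ 2) * ∫⁻ u, ∫⁻ y, f y ∂(M n u) ∂(predictor G μ M n) := by
  have h0 := unnormalized_univ_ne_zero (μ := μ) (M := M) hG n
  have hc : ENNReal.ofReal c ≠ 0 := (ENNReal.ofReal_pos.2 hG.pos).ne'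
  rw [predictor, predictor, lintegral_smul_measure, lintegral_smul_measure,
    lintegral_unnormalized_succ n hf, smul_eq_mul, smul_eq_mul]
  calc _ ≤ (ENNReal.ofReal c⁻¹ * unnormalized G μ M n Set.univ)⁻¹ *
        ∫⁻ u, ENNReal.ofReal c * ∫⁻ y, f y ∂(M n u) ∂(unnormalized G μ M n) := by
        gcongr with u
        · exact ofReal_inv_mul_unnormalized_le hG n
        · exact hG.upper n u
    _ = _ := by
        rw [lintegral_const_mul _ hf.lintegral_kernel, ENNReal.ofReal_inv_of_pos hG.pos,
          ENNReal.mul_inv (.inl (ENNReal.inv_ne_zero.2 ENNReal.ofReal_ne_top)) (.inr h0), inv_inv,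
          ENNReal.ofReal_pow hG.pos.le]
        ring

/-- A weight `V ≥ 1` with square integrability propagated by the transitions, with constant `a`. -/
structure Weight (μ : Measure U) (M : ℕ → Kernel U U) (V : U → ℝ) (a : ℝ) : Prop where
  one_le : ∀ u, 1 ≤ V u
  init : L2Le μ V a
  step : ∀ p u, L2Le (M p u) V (a * V u)

/-- The bound of the norm of a weight at time `p`. -/
def moment (c a : ℝ) (p : ℕ) : ℝ := (c * a) ^ p * a

/-- The functions that are bounded by `w • V`. -/
structure WeightLe (V φ : U → ℝ) (w : ℝ) : Prop where
  meas : Measurable φ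
  nonneg : 0 ≤ w
  le : ∀ u, |φ u| ≤ w * V u

namespace Weight

variable {V φ : U → ℝ} {a w : ℝ}

/-- With the constant weight, weighted functions are just bounded ones; this serves the general
levels. For Euler schemes the transitions of two levels differ by an amount that grows with the
starting point, and `sqrtWeight` is needed. -/
theorem trivial : Weight μ M (fun _ => 1) 1 :=
  ⟨fun _ => le_rfl, L2Le.of_abs_le measurable_const zero_le_one (by simp), fun p u =>
    L2Le.of_abs_le measurable_const (by simp) (by simp)⟩

theorem pos (hV : Weight μ M V a) (u : U) : 0 < V u := one_pos.trans_le (hV.one_le u)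

theorem meas (hV : Weight μ M V a) : Measurable V := hV.init.meas

theorem nonneg (hV : Weight μ M V a) : 0 ≤ a := hV.init.nonneg

theorem moment_nonneg (hV : Weight μ M V a) (hG : G.Bounded c) (p : ℕ) : 0 ≤ moment c a p :=
  mul_nonneg (pow_nonneg (mul_nonneg hG.pos.le hV.nonneg) p) hV.nonneg

theorem l2Le (hV : Weight μ M V a) (hφ : WeightLe V φ w) {ν : Measure U} {r : ℝ}
    (h : L2Le ν V r) : L2Le ν φ (w * r) :=
  h.of_abs_le_mul hφ.meas hφ.nonneg fun u => by rw [abs_of_pos (hV.pos u)]; exact hφ.le u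

/-- Each time step multiplies the squared norm of `V` by at most `c ^ 2` for the reweighting and `a
^ 2` for the transition. -/
theorem l2Le_predictor (hV : Weight μ M V a) (hG : G.Bounded c) (p : ℕ) :
    L2Le (predictor G μ M p) V (moment c a p) := by
  induction p with
  | zero => rw [predictor_zero]; simpa [moment] using hV.init
  | succ p ih =>
    refine ⟨hV.meas, hV.moment_nonneg hG _, ?_⟩
    refine (lintegral_predictor_succ_le hG p (hV.meas.pow_const 2).ennreal_ofReal).trans ?_
    calc _ ≤ ENNReal.ofReal (c ^ 2) *
          ∫⁻ u, ENNReal.ofReal (a ^ 2) * ENNReal.ofReal (V u ^ 2) ∂(predictor G μ M p) := by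
          gcongr with u
          rw [← ENNReal.ofReal_mul (sq_nonneg a), ← mul_pow]
          exact (hV.step p u).bound
      _ ≤ ENNReal.ofReal (c ^ 2) * (ENNReal.ofReal (a ^ 2) *
            ENNReal.ofReal (moment c a p ^ 2)) := by
          rw [lintegral_const_mul _ (hV.meas.pow_const 2).ennreal_ofReal]
          gcongr
          exact ih.bound
      _ = _ := by
          rw [← ENNReal.ofReal_mul (sq_nonneg a), ← ENNReal.ofReal_mul (sq_nonneg c)]
          congr 1
          simp only [moment, pow_succ]; ring

theorem integrable_step (hV : Weight μ M V a) (hφ : WeightLe V φ w) (p : ℕ) (u : U) :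
    Integrable φ (M p u) := (hV.l2Le hφ (hV.step p u)).integrable

theorem integrable_predictor (hV : Weight μ M V a) (hG : G.Bounded c) (hφ : WeightLe V φ w)
    (p : ℕ) : Integrable φ (predictor G μ M p) := by
  have := isProbabilityMeasure_predictor (μ := μ) (M := M) hG p
  exact (hV.l2Le hφ (hV.l2Le_predictor hG p)).integrable

theorem abs_integral_predictor_le (hV : Weight μ M V a) (hG : G.Bounded c) (hφ : WeightLe V φ w)
    (p : ℕ) : |∫ u, φ u ∂(predictor G μ M p)| ≤ w * moment c a p := by
  have := isProbabilityMeasure_predictor (μ := μ) (M := M) hG p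
  exact (hV.l2Le hφ (hV.l2Le_predictor hG p)).abs_integral_le

theorem weightLe_step (hV : Weight μ M V a) (hφ : WeightLe V φ w) (p : ℕ) :
    WeightLe V (fun u => ∫ y, φ y ∂(M p u)) (w * a) :=
  ⟨hφ.meas.stronglyMeasurable.integral_kernel.measurable, mul_nonneg hφ.nonneg hV.nonneg,
    fun u => by
      rw [mul_assoc]; exact (hV.l2Le hφ (hV.step p u)).abs_integral_le⟩

theorem weightLe_val (hV : Weight μ M V a) (hG : G.Bounded c) (p : ℕ) :
    WeightLe V (G.val p) c :=
  ⟨G.measurable p, hG.pos.le, fun u => (hG.abs_le p u).trans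
    (le_mul_of_one_le_right hG.pos.le (hV.one_le u))⟩

end Weight

/-- The function `G_p (M_p(φ) - R)`, where `R` is the integral of `φ` against the predictor at time
`p + 1`; its integral against the predictor at time `p` is zero. -/
def centred (G : Potentials U) (μ : Measure U) (M : ℕ → Kernel U U) (φ : U → ℝ) (p : ℕ) (u : U) : ℝ :=
  G.val p u * ∫ y, φ y ∂(M p u) - (∫ y, φ y ∂(predictor G μ M (p + 1))) * G.val p u

variable {V φ : U → ℝ} {a w : ℝ}

theorem Weight.weightLe_centred (hV : Weight μ M V a) (hG : G.Bounded c) (hφ : WeightLe V φ w)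
    (p : ℕ) : WeightLe V (centred G μ M φ p) (c * (a + moment c a (p + 1)) * w) := by
  have h1 := hV.weightLe_step hφ p
  have hm := hV.moment_nonneg hG (p + 1)
  have ha := hV.nonneg
  have hw := hφ.nonneg
  have hc := hG.pos.le
  refine ⟨((G.measurable p).mul h1.meas).sub ((G.measurable p).const_mul _), by positivity,
    fun u => ?_⟩
  have hR := hV.abs_integral_predictor_le hG hφ (p + 1)
  have hV1 := hV.one_le u
  calc _ ≤ |G.val p u * ∫ y, φ y ∂(M p u)| +
        |(∫ y, φ y ∂(predictor G μ M (p + 1))) * G.val p u| := abs_sub _ _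
    _ ≤ c * (w * a * V u) + w * moment c a (p + 1) * c := by
        rw [abs_mul, abs_mul]
        gcongr
        · exact hG.abs_le p u
        · exact h1.le u
        · exact hG.abs_le p u
    _ ≤ c * (w * a * V u) + w * moment c a (p + 1) * c * V u := by
        have := le_mul_of_one_le_right (by positivity : 0 ≤ w * moment c a (p + 1) * c) hV1
        linarith
    _ = _ := by ring

/-- By the recursion of the predictors, the subtracted constant is the integral of `G_p M_p(φ)`
under the predictor at time `p`, divided by that of `G_p`. This cancellation turns the bias of a new
particle into an ordinary error of an empirical mean. -/
theorem integral_centred (hG : G.Bounded c) (hV : Weight μ M V a) (hφ : WeightLe V φ w)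
    (p : ℕ) : ∫ u, centred G μ M φ p u ∂(predictor G μ M p) = 0 := by
  have := isProbabilityMeasure_predictor (μ := μ) (M := M) hG p
  have hi : Integrable (fun u => G.val p u * ∫ y, φ y ∂(M p u)) (predictor G μ M p) :=
    (hV.integrable_predictor hG (hV.weightLe_step hφ p) p).bdd_mul
      (G.measurable p).aestronglyMeasurable (.of_forall fun u => hG.abs_le p u)
  have hg := integrable_val hG (predictor G μ M p) p
  have h0 : 0 < ∫ u, G.val p u ∂(predictor G μ M p) :=
    (inv_pos.2 hG.pos).trans_le (le_integral_val hG _ p)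
  unfold centred
  rw [integral_sub hi (hg.const_mul _), integral_const_mul,
    integral_predictor_succ hG p (hV.integrable_predictor hG hφ (p + 1))]
  field_simp
  ring

end FeynmanKac

/-! ### Mean square error of a single particle filter -/

section ParticleSystems

variable {U W : Type*} [MeasurableSpace U] [MeasurableSpace W] {G : Potentials U} {c : ℝ}

theorem Potentials.Bounded.weight_le (hG : G.Bounded c) {N : ℕ} [NeZero N] (p : ℕ)
    (x : Fin N → U) (i : Fin N) : weight (fun j => G.val p (x j)) i ≤ c ^ 2 / N := by
  have hN : (0 : ℝ) < N := by exact_mod_cast Nat.pos_of_neZero N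
  have hc := hG.pos
  have hs : N * c⁻¹ ≤ ∑ j, G.val p (x j) := by
    have := Finset.card_nsmul_le_sum univ (fun j => G.val p (x j)) c⁻¹ fun j _ => hG.lower p (x j)
    simpa using this
  unfold weight
  calc _ ≤ c / (N * c⁻¹) := div_le_div₀ hc.le (hG.upper p _) (by positivity) hs
    _ = _ := by field_simp

theorem Potentials.Bounded.inv_le_avg (hG : G.Bounded c) {N : ℕ} [NeZero N] (p : ℕ)
    (x : Fin N → U) : c⁻¹ ≤ avg (G.val p) x := le_avg (hG.lower p) x

theorem Potentials.Bounded.avg_pos (hG : G.Bounded c) {N : ℕ} [NeZero N] (p : ℕ)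
    (x : Fin N → U) : 0 < avg (G.val p) x := (inv_pos.2 hG.pos).trans_le (hG.inv_le_avg p x)

theorem lintegral_moveKernel_le (hG : G.Bounded c) {N : ℕ} [NeZero N] (p : ℕ) (M : Kernel U U)
    (x : Fin N → U) (f : U → ℝ≥0∞) : ∫⁻ y, f y ∂(moveKernel G p N M x) ≤
      ∑ i, ENNReal.ofReal (c ^ 2 / N) * ∫⁻ y, f y ∂(M (x i)) := by
  have h : ∫⁻ y, f y ∂(moveKernel G p N M x) =
      ∑ i, ENNReal.ofReal (weight (fun j => G.val p (x j)) i) * ∫⁻ y, f y ∂(M (x i)) :=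
    lintegral_mixture _ _ _ x f
  rw [h]
  gcongr with i
  exact hG.weight_le p x i

theorem integral_moveKernel {N : ℕ} [NeZero N] (p : ℕ) (M : Kernel U U) (x : Fin N → U)
    (f : U → ℝ) (hf : ∀ u, Integrable f (M u)) : ∫ y, f y ∂(moveKernel G p N M x) =
      avg (fun u => G.val p u * ∫ y, f y ∂(M u)) x / avg (G.val p) x := by
  have hN : (N : ℝ) ≠ 0 := NeZero.ne _
  have hs : (∑ j, G.val p (x j)) ≠ 0 :=
    (Finset.sum_pos (fun i _ => G.pos p (x i)) Finset.univ_nonempty).ne'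
  have h : ∫ y, f y ∂(moveKernel G p N M x) =
      ∑ i, weight (fun j => G.val p (x j)) i * ∫ y, f y ∂(M (x i)) :=
    integral_mixture (fun i (x : Fin N → U) => weight (fun j => G.val p (x j)) i) _
      (fun i => M.comap (fun x => x i) (measurable_pi_apply i))
      (fun i x => weight_nonneg (fun j => G.pos p (x j)) i) x f fun i => hf (x i)
  rw [h]
  simp only [weight, avg]
  rw [mul_div_mul_left _ _ (one_div_ne_zero hN), Finset.sum_div]
  exact Finset.sum_congr rfl fun i _ => by ring

/-- The law of the paths of a system of `N` particles that move independently of each other given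
the current positions of all of them. -/
def systemLaw {N : ℕ} (μ : Measure W) (K : ℕ → Kernel (Fin N → W) W) [∀ p, IsMarkovKernel (K p)] :
    Measure (ℕ → Fin N → W) :=
  chainLaw (Measure.pi fun _ => μ) fun p => iidKernel (Fin N) (K p)

variable {N : ℕ} {μ₀ : Measure W} [IsProbabilityMeasure μ₀] {K : ℕ → Kernel (Fin N → W) W}
  [∀ p, IsMarkovKernel (K p)]

instance : IsProbabilityMeasure (systemLaw μ₀ K) := by
  unfold systemLaw; infer_instance

instance (p : ℕ) : IsProbabilityMeasure ((systemLaw μ₀ K).map fun ω => ω p) :=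
  Measure.isProbabilityMeasure_map (measurable_pi_apply p).aemeasurable

theorem systemLaw_map_zero (i : Fin N) : (systemLaw μ₀ K).map (fun ω => ω 0 i) = μ₀ := by
  have h : (systemLaw μ₀ K).map (fun ω => ω 0) = Measure.pi fun _ => μ₀ := chainLaw_map_zero _ _
  have h2 : (fun ω : ℕ → Fin N → W => ω 0 i) = (fun x => x i) ∘ fun ω => ω 0 := rfl
  rw [h2, ← Measure.map_map (by fun_prop) (by fun_prop), h]
  exact (measurePreserving_eval (fun _ : Fin N => μ₀) i).map_eq

theorem systemLaw_map_succ (p : ℕ) (i : Fin N) : (systemLaw μ₀ K).map (fun ω => ω (p + 1) i) =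
    ((systemLaw μ₀ K).map fun ω => ω p).bind (K p) := by
  have h : (systemLaw μ₀ K).map (fun ω => ω (p + 1)) =
      ((systemLaw μ₀ K).map fun ω => ω p).bind (iidKernel (Fin N) (K p)) := chainLaw_map_succ _ _ p
  have h2 : (fun ω : ℕ → Fin N → W => ω (p + 1) i) = (fun x => x i) ∘ fun ω => ω (p + 1) := rfl
  rw [h2, ← Measure.map_map (by fun_prop) (by fun_prop), h, map_eval_iidKernel]

/-- All particles of a system have the same law. -/
theorem systemLaw_map_eq (p : ℕ) (i j : Fin N) :
    (systemLaw μ₀ K).map (fun ω => ω p i) = (systemLaw μ₀ K).map fun ω => ω p j := by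
  cases p with
  | zero => rw [systemLaw_map_zero, systemLaw_map_zero]
  | succ p => rw [systemLaw_map_succ, systemLaw_map_succ]

theorem L2Le.avg_systemLaw_zero [NeZero N] {f : W → ℝ} {r : ℝ} (hr : L2Le μ₀ f r) :
    L2Le (systemLaw μ₀ K) (fun ω => avg f (ω 0) - ∫ x, f x ∂μ₀) (r / Real.sqrt N) := by
  have h := hr.avg_pi (N := N)
  rw [← show (systemLaw μ₀ K).map (fun ω => ω 0) = Measure.pi fun _ => μ₀ from
    chainLaw_map_zero _ _] at h
  exact (l2Le_map_iff (by fun_prop) h.meas).1 h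

/-- All particles have the same law, so the norm for particle `0` controls the fluctuation of the
whole average. -/
theorem L2Le.avg_systemLaw_succ [NeZero N] {p : ℕ} {f : W → ℝ} {r s t : ℝ}
    (hr : L2Le (systemLaw μ₀ K) (fun ω => f (ω (p + 1) 0)) r) (hf : Measurable f)
    (hs : L2Le (systemLaw μ₀ K) (fun ω => ∫ y, f y ∂(K p (ω p)) - t) s) :
    L2Le (systemLaw μ₀ K) (fun ω => avg f (ω (p + 1)) - t) (r / Real.sqrt N + s) := by
  have hm : Measurable fun x => ∫ y, f y ∂(K p x) - t :=
    hf.stronglyMeasurable.integral_kernel.measurable.sub_const t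
  have hr' := (l2Le_map_iff (by fun_prop) hf).2 hr
  rw [systemLaw_map_succ] at hr'
  have h := hr'.avg_bind (N := N) (K p) ((l2Le_map_iff (by fun_prop) hm).2 hs)
  rw [← show (systemLaw μ₀ K).map (fun ω => ω (p + 1)) =
      ((systemLaw μ₀ K).map fun ω => ω p).bind (iidKernel (Fin N) (K p)) from
    chainLaw_map_succ _ _ p] at h
  exact (l2Le_map_iff (by fun_prop) h.meas).1 h

/-- The images under `π` of the particles of a system form a particle filter. -/
structure Projects (G : Potentials U) (μ : Measure U) (M : ℕ → Kernel U U) (π : W → U)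
    (μ₀ : Measure W) (K : ℕ → Kernel (Fin N → W) W) : Prop where
  meas : Measurable π
  init : μ₀.map π = μ
  step : ∀ p x, (K p x).map π = moveKernel G p N (M p) fun i => π (x i)

variable {μ : Measure U} [IsProbabilityMeasure μ] {M : ℕ → Kernel U U} [∀ p, IsMarkovKernel (M p)]
  {π : W → U} {V φ : U → ℝ} {a w : ℝ}

namespace Projects

/-- No ancestor has a weight above `c ^ 2 / N`. The sum over the N possible ancestors consists of
equal expectations, since all particles have the same law, and N cancels. -/
theorem lintegral_succ_le (hπ : Projects G μ M π μ₀ K) (hG : G.Bounded c) [NeZero N] (p : ℕ)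
    (i : Fin N) {f : U → ℝ≥0∞} (hf : Measurable f) :
    ∫⁻ ω, f (π (ω (p + 1) i)) ∂(systemLaw μ₀ K) ≤
      ENNReal.ofReal (c ^ 2) * ∫⁻ ω, ∫⁻ y, f y ∂(M p (π (ω p i))) ∂(systemLaw μ₀ K) := by
  have hπm := hπ.meas
  have hfπ : Measurable fun x => f (π x) := hf.comp hπm
  have h1 : ∫⁻ ω, f (π (ω (p + 1) i)) ∂(systemLaw μ₀ K) =
      ∫⁻ x, f (π x) ∂((systemLaw μ₀ K).map fun ω => ω (p + 1) i) :=
    (lintegral_map hfπ (by fun_prop)).symm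
  have hMm : Measurable fun x => ∫⁻ y, f y ∂(M p (π x)) := hf.lintegral_kernel.comp hπm
  have h2 : ∀ j, ∫⁻ ω, ∫⁻ y, f y ∂(M p (π (ω p j))) ∂(systemLaw μ₀ K) =
      ∫⁻ ω, ∫⁻ y, f y ∂(M p (π (ω p i))) ∂(systemLaw μ₀ K) := fun j => by
    have := systemLaw_map_eq (μ₀ := μ₀) (K := K) p j i
    rw [← lintegral_map (f := fun x => ∫⁻ y, f y ∂(M p (π x))) (g := fun ω : ℕ → Fin N → W => ω p j)
      hMm (by fun_prop), this, lintegral_map hMm (by fun_prop)]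
  rw [h1, systemLaw_map_succ, Measure.lintegral_bind (Kernel.aemeasurable _) hfπ.aemeasurable,
    lintegral_map (by exact hfπ.lintegral_kernel) (by fun_prop)]
  calc _ ≤ ∫⁻ ω, ∑ j, ENNReal.ofReal (c ^ 2 / N) * ∫⁻ y, f y ∂(M p (π (ω p j)))
          ∂(systemLaw μ₀ K) := by
        refine lintegral_mono fun ω => ?_
        rw [← lintegral_map hf hπm, hπ.step]
        exact lintegral_moveKernel_le hG p (M p) _ f
    _ = ∑ j : Fin N, ENNReal.ofReal (c ^ 2 / N) *
          ∫⁻ ω, ∫⁻ y, f y ∂(M p (π (ω p i))) ∂(systemLaw μ₀ K) := by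
        have hm : ∀ j, Measurable fun ω : ℕ → Fin N → W => ∫⁻ y, f y ∂(M p (π (ω p j))) := fun j =>
          hMm.comp (g := fun x => ∫⁻ y, f y ∂(M p (π x))) (by fun_prop)
        rw [lintegral_finsetSum _ fun j _ => (hm j).const_mul _]
        refine Finset.sum_congr rfl fun j _ => ?_
        rw [lintegral_const_mul _ (hm j), h2 j]
    _ = _ := by
        have hN : (N : ℝ) ≠ 0 := NeZero.ne _
        rw [Finset.sum_const, card_univ, Fintype.card_fin, nsmul_eq_mul, ← mul_assoc,
          ← ENNReal.ofReal_natCast, ← ENNReal.ofReal_mul (by positivity), mul_div_cancel₀ _ hN]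

theorem l2Le_weight (hπ : Projects G μ M π μ₀ K) (hG : G.Bounded c) [NeZero N]
    (hV : Weight μ M V a) (p : ℕ) (i : Fin N) :
    L2Le (systemLaw μ₀ K) (fun ω => V (π (ω p i))) (moment c a p) := by
  have hπm := hπ.meas
  have hVm := hV.meas
  have hV2 := (hVm.pow_const 2).ennreal_ofReal
  have hm : ∀ p, Measurable fun ω : ℕ → Fin N → W => V (π (ω p i)) := fun p =>
    hVm.comp (hπm.comp (by fun_prop))
  induction p with
  | zero =>
    have h := hV.init
    rw [← hπ.init, ← systemLaw_map_zero (μ₀ := μ₀) (K := K) i] at h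
    rw [Measure.map_map hπm (by fun_prop)] at h
    simpa [moment] using (l2Le_map_iff (hπm.comp (by fun_prop)) hVm).1 h
  | succ p ih =>
    refine ⟨hm _, hV.moment_nonneg hG _, (hπ.lintegral_succ_le hG p i hV2).trans ?_⟩
    calc _ ≤ ENNReal.ofReal (c ^ 2) * ∫⁻ ω, ENNReal.ofReal (a ^ 2) *
          ENNReal.ofReal (V (π (ω p i)) ^ 2) ∂(systemLaw μ₀ K) := by
          gcongr with ω
          rw [← ENNReal.ofReal_mul (sq_nonneg a), ← mul_pow]
          exact (hV.step p _).bound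
      _ ≤ ENNReal.ofReal (c ^ 2) * (ENNReal.ofReal (a ^ 2) *
            ENNReal.ofReal (moment c a p ^ 2)) := by
          rw [lintegral_const_mul _ (hm p |>.pow_const 2).ennreal_ofReal]
          gcongr
          exact ih.bound
      _ = _ := by
          rw [← ENNReal.ofReal_mul (sq_nonneg a), ← ENNReal.ofReal_mul (sq_nonneg c)]
          congr 1
          simp only [moment, pow_succ]; ring

/-- The conditional mean of a new particle, minus its limit. -/
theorem integral_step_sub (hπ : Projects G μ M π μ₀ K) (hG : G.Bounded c) [NeZero N]
    (hV : Weight μ M V a) (hφ : WeightLe V φ w) (p : ℕ) (x : Fin N → W) :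
    ∫ y, φ (π y) ∂(K p x) - ∫ u, φ u ∂(predictor G μ M (p + 1)) =
      (avg (centred G μ M φ p) (fun i => π (x i)) -
        ∫ u, centred G μ M φ p u ∂(predictor G μ M p)) / avg (G.val p) (fun i => π (x i)) := by
  have h0 := (hG.avg_pos p fun i => π (x i)).ne'
  have h1 : ∫ y, φ (π y) ∂(K p x) = ∫ u, φ u ∂((K p x).map π) :=
    (integral_map hπ.meas.aemeasurable hφ.meas.aestronglyMeasurable).symm
  -- The integral of the centred function vanishes; it is kept in the statement so that the
  -- numerator is literally an error at time `p`, to which an induction hypothesis applies.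
  rw [h1, hπ.step, integral_moveKernel p (M p) _ φ fun u => hV.integrable_step hφ p u,
    integral_centred hG hV hφ, sub_zero]
  unfold centred
  rw [avg_sub, avg_const_mul]
  field_simp

/-- The constants of the mean square error of a particle filter. -/
def errConst (c a : ℝ) : ℕ → ℝ
  | 0 => a
  | p + 1 => moment c a (p + 1) + c * (errConst c a p * (c * (a + moment c a (p + 1))))

/-- The mean square error of a particle filter, for functions that are bounded by a weight. -/
theorem l2Le_avg_sub (hπ : Projects G μ M π μ₀ K) (hG : G.Bounded c) [NeZero N]
    (hV : Weight μ M V a) (p : ℕ) : ∀ {φ : U → ℝ} {w : ℝ}, WeightLe V φ w →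
    L2Le (systemLaw μ₀ K) (fun ω => avg φ (fun i => π (ω p i)) -
      ∫ u, φ u ∂(predictor G μ M p)) (errConst c a p * w / Real.sqrt N) := by
  have hπm := hπ.meas
  induction p with
  | zero =>
    intro φ w hφ
    have h := hV.l2Le hφ hV.init
    rw [← hπ.init] at h
    have h2 := ((l2Le_map_iff hπm hφ.meas).1 h).avg_systemLaw_zero (K := K)
    have h3 : ∫ x, φ (π x) ∂μ₀ = ∫ u, φ u ∂(predictor G μ M 0) := by
      rw [predictor_zero, ← hπ.init,
        integral_map hπm.aemeasurable hφ.meas.aestronglyMeasurable]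
    rw [h3, mul_comm] at h2
    exact h2
  | succ p ih =>
    intro φ w hφ
    have hc := hG.pos
    have h1 : L2Le (systemLaw μ₀ K) (fun ω => φ (π (ω (p + 1) 0))) (w * moment c a (p + 1)) :=
      (hπ.l2Le_weight hG hV (p + 1) 0).of_abs_le_mul (hφ.meas.comp (hπm.comp (by fun_prop)))
        hφ.nonneg fun ω => by rw [abs_of_pos (hV.pos _)]; exact hφ.le _
    -- The induction hypothesis is used for the centred function instead of `φ`, which is why the
    -- claim is proved for all weighted functions simultaneously.
    have h2 := ih (hV.weightLe_centred hG hφ p)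
    have hgm : Measurable fun ω : ℕ → Fin N → W => (avg (G.val p) fun i => π (ω p i))⁻¹ :=
      ((measurable_avg (G.measurable p)).comp (by fun_prop)).inv
    have h3 := h2.mul_of_abs_le hgm hc.le fun ω => by
      have := hG.avg_pos p fun i => π (ω p i)
      rw [abs_of_pos (inv_pos.2 this)]
      exact inv_le_of_inv_le₀ hc (hG.inv_le_avg p _)
    have h4 := h1.avg_systemLaw_succ (f := fun x => φ (π x)) (hφ.meas.comp hπm)
      (t := ∫ u, φ u ∂(predictor G μ M (p + 1))) (h3.congr fun ω => by
        rw [hπ.integral_step_sub hG hV hφ]; ring)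
    refine h4.weaken (le_of_eq ?_)
    rw [errConst]
    ring

/-- The constants of the error of the estimate of the normalizing constant. -/
def normErrConst (c : ℝ) : ℕ → ℝ
  | 0 => 0
  | n + 1 => c ^ n * (errConst c 1 n * c) + c * normErrConst c n

end Projects

theorem normEst_succ (n : ℕ) (ω : ℕ → Fin N → U) :
    normEst G (n + 1) N ω = normEst G n N ω * avg (G.val n) (ω n) := prod_range_succ _ _

theorem normEst_zero (ω : ℕ → Fin N → U) : normEst G 0 N ω = 1 := prod_range_zero _

theorem measurable_normEst (n : ℕ) : Measurable fun ω : ℕ → Fin N → U => normEst G n N ω :=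
  Finset.measurable_prod _ fun p _ => (measurable_avg (G.measurable p)).comp (measurable_pi_apply p)

theorem Potentials.Bounded.normEst_pos (hG : G.Bounded c) [NeZero N] (n : ℕ) (ω : ℕ → Fin N → U) :
    0 < normEst G n N ω := prod_pos fun p _ => hG.avg_pos p (ω p)

theorem Potentials.Bounded.normEst_le (hG : G.Bounded c) [NeZero N] (n : ℕ) (ω : ℕ → Fin N → U) :
    normEst G n N ω ≤ c ^ n := by
  have h := prod_le_prod (s := range n) (f := fun p => avg (G.val p) (ω p)) (g := fun _ => c)
    (fun p _ => (hG.avg_pos p (ω p)).le) fun p _ => avg_le (hG.upper p) (ω p)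
  rwa [prod_const, card_range] at h

theorem Potentials.Bounded.abs_normEst_le (hG : G.Bounded c) [NeZero N] (n : ℕ)
    (ω : ℕ → Fin N → U) : |normEst G n N ω| ≤ c ^ n := by
  rw [abs_of_pos (hG.normEst_pos n ω)]; exact hG.normEst_le n ω

theorem Potentials.Bounded.inv_le_normEst (hG : G.Bounded c) [NeZero N] (n : ℕ)
    (ω : ℕ → Fin N → U) : (c ^ n)⁻¹ ≤ normEst G n N ω := by
  have h := prod_le_prod (s := range n) (f := fun _ => c⁻¹) (g := fun p => avg (G.val p) (ω p))
    (fun _ _ => (inv_pos.2 hG.pos).le) fun p _ => hG.inv_le_avg p (ω p)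
  rwa [prod_const, card_range, inv_pow] at h

/-- The estimate is a product of averages, so an increment of its error is the previous estimate
times the error of the new average, plus the limit of that average times the previous error. The
first coefficient is at most `c ^ n`, the second at most `c`. -/
theorem Projects.l2Le_normEst_sub (hπ : Projects G μ M π μ₀ K) (hG : G.Bounded c) [NeZero N]
    (n : ℕ) : L2Le (systemLaw μ₀ K)
      (fun ω => normEst G n N (fun p i => π (ω p i)) - normConst G μ M n)
      (normErrConst c n / Real.sqrt N) := by
  have hπm := hπ.meas
  induction n with
  | zero =>
    refine (L2Le.const (μ := systemLaw μ₀ K) 0).congr (fun ω => ?_) |>.weaken (by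
      simp [normErrConst])
    rw [normEst_zero, normConst_zero, sub_self]
  | succ n ih =>
    have h1 := hπ.l2Le_avg_sub hG Weight.trivial n (Weight.weightLe_val
      (Weight.trivial (μ := μ) (M := M)) hG n)
    have hm : Measurable fun ω : ℕ → Fin N → W => normEst G n N (fun p i => π (ω p i)) :=
      (measurable_normEst n).comp (by fun_prop)
    have h2 := h1.mul_of_abs_le hm (pow_pos hG.pos n).le fun ω => hG.abs_normEst_le n _
    have : IsProbabilityMeasure (predictor G μ M n) := isProbabilityMeasure_predictor hG n
    have h3 := ih.const_mul (∫ u, G.val n u ∂(predictor G μ M n))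
    have h4 : |∫ u, G.val n u ∂(predictor G μ M n)| ≤ c := by
      have h5 := (inv_pos.2 hG.pos).trans_le (le_integral_val hG (predictor G μ M n) n)
      rw [abs_of_pos h5]
      exact integral_val_le hG _ n
    refine ((h2.add h3).congr fun ω => ?_).weaken ?_
    · rw [normEst_succ, normConst_succ hG]; ring
    · rw [normErrConst, add_div]
      have := ih.nonneg
      refine add_le_add (le_of_eq (by ring)) ?_
      rw [mul_div_assoc]
      gcongr

end ParticleSystems

/-! ### Marginals of coupled resampling and of the coupled filter -/

section CoupledResampling

variable {ι : Type*} [Fintype ι] [DecidableEq ι] {w₁ w₂ : ι → ℝ}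

theorem sum_couplingProb_snd (s₁ : ∑ i, w₁ i = 1) (s₂ : ∑ i, w₂ i = 1) (i : ι) :
    ∑ j, couplingProb w₁ w₂ (i, j) = w₁ i := by
  unfold couplingProb
  simp only [Finset.sum_add_distrib, ← Finset.mul_sum, ← Finset.sum_div, Finset.sum_ite_eq,
    Finset.mem_univ, if_true, Finset.sum_sub_distrib, s₁, s₂]
  by_cases h : 1 - ∑ s, min (w₁ s) (w₂ s) = 0
  -- Without residual mass the independent part of the coupling has coefficient zero, and its
  -- quotients have zero denominators. The weights then agree with their minimum at every index, so
  -- the diagonal part alone gives `w₁`.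
  · have h1 : ∑ s, (w₁ s - min (w₁ s) (w₂ s)) = 0 := by rw [sum_sub_distrib, s₁, h]
    have h2 := (sum_eq_zero_iff_of_nonneg fun s _ => sub_nonneg.2 (min_le_left _ _)).1 h1 i
      (mem_univ i)
    rw [h]; linarith
  · rw [div_self h]; field_simp; ring

theorem sum_couplingProb_fst (s₁ : ∑ i, w₁ i = 1) (s₂ : ∑ i, w₂ i = 1) (j : ι) :
    ∑ i, couplingProb w₁ w₂ (i, j) = w₂ j := by
  unfold couplingProb
  simp only [Finset.sum_add_distrib, ← Finset.mul_sum, ← Finset.sum_mul, ← Finset.sum_div,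
    Finset.sum_ite_eq', Finset.mem_univ, if_true, Finset.sum_sub_distrib, s₁, s₂]
  by_cases h : 1 - ∑ s, min (w₁ s) (w₂ s) = 0
  · have h1 : ∑ s, (w₂ s - min (w₁ s) (w₂ s)) = 0 := by rw [sum_sub_distrib, s₂, h]
    have h2 := (sum_eq_zero_iff_of_nonneg fun s _ => sub_nonneg.2 (min_le_right _ _)).1 h1 j
      (mem_univ j)
    rw [h]; linarith
  · rw [div_self h]; field_simp; ring

end CoupledResampling

section CoupledFilters

variable {U : Type*} [MeasurableSpace U] {G : Potentials U} {c : ℝ} {N : ℕ} [NeZero N]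

theorem lintegral_coupledMoveKernel (p : ℕ) (K : Kernel (U × U) (U × U)) (x : Fin N → U × U)
    (f : U × U → ℝ≥0∞) : ∫⁻ y, f y ∂(coupledMoveKernel G p N K x) =
      ∑ q : Fin N × Fin N, ENNReal.ofReal (couplingProb (weight fun j => G.val p (x j).1)
        (weight fun j => G.val p (x j).2) q) * ∫⁻ y, f y ∂(K ((x q.1).1, (x q.2).2)) :=
  lintegral_mixture _ _ _ x f

/-- The first marginal of `K` does not see the coarse ancestor, and summing the coupling
probabilities over that ancestor returns the fine weights. Hence the fine particle alone is
resampled and moved as in an uncoupled filter, conditionally on all fine positions. -/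
theorem coupledMoveKernel_map_fst (p : ℕ) {K : Kernel (U × U) (U × U)} {M : Kernel U U}
    (h : ∀ v, (K v).map Prod.fst = M v.1) (x : Fin N → U × U) :
    (coupledMoveKernel G p N K x).map Prod.fst = moveKernel G p N M fun i => (x i).1 := by
  have s₁ := sum_weight fun j => G.pos p (x j).1
  have s₂ := sum_weight fun j => G.pos p (x j).2
  refine Measure.ext_of_lintegral _ fun f hf => ?_
  have h1 : ∫⁻ y, f y ∂(moveKernel G p N M fun i => (x i).1) =
      ∑ i, ENNReal.ofReal (weight (fun j => G.val p (x j).1) i) * ∫⁻ y, f y ∂(M (x i).1) :=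
    lintegral_mixture _ _ _ _ f
  rw [lintegral_map hf measurable_fst, lintegral_coupledMoveKernel, h1, Fintype.sum_prod_type]
  refine Finset.sum_congr rfl fun i _ => ?_
  have h2 : ∀ j, ∫⁻ y, f y.1 ∂(K ((x i).1, (x j).2)) = ∫⁻ y, f y ∂(M (x i).1) := fun j => by
    rw [← lintegral_map hf measurable_fst, h]
  simp only [h2]
  rw [← Finset.sum_mul, ← ENNReal.ofReal_sum_of_nonneg fun j _ =>
    couplingProb_nonneg (weight_nonneg fun j => G.pos p (x j).1)
      (weight_nonneg fun j => G.pos p (x j).2) s₁ _, sum_couplingProb_snd s₁ s₂]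

theorem coupledMoveKernel_map_snd (p : ℕ) {K : Kernel (U × U) (U × U)} {M : Kernel U U}
    (h : ∀ v, (K v).map Prod.snd = M v.2) (x : Fin N → U × U) :
    (coupledMoveKernel G p N K x).map Prod.snd = moveKernel G p N M fun i => (x i).2 := by
  have s₁ := sum_weight fun j => G.pos p (x j).1
  have s₂ := sum_weight fun j => G.pos p (x j).2
  refine Measure.ext_of_lintegral _ fun f hf => ?_
  have h1 : ∫⁻ y, f y ∂(moveKernel G p N M fun i => (x i).2) =
      ∑ i, ENNReal.ofReal (weight (fun j => G.val p (x j).2) i) * ∫⁻ y, f y ∂(M (x i).2) :=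
    lintegral_mixture _ _ _ _ f
  rw [lintegral_map hf measurable_snd, lintegral_coupledMoveKernel, h1,
    Fintype.sum_prod_type_right]
  refine Finset.sum_congr rfl fun i _ => ?_
  have h2 : ∀ j, ∫⁻ y, f y.2 ∂(K ((x j).1, (x i).2)) = ∫⁻ y, f y ∂(M (x i).2) := fun j => by
    rw [← lintegral_map hf measurable_snd, h]
  simp only [h2]
  rw [← Finset.sum_mul, ← ENNReal.ofReal_sum_of_nonneg fun j _ =>
    couplingProb_nonneg (weight_nonneg fun j => G.pos p (x j).1)
      (weight_nonneg fun j => G.pos p (x j).2) s₁ _, sum_couplingProb_fst s₁ s₂]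

namespace Coupled

variable (F : Coupled U)

theorem law_eq_systemLaw :
    F.law G N = systemLaw F.init fun p => coupledMoveKernel G p N (F.M p) := rfl

theorem projects_fst : Projects G (F.init.map Prod.fst) F.M₁ Prod.fst F.init
    fun p => coupledMoveKernel G p N (F.M p) :=
  ⟨measurable_fst, rfl, fun p => coupledMoveKernel_map_fst p (F.map_fst p)⟩

theorem projects_snd : Projects G (F.init.map Prod.snd) F.M₂ Prod.snd F.init
    fun p => coupledMoveKernel G p N (F.M p) :=
  ⟨measurable_snd, rfl, fun p => coupledMoveKernel_map_snd p (F.map_snd p)⟩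

instance : IsProbabilityMeasure (F.init.map Prod.fst) :=
  Measure.isProbabilityMeasure_map measurable_fst.aemeasurable

instance : IsProbabilityMeasure (F.init.map Prod.snd) :=
  Measure.isProbabilityMeasure_map measurable_snd.aemeasurable

end Coupled

theorem Single.projects (F : Single U) : Projects G F.init F.M id F.init
    fun p => moveKernel G p N (F.M p) :=
  ⟨measurable_id, Measure.map_id, fun _ _ => Measure.map_id⟩

end CoupledFilters

theorem Potentials.Bounded.inv_le_normConst {U : Type*} [MeasurableSpace U] {G : Potentials U}
    {c : ℝ} (hG : G.Bounded c) {μ : Measure U} [IsProbabilityMeasure μ] {M : ℕ → Kernel U U}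
    [∀ p, IsMarkovKernel (M p)] (n : ℕ) : (c ^ n)⁻¹ ≤ normConst G μ M n := by
  induction n with
  | zero => simp [normConst_zero]
  | succ n ih =>
    have := isProbabilityMeasure_predictor (μ := μ) (M := M) hG n
    rw [normConst_succ hG, pow_succ, mul_inv]
    exact mul_le_mul ih (le_integral_val hG _ n) (inv_pos.2 hG.pos).le (normConst_pos hG n).le

/-! ### Errors of the difference between the coordinates of a coupled filter -/

/-- `φ` is bounded by `b` and Lipschitz with constant `b`. -/
structure BoundedLip {U : Type*} [MetricSpace U] (φ : U → ℝ) (b : ℝ) : Prop where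
  nonneg : 0 ≤ b
  le : ∀ u, |φ u| ≤ b
  lip : ∀ u v, |φ u - φ v| ≤ b * dist u v

section PairErrors

variable {U : Type*} [MetricSpace U]

theorem BoundedLip.lipschitzWith {φ : U → ℝ} {b : ℝ} (h : BoundedLip φ b) :
    LipschitzWith b.toNNReal φ :=
  LipschitzWith.of_dist_le_mul fun x y => by
    rw [Real.coe_toNNReal b h.nonneg, Real.dist_eq]; exact h.lip x y

/-- Boundedness handles distant points, so the truncated distance suffices; it is the only distance
of a pair that is controlled. -/
theorem BoundedLip.abs_sub_le {φ : U → ℝ} {b : ℝ} (h : BoundedLip φ b) (u v : U) :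
    |φ u - φ v| ≤ 2 * b * min (dist u v) 1 := by
  have h1 := h.lip u v
  have h2 := abs_sub (φ u) (φ v)
  have h3 := h.le u
  have h4 := h.le v
  have h5 := h.nonneg
  have h6 : 0 ≤ dist u v := dist_nonneg
  rcases min_cases (dist u v) 1 with ⟨h, _⟩ | ⟨h, _⟩ <;> rw [h] <;> nlinarith

variable [MeasurableSpace U] [BorelSpace U]

theorem BoundedLip.measurable {φ : U → ℝ} {b : ℝ} (h : BoundedLip φ b) : Measurable φ :=
  h.lipschitzWith.continuous.measurable

theorem BoundedLip.weightLe {φ : U → ℝ} {b : ℝ} (h : BoundedLip φ b) :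
    WeightLe (fun _ => 1) φ b := ⟨h.measurable, h.nonneg, fun u => by simpa using h.le u⟩

/-- Bounds for the discrepancy between the two models of a coupled model: `D` for the distance of
the particles of a pair, `T` for the predictors and `Q` for the transitions. -/
structure PairBounds (F : Coupled U) (G : Potentials U) (N : ℕ) [NeZero N] (c : ℝ) (Λ : ℕ → ℝ)
    (V : U → ℝ) (a : ℝ) (D T Q : ℕ → ℝ) : Prop where
  bdd : G.Bounded c
  lip_val : ∀ p u v, |G.val p u - G.val p v| ≤ c * dist u v
  lip_step : ∀ p φ b, BoundedLip φ b → ∀ u v,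
    |∫ y, φ y ∂(F.M₁ p u) - ∫ y, φ y ∂(F.M₁ p v)| ≤ Λ p * b * dist u v
  lip_nonneg : ∀ p, 0 ≤ Λ p
  weight : Weight (F.init.map Prod.snd) F.M₂ V a
  dist_le : ∀ p, L2Le (F.law G N) (fun ω => min (dist (ω p 0).1 (ω p 0).2) 1) (D p)
  predictor_le : ∀ p φ b, BoundedLip φ b →
    |∫ u, φ u ∂(F.η₁ G p) - ∫ u, φ u ∂(F.η₂ G p)| ≤ b * T p
  step_le : ∀ p φ b, BoundedLip φ b → ∀ u,
    |∫ y, φ y ∂(F.M₁ p u) - ∫ y, φ y ∂(F.M₂ p u)| ≤ b * Q p * V u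
  predictor_nonneg : ∀ p, 0 ≤ T p
  step_nonneg : ∀ p, 0 ≤ Q p

/-- The sum of the discrepancies up to time `p`. -/
def discrepancy (D T Q : ℕ → ℝ) (p : ℕ) : ℝ :=
  ∑ q ∈ range (p + 1), (D q + T q) + ∑ q ∈ range p, Q q

/-- The constants of the error of the difference of two coupled empirical measures. -/
def pairConst (c a : ℝ) (Λ : ℕ → ℝ) : ℕ → ℝ
  | 0 => 2
  | p + 1 => 2 + c * (pairConst c a Λ p * (c * (Λ p + 2))) + c ^ 2 * Projects.errConst c a p +
      4 * c ^ 4 * pairConst c a Λ p + 2 * c ^ 4 * Projects.errConst c 1 p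

namespace PairBounds

variable {F : Coupled U} {G : Potentials U} {N : ℕ} [NeZero N] {c : ℝ} {Λ : ℕ → ℝ}
  {V : U → ℝ} {a : ℝ} {D T Q : ℕ → ℝ}

theorem boundedLip_val (h : PairBounds F G N c Λ V a D T Q) (p : ℕ) : BoundedLip (G.val p) c :=
  ⟨h.bdd.pos.le, h.bdd.abs_le p, h.lip_val p⟩

theorem abs_integral_le {ν : Measure U} [IsProbabilityMeasure ν] {φ : U → ℝ} {b : ℝ}
    (hφ : BoundedLip φ b) : |∫ u, φ u ∂ν| ≤ b :=
  (L2Le.of_abs_le hφ.measurable hφ.nonneg hφ.le).abs_integral_le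

/-- By (A) the transition makes `φ` Lipschitz, with a constant that depends only on its bound. Hence
centring does not leave the class of bounded Lipschitz functions, and the induction over time
closes. -/
theorem boundedLip_centred (h : PairBounds F G N c Λ V a D T Q) (p : ℕ) {φ : U → ℝ} {b : ℝ}
    (hφ : BoundedLip φ b) :
    BoundedLip (centred G (F.init.map Prod.fst) F.M₁ φ p) (c * (Λ p + 2) * b) := by
  have hc := h.bdd.pos.le
  have hb := hφ.nonneg
  have hΛ := h.lip_nonneg p
  have := isProbabilityMeasure_predictor (μ := F.init.map Prod.fst) (M := F.M₁) h.bdd (p + 1)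
  have hR := abs_integral_le (ν := predictor G (F.init.map Prod.fst) F.M₁ (p + 1)) hφ
  have hm : ∀ u, |∫ y, φ y ∂(F.M₁ p u)| ≤ b := fun u => abs_integral_le hφ
  unfold centred
  set R := ∫ u, φ u ∂(predictor G (F.init.map Prod.fst) F.M₁ (p + 1))
  refine ⟨by positivity, fun u => ?_, fun u v => ?_⟩
  · calc _ ≤ |G.val p u * ∫ y, φ y ∂(F.M₁ p u)| + |R * G.val p u| := abs_sub _ _
      _ ≤ c * b + b * c := by
          rw [abs_mul, abs_mul]
          gcongr
          exacts [h.bdd.abs_le p u, hm u, h.bdd.abs_le p u]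
      _ ≤ _ := by nlinarith [mul_nonneg (mul_nonneg hc hΛ) hb]
  -- Product rule: the increment of the averaged function contributes `Λ p`, and the increment of
  -- the potential, multiplied by at most twice the bound of `φ`, contributes 2.
  · have h1 : ∀ g g' m m' R : ℝ, g * m - R * g - (g' * m' - R * g') =
        g * (m - m') + (m' - R) * (g - g') := by intros; ring
    rw [h1]
    calc _ ≤ |G.val p u| * |∫ y, φ y ∂(F.M₁ p u) - ∫ y, φ y ∂(F.M₁ p v)| +
          (|∫ y, φ y ∂(F.M₁ p v)| + |R|) * |G.val p u - G.val p v| := by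
          rw [← abs_mul]
          refine (abs_add_le _ _).trans (add_le_add_right ?_ _)
          rw [abs_mul]
          gcongr
          exact abs_sub _ _
      _ ≤ c * (Λ p * b * dist u v) + (b + b) * (c * dist u v) := by
          gcongr
          exacts [h.bdd.abs_le p u, h.lip_step p φ b hφ u v, hm v, h.lip_val p u v]
      _ = _ := by ring

/-- The fine and the coarse centred function share the potential. They differ only through the
transitions, which gives `Q p` and the weight `V`, and through the subtracted constants, which gives
`T (p + 1)`. -/
theorem weightLe_centred_sub (h : PairBounds F G N c Λ V a D T Q) (p : ℕ) {φ : U → ℝ} {b : ℝ}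
    (hφ : BoundedLip φ b) :
    WeightLe V (fun u => centred G (F.init.map Prod.fst) F.M₁ φ p u -
      centred G (F.init.map Prod.snd) F.M₂ φ p u) (c * b * (Q p + T (p + 1))) := by
  have hc := h.bdd.pos.le
  have hb := hφ.nonneg
  have hT := h.predictor_nonneg (p + 1)
  have hQ := h.step_nonneg p
  have hm : ∀ (μ : Measure U) (M : ℕ → Kernel U U) [∀ p, IsMarkovKernel (M p)],
      Measurable (centred G μ M φ p) := fun μ M _ =>
    ((G.measurable p).mul hφ.measurable.stronglyMeasurable.integral_kernel.measurable).sub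
      ((G.measurable p).const_mul _)
  refine ⟨(hm _ _).sub (hm _ _), by positivity, fun u => ?_⟩
  have hV := h.weight.one_le u
  have h1 : ∀ g m m' R R' : ℝ, g * m - R * g - (g * m' - R' * g) =
      g * ((m - m') - (R - R')) := by intros; ring
  unfold centred
  rw [h1, abs_mul]
  have h2 := h.step_le p φ b hφ u
  have h3 := h.predictor_le (p + 1) φ b hφ
  have h4 : b * T (p + 1) ≤ b * T (p + 1) * V u := le_mul_of_one_le_right (by positivity) hV
  calc _ ≤ c * (b * Q p * V u + b * T (p + 1)) := by
        gcongr
        · exact h.bdd.abs_le p u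
        · exact (abs_sub _ _).trans (add_le_add h2 h3)
    _ ≤ c * (b * Q p * V u + b * T (p + 1) * V u) := by gcongr
    _ = _ := by ring

end PairBounds

end PairErrors

section PairErrors

theorem Projects.errConst_nonneg {c a : ℝ} (hc : 0 ≤ c) (ha : 0 ≤ a) (p : ℕ) :
    0 ≤ Projects.errConst c a p := by
  induction p with
  | zero => exact ha
  | succ p ih => rw [Projects.errConst, moment]; positivity

theorem Projects.normErrConst_nonneg {c : ℝ} (hc : 0 ≤ c) (n : ℕ) :
    0 ≤ Projects.normErrConst c n := by
  induction n with
  | zero => exact le_rfl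
  | succ n ih =>
    have := Projects.errConst_nonneg hc zero_le_one n
    rw [Projects.normErrConst]; positivity

theorem discrepancy_succ (D T Q : ℕ → ℝ) (p : ℕ) : discrepancy D T Q (p + 1) =
    discrepancy D T Q p + D (p + 1) + T (p + 1) + Q p := by
  simp only [discrepancy, sum_range_succ]; ring

variable {U : Type*} [MetricSpace U] [SecondCountableTopology U] [MeasurableSpace U] [BorelSpace U]

namespace PairBounds

variable {F : Coupled U} {G : Potentials U} {N : ℕ} [NeZero N] {c : ℝ} {Λ : ℕ → ℝ}
  {V : U → ℝ} {a : ℝ} {D T Q : ℕ → ℝ}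

theorem discrepancy_nonneg (h : PairBounds F G N c Λ V a D T Q) (p : ℕ) :
    0 ≤ discrepancy D T Q p :=
  add_nonneg (sum_nonneg fun q _ => add_nonneg (h.dist_le q).nonneg (h.predictor_nonneg q))
    (sum_nonneg fun q _ => h.step_nonneg q)

theorem predictor_le_discrepancy (h : PairBounds F G N c Λ V a D T Q) (p : ℕ) :
    T p ≤ discrepancy D T Q p := by
  have h1 := single_le_sum (f := fun q => D q + T q)
    (fun q _ => add_nonneg (h.dist_le q).nonneg (h.predictor_nonneg q)) (self_mem_range_succ p)
  have h2 := sum_nonneg (s := range p) fun q _ => h.step_nonneg q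
  have h3 := (h.dist_le p).nonneg
  simp only [discrepancy] at h1 ⊢
  linarith

theorem pairConst_nonneg (h : PairBounds F G N c Λ V a D T Q) (p : ℕ) :
    0 ≤ pairConst c a Λ p := by
  have hc := h.bdd.pos.le
  induction p with
  | zero => simp [pairConst]
  | succ p ih =>
    have h1 := Projects.errConst_nonneg hc h.weight.nonneg p
    have h2 := Projects.errConst_nonneg hc zero_le_one p
    have h3 := h.lip_nonneg p
    rw [pairConst]; positivity

theorem l2Le_sub (h : PairBounds F G N c Λ V a D T Q) {φ : U → ℝ} {b : ℝ} (hφ : BoundedLip φ b)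
    (p : ℕ) : L2Le (F.law G N) (fun ω => φ (ω p 0).1 - φ (ω p 0).2) (2 * b * D p) := by
  have hm := hφ.measurable
  have hb := hφ.nonneg
  refine (h.dist_le p).of_abs_le_mul ((hm.comp (by fun_prop)).sub (hm.comp (by fun_prop)))
    (by positivity) fun ω => ?_
  rw [abs_of_nonneg (le_min dist_nonneg zero_le_one)]
  exact hφ.abs_sub_le _ _

/-- The error of the difference of the two empirical measures at time `p`. -/
theorem l2Le_avg_sub_avg (h : PairBounds F G N c Λ V a D T Q) (p : ℕ) :
    ∀ {φ : U → ℝ} {b : ℝ}, BoundedLip φ b → L2Le (F.law G N)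
      (fun ω => avg φ (fun i => (ω p i).1) - avg φ (fun i => (ω p i).2) -
        (∫ u, φ u ∂(F.η₁ G p) - ∫ u, φ u ∂(F.η₂ G p)))
      (pairConst c a Λ p * b * discrepancy D T Q p / Real.sqrt N) := by
  induction p with
  | zero =>
    intro φ b hφ
    have hm := hφ.measurable
    have hf : Measurable fun v : U × U => φ v.1 - φ v.2 := by fun_prop
    have h1 : L2Le F.init (fun v => φ v.1 - φ v.2) (2 * b * D 0) := by
      have := (l2Le_map_iff (by fun_prop) hf).2 (h.l2Le_sub hφ 0)
      rwa [F.law_eq_systemLaw, systemLaw_map_zero] at this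
    have h2 := h1.avg_systemLaw_zero (N := N) (K := fun p => coupledMoveKernel G p N (F.M p))
    have hint : ∀ ν : Measure (U × U), IsProbabilityMeasure ν →
        Integrable (fun v => φ v.1) ν ∧ Integrable (fun v => φ v.2) ν := fun ν _ =>
      ⟨(L2Le.of_abs_le (hm.comp measurable_fst) hφ.nonneg fun v => hφ.le v.1).integrable,
        (L2Le.of_abs_le (hm.comp measurable_snd) hφ.nonneg fun v => hφ.le v.2).integrable⟩
    refine (h2.congr fun ω => ?_).weaken ?_
    · rw [avg_sub, integral_sub (hint _ F.isProb).1 (hint _ F.isProb).2, Coupled.η₁, Coupled.η₂,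
        predictor_zero, predictor_zero, integral_map measurable_fst.aemeasurable
          hm.aestronglyMeasurable, integral_map measurable_snd.aemeasurable
          hm.aestronglyMeasurable]
      rfl
    · have hT := h.predictor_nonneg 0
      have hb := hφ.nonneg
      rw [pairConst]
      gcongr
      simp [discrepancy, hT]
  | succ p ih =>
    intro φ b hφ
    have hc := h.bdd.pos
    have hb := hφ.nonneg
    have hm := hφ.measurable
    have hP := h.pairConst_nonneg p
    have hs := h.discrepancy_nonneg p
    have hTs := h.predictor_le_discrepancy p
    have hT := h.predictor_nonneg p
    have hT1 := h.predictor_nonneg (p + 1)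
    have hQ := h.step_nonneg p
    have hD := (h.dist_le (p + 1)).nonneg
    have hΛ := h.lip_nonneg p
    have hw1 : Weight (F.init.map Prod.fst) F.M₁ (fun _ => 1) 1 := Weight.trivial
    have hw2 : Weight (F.init.map Prod.snd) F.M₂ (fun _ => 1) 1 := Weight.trivial
    set f₁ := centred G (F.init.map Prod.fst) F.M₁ φ p with hf₁
    set f₂ := centred G (F.init.map Prod.snd) F.M₂ φ p with hf₂
    have hF₁ : BoundedLip f₁ (c * (Λ p + 2) * b) := h.boundedLip_centred p hφ
    have hF₁w := hw1.weightLe_centred h.bdd hφ.weightLe p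
    have hprob1 : IsProbabilityMeasure (F.η₁ G p) := isProbabilityMeasure_predictor h.bdd p
    have hprob2 : IsProbabilityMeasure (F.η₂ G p) := isProbabilityMeasure_predictor h.bdd p
    have hprob3 : IsProbabilityMeasure (predictor G (F.init.map Prod.snd) F.M₂ (p + 1)) :=
      isProbabilityMeasure_predictor h.bdd (p + 1)
    have hF₂ : ∀ u, |f₂ u| ≤ 2 * c * b := fun u => by
      have hR := abs_integral_le (ν := predictor G (F.init.map Prod.snd) F.M₂ (p + 1)) hφ
      have hm := abs_integral_le (ν := F.M₂ p u) hφ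
      calc _ ≤ |G.val p u * ∫ y, φ y ∂(F.M₂ p u)| + |_ * G.val p u| := abs_sub _ _
        _ ≤ c * b + b * c := by
            rw [abs_mul, abs_mul]
            gcongr
            exacts [h.bdd.abs_le p u, h.bdd.abs_le p u]
        _ = _ := by ring
    have hF₂m : Measurable f₂ := (hw2.weightLe_centred h.bdd hφ.weightLe p).meas
    have hF₂w : WeightLe (fun _ => 1) f₂ (2 * c * b) :=
      ⟨hF₂m, by positivity, fun u => by simpa using hF₂ u⟩
    have hF₁m : Measurable f₁ := hF₁.measurable
    have hF₁₂ : WeightLe V (fun u => f₁ u - f₂ u) (c * b * (Q p + T (p + 1))) :=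
      h.weightLe_centred_sub p hφ
    set A₂ : (ℕ → Fin N → U × U) → ℝ := fun ω =>
      avg f₂ (fun i => (ω p i).2) - ∫ u, f₂ u ∂(F.η₂ G p) with hA₂
    set g₁ : (ℕ → Fin N → U × U) → ℝ := fun ω => avg (G.val p) (fun i => (ω p i).1) with hg₁
    set g₂ : (ℕ → Fin N → U × U) → ℝ := fun ω => avg (G.val p) (fun i => (ω p i).2) with hg₂
    have hA₂m : Measurable A₂ := ((measurable_avg hF₂m).comp (by fun_prop)).sub_const _
    have hg₁m : Measurable g₁ := (measurable_avg (G.measurable p)).comp (by fun_prop)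
    have hg₂m : Measurable g₂ := (measurable_avg (G.measurable p)).comp (by fun_prop)
    have hg₁p : ∀ ω, 0 < g₁ ω := fun ω => h.bdd.avg_pos p _
    have hg₂p : ∀ ω, 0 < g₂ ω := fun ω => h.bdd.avg_pos p _
    have hg₁i : ∀ ω, |(g₁ ω)⁻¹| ≤ c := fun ω => by
      rw [abs_of_pos (inv_pos.2 (hg₁p ω))]
      exact inv_le_of_inv_le₀ hc (h.bdd.inv_le_avg p _)
    have hg₂i : ∀ ω, |(g₂ ω)⁻¹| ≤ c := fun ω => by
      rw [abs_of_pos (inv_pos.2 (hg₂p ω))]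
      exact inv_le_of_inv_le₀ hc (h.bdd.inv_le_avg p _)
    have hA₂b : ∀ ω, |A₂ ω| ≤ 4 * c * b := fun ω => by
      have h1 := abs_avg_le hF₂ fun i => (ω p i).2
      have h2 := (L2Le.of_abs_le (μ := F.η₂ G p) hF₂m (by positivity) hF₂).abs_integral_le
      refine (abs_sub _ _).trans ?_
      linarith
    -- With A_j the error of the average of f_j in coordinate j, the bias is A₁/g₁ − A₂/g₂ = (A₁ −
    -- A₂)/g₁ − A₂(g₁ − g₂)/(g₁g₂). Here A₁ − A₂ is the coupled error for f₁ (`t₁`) plus the coarse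
    -- error for f₁ − f₂ (`t₂`). Likewise g₁ − g₂ is its own coupled error (`t₃`, with A₂ merely
    -- bounded) plus its limit E, which is small with the predictors (`t₄`, with A₂ of order
    -- N^{-1/2}).
    have t₁ := (ih hF₁).mul_of_abs_le hg₁m.inv hc.le hg₁i
    have t₂ := ((F.projects_snd (G := G) (N := N)).l2Le_avg_sub h.bdd h.weight p
      hF₁₂).mul_of_abs_le hg₁m.inv hc.le hg₁i
    have t₃ := (ih (h.boundedLip_val p)).mul_of_abs_le
      (g := fun ω => (g₁ ω)⁻¹ * (g₂ ω)⁻¹ * A₂ ω) ((hg₁m.inv.mul hg₂m.inv).mul hA₂m)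
      (b := c * c * (4 * c * b)) (by positivity) fun ω => by
        rw [abs_mul, abs_mul]
        gcongr
        exacts [hg₁i ω, hg₂i ω, hA₂b ω]
    have hE := h.predictor_le p _ _ (h.boundedLip_val p)
    set E := ∫ u, G.val p u ∂(F.η₁ G p) - ∫ u, G.val p u ∂(F.η₂ G p) with hEdef
    have t₄ := ((F.projects_snd (G := G) (N := N)).l2Le_avg_sub h.bdd hw2 p hF₂w).mul_of_abs_le
      (g := fun ω => (g₁ ω)⁻¹ * (g₂ ω)⁻¹ * E) ((hg₁m.inv.mul hg₂m.inv).mul_const _)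
      (b := c * c * (c * T p)) (by positivity) fun ω => by
        rw [abs_mul, abs_mul]
        gcongr
        exacts [hg₁i ω, hg₂i ω]
    have hstep : ∀ x : Fin N → U × U,
        ∫ v, (φ v.1 - φ v.2) ∂(coupledMoveKernel G p N (F.M p) x) =
          ∫ v, φ v.1 ∂(coupledMoveKernel G p N (F.M p) x) -
            ∫ v, φ v.2 ∂(coupledMoveKernel G p N (F.M p) x) := fun x =>
      integral_sub
        (L2Le.of_abs_le (hm.comp measurable_fst) hφ.nonneg fun v => hφ.le v.1).integrable
        (L2Le.of_abs_le (hm.comp measurable_snd) hφ.nonneg fun v => hφ.le v.2).integrable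
    have hf : Measurable fun v : U × U => φ v.1 - φ v.2 := by fun_prop
    have hfin := L2Le.avg_systemLaw_succ (f := fun v : U × U => φ v.1 - φ v.2)
      (t := ∫ u, φ u ∂(F.η₁ G (p + 1)) - ∫ u, φ u ∂(F.η₂ G (p + 1)))
      (h.l2Le_sub hφ (p + 1)) hf (((t₁.add t₂).sub (t₃.add t₄)).congr fun ω => by
        have e1 := (F.projects_fst (G := G) (N := N)).integral_step_sub h.bdd hw1 hφ.weightLe p
          (ω p)
        have e2 := (F.projects_snd (G := G) (N := N)).integral_step_sub h.bdd hw2 hφ.weightLe p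
          (ω p)
        have e3 : ∫ u, (f₁ u - f₂ u) ∂(F.η₂ G p) =
            ∫ u, f₁ u ∂(F.η₂ G p) - ∫ u, f₂ u ∂(F.η₂ G p) :=
          integral_sub (L2Le.of_abs_le hF₁m hF₁.nonneg hF₁.le).integrable
            (L2Le.of_abs_le hF₂m (by positivity) hF₂).integrable
        have e4 : ∫ u, (f₁ u - f₂ u) ∂(predictor G (F.init.map Prod.snd) F.M₂ p) =
            ∫ u, f₁ u ∂(F.η₂ G p) - ∫ u, f₂ u ∂(F.η₂ G p) := e3
        rw [hstep, avg_sub, e4]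
        have e5 : ∀ x y x' y' : ℝ, x - y - (x' - y') = (x - x') - (y - y') := by intros; ring
        rw [e5 (∫ v, φ v.1 ∂(coupledMoveKernel G p N (F.M p) (ω p)))]
        refine Eq.trans ?_ (congrArg₂ (· - ·) e1.symm e2.symm)
        have n1 := (hg₁p ω).ne'
        have n2 := (hg₂p ω).ne'
        simp only [hA₂, hEdef]
        change _ = (avg f₁ (fun i => (ω p i).1) - ∫ u, f₁ u ∂(F.η₁ G p)) / g₁ ω -
          (avg f₂ (fun i => (ω p i).2) - ∫ u, f₂ u ∂(F.η₂ G p)) / g₂ ω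
        change (g₁ ω)⁻¹ * _ + (g₁ ω)⁻¹ * _ - ((g₁ ω)⁻¹ * (g₂ ω)⁻¹ * _ * (g₁ ω - g₂ ω - _) +
          (g₁ ω)⁻¹ * (g₂ ω)⁻¹ * _ * (avg f₂ (fun i => (ω p i).2) - ∫ u, f₂ u ∂(F.η₂ G p))) = _
        field_simp
        ring)
    refine (hfin.congr fun ω => ?_).weaken ?_
    · rw [avg_sub]; rfl
    · have he1 := Projects.errConst_nonneg hc.le h.weight.nonneg p
      have he2 := Projects.errConst_nonneg hc.le zero_le_one p
      have hsucc := discrepancy_succ D T Q p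
      rw [← mul_div_assoc, ← mul_div_assoc, ← mul_div_assoc, ← mul_div_assoc, ← add_div, ← add_div,
        ← add_div, ← add_div]
      gcongr
      rw [pairConst]
      have b1 : D (p + 1) ≤ discrepancy D T Q (p + 1) := by linarith
      have b2 : discrepancy D T Q p ≤ discrepancy D T Q (p + 1) := by linarith
      have b3 : Q p + T (p + 1) ≤ discrepancy D T Q (p + 1) := by linarith
      have b4 : T p ≤ discrepancy D T Q (p + 1) := by linarith
      set S := discrepancy D T Q (p + 1)
      set s := discrepancy D T Q p
      calc _ ≤ 2 * b * S + (c * (pairConst c a Λ p * (c * (Λ p + 2) * b) * S) +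
            c * (Projects.errConst c a p * (c * b * S)) +
            (c * c * (4 * c * b) * (pairConst c a Λ p * c * S) +
              c * c * (c * S) * (Projects.errConst c 1 p * (2 * c * b)))) := by gcongr
        _ = _ := by ring

end PairBounds

/-- The accumulated discrepancy that governs the estimates of the normalizing constants; `z` is the
difference of the two normalizing constants. -/
def normDiscrepancy (D T Q z : ℕ → ℝ) : ℕ → ℝ
  | 0 => 0
  | n + 1 => discrepancy D T Q n + normDiscrepancy D T Q z n + |z n|

/-- The constants of the error of the difference of two coupled normalizing constants. -/
def normPairConst (c a : ℝ) (Λ : ℕ → ℝ) : ℕ → ℝ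
  | 0 => 0
  | n + 1 => c * normPairConst c a Λ n + Projects.errConst c 1 n * c +
      c * Projects.normErrConst c n + c ^ n * (pairConst c a Λ n * c)

/-- The constants of the error of the ratio of two coupled normalizing constants. -/
def ratioConst (c a : ℝ) (Λ : ℕ → ℝ) (n : ℕ) : ℝ :=
  c ^ n * normPairConst c a Λ n + c ^ n * c ^ n * Projects.normErrConst c n

namespace PairBounds

variable {F : Coupled U} {G : Potentials U} {N : ℕ} [NeZero N] {c : ℝ} {Λ : ℕ → ℝ}
  {V : U → ℝ} {a : ℝ} {D T Q : ℕ → ℝ}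

theorem normDiscrepancy_nonneg (h : PairBounds F G N c Λ V a D T Q) (z : ℕ → ℝ) (n : ℕ) :
    0 ≤ normDiscrepancy D T Q z n := by
  induction n with
  | zero => exact le_rfl
  | succ n ih => exact add_nonneg (add_nonneg (h.discrepancy_nonneg n) ih) (abs_nonneg _)

theorem normPairConst_nonneg (h : PairBounds F G N c Λ V a D T Q) (n : ℕ) :
    0 ≤ normPairConst c a Λ n := by
  induction n with
  | zero => exact le_rfl
  | succ n ih =>
    have hc := h.bdd.pos.le
    have h1 := Projects.errConst_nonneg hc zero_le_one n
    have h2 := Projects.normErrConst_nonneg hc n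
    have h3 := h.pairConst_nonneg n
    rw [normPairConst]; positivity

/-- The error of the difference of the estimates of the normalizing constants. -/
theorem l2Le_normEst_sub (h : PairBounds F G N c Λ V a D T Q) (n : ℕ) : L2Le (F.law G N)
    (fun ω => normEst G n N (fun p i => (ω p i).1) - normEst G n N (fun p i => (ω p i).2) -
      (F.Z₁ G n - F.Z₂ G n))
    (normPairConst c a Λ n * normDiscrepancy D T Q (fun n => F.Z₁ G n - F.Z₂ G n) n /
      Real.sqrt N) := by
  induction n with
  | zero =>
    refine (L2Le.const (μ := F.law G N) 0).congr (fun ω => ?_) |>.weaken (by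
      simp [normPairConst])
    rw [normEst_zero, normEst_zero, Coupled.Z₁, Coupled.Z₂, normConst_zero, normConst_zero]; simp
  | succ n ih =>
    have hc := h.bdd.pos
    have hs := h.discrepancy_nonneg n
    have hP := h.pairConst_nonneg n
    have hnp := h.normPairConst_nonneg n
    have hT := h.predictor_nonneg n
    have hTs := h.predictor_le_discrepancy n
    have hnd := h.normDiscrepancy_nonneg (fun n => F.Z₁ G n - F.Z₂ G n) n
    have he1 := Projects.errConst_nonneg hc.le zero_le_one n
    have he2 := Projects.normErrConst_nonneg hc.le n
    have hprob1 : IsProbabilityMeasure (F.η₁ G n) := isProbabilityMeasure_predictor h.bdd n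
    have hprob2 : IsProbabilityMeasure (F.η₂ G n) := isProbabilityMeasure_predictor h.bdd n
    have hw1 : Weight (F.init.map Prod.fst) F.M₁ (fun _ => 1) 1 := Weight.trivial
    have hg₁m : Measurable fun ω : ℕ → Fin N → U × U => avg (G.val n) fun i => (ω n i).1 :=
      (measurable_avg (G.measurable n)).comp (by fun_prop)
    have ha₂m : Measurable fun ω : ℕ → Fin N → U × U => normEst G n N fun p i => (ω p i).2 :=
      (measurable_normEst n).comp (by fun_prop)
    -- With a_j the estimates, g_j the new averages and m_j their limits, a₁g₁ − a₂g₂ − (Z₁m₁ −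
    -- Z₂m₂) is the sum of g₁(a₁ − a₂ − Z₁ + Z₂), (Z₁ − Z₂)(g₁ − m₁), (m₁ − m₂)(a₂ − Z₂) and a₂(g₁ −
    -- g₂ − m₁ + m₂). Each has one coefficient that is bounded or small and one factor of order
    -- N^{-1/2}.
    have t₁ := ih.mul_of_abs_le hg₁m hc.le fun ω => abs_avg_le (h.bdd.abs_le n) _
    have t₂ := ((F.projects_fst (G := G) (N := N)).l2Le_avg_sub h.bdd hw1 n
      (hw1.weightLe_val h.bdd n)).const_mul (F.Z₁ G n - F.Z₂ G n)
    have t₃ := ((F.projects_snd (G := G) (N := N)).l2Le_normEst_sub h.bdd n).const_mul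
      (∫ u, G.val n u ∂(F.η₁ G n) - ∫ u, G.val n u ∂(F.η₂ G n))
    have hE := h.predictor_le n _ _ (h.boundedLip_val n)
    have t₄ := (h.l2Le_avg_sub_avg n (h.boundedLip_val n)).mul_of_abs_le ha₂m
      (pow_pos hc n).le fun ω => h.bdd.abs_normEst_le n _
    refine (((t₁.add t₂).add t₃).add t₄).congr (fun ω => ?_) |>.weaken ?_
    · have e1 : F.Z₁ G (n + 1) = F.Z₁ G n * ∫ u, G.val n u ∂(F.η₁ G n) := normConst_succ h.bdd n
      have e2 : F.Z₂ G (n + 1) = F.Z₂ G n * ∫ u, G.val n u ∂(F.η₂ G n) := normConst_succ h.bdd n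
      rw [e1, e2, normEst_succ, normEst_succ]
      change _ * (_ - _ - (F.Z₁ G n - F.Z₂ G n)) + (F.Z₁ G n - F.Z₂ G n) *
        (avg (G.val n) (fun i => (ω n i).1) - ∫ u, G.val n u ∂(F.η₁ G n)) +
        _ * (normEst G n N (fun p i => (ω p i).2) - F.Z₂ G n) + _ = _
      ring
    · rw [← mul_div_assoc, ← mul_div_assoc, ← mul_div_assoc, ← mul_div_assoc, ← add_div, ← add_div,
        ← add_div]
      gcongr
      simp only [normPairConst, normDiscrepancy]
      set z := |F.Z₁ G n - F.Z₂ G n|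
      have hz : 0 ≤ z := abs_nonneg _
      set s := discrepancy D T Q n
      set t := normDiscrepancy D T Q (fun n => F.Z₁ G n - F.Z₂ G n) n
      set S := s + t + z
      calc _ ≤ c * (normPairConst c a Λ n * S) + S * (Projects.errConst c 1 n * c) +
            c * S * Projects.normErrConst c n + c ^ n * (pairConst c a Λ n * c * S) := by
            gcongr
            · linarith
            · linarith
            · exact hE.trans (mul_le_mul_of_nonneg_left (by linarith) hc.le)
            · linarith
        _ = _ := by ring

/-- The error of the ratio of the estimates of the normalizing constants. -/
theorem l2Le_ratio_sub (h : PairBounds F G N c Λ V a D T Q) (n : ℕ) : L2Le (F.law G N)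
    (fun ω => normEst G n N (fun p i => (ω p i).1) / normEst G n N (fun p i => (ω p i).2) -
      F.Z₁ G n / F.Z₂ G n)
    (ratioConst c a Λ n * (normDiscrepancy D T Q (fun n => F.Z₁ G n - F.Z₂ G n) n +
      |F.Z₁ G n - F.Z₂ G n|) / Real.sqrt N) := by
  have hc := h.bdd.pos
  have hcn := pow_pos hc n
  have hnp := h.normPairConst_nonneg n
  have he2 := Projects.normErrConst_nonneg hc.le n
  have hnd := h.normDiscrepancy_nonneg (fun n => F.Z₁ G n - F.Z₂ G n) n
  have hZ : 0 < F.Z₂ G n := normConst_pos h.bdd n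
  have hZi : (c ^ n)⁻¹ ≤ F.Z₂ G n := h.bdd.inv_le_normConst n
  have hap : ∀ ω : ℕ → Fin N → U × U, 0 < normEst G n N fun p i => (ω p i).2 := fun ω =>
    h.bdd.normEst_pos n _
  have ham : Measurable fun ω : ℕ → Fin N → U × U => (normEst G n N fun p i => (ω p i).2)⁻¹ :=
    ((measurable_normEst n).comp (by fun_prop)).inv
  have hai : ∀ ω : ℕ → Fin N → U × U, |(normEst G n N fun p i => (ω p i).2)⁻¹| ≤ c ^ n := fun ω => by
    rw [abs_of_pos (inv_pos.2 (hap ω))]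
    exact inv_le_of_inv_le₀ hcn (h.bdd.inv_le_normEst n _)
  have hZa : |(F.Z₂ G n)⁻¹| ≤ c ^ n := by
    rw [abs_of_pos (inv_pos.2 hZ)]
    exact inv_le_of_inv_le₀ hcn hZi
  -- For estimates x, y with limits X, Y: x/y − X/Y = y⁻¹(x − y − (X − Y)) − (yY)⁻¹(X − Y)(y − Y).
  -- The second term is the origin of |γ₁(1) − γ₂(1)| at time `n` in the rate.
  have t₁ := (h.l2Le_normEst_sub n).mul_of_abs_le ham hcn.le hai
  have hgm := (ham.mul_const (F.Z₂ G n)⁻¹).mul_const (F.Z₁ G n - F.Z₂ G n)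
  have hgb : ∀ ω : ℕ → Fin N → U × U, |(normEst G n N fun p i => (ω p i).2)⁻¹ * (F.Z₂ G n)⁻¹ *
      (F.Z₁ G n - F.Z₂ G n)| ≤ c ^ n * c ^ n * |F.Z₁ G n - F.Z₂ G n| := fun ω => by
    rw [abs_mul, abs_mul]
    gcongr
    exact hai ω
  have t₂' := (F.projects_snd (G := G) (N := N)).l2Le_normEst_sub h.bdd n
  have t₂ := t₂'.mul_of_abs_le hgm (by positivity) hgb
  refine (t₁.sub t₂).congr (fun ω => ?_) |>.weaken ?_
  · have n1 := (hap ω).ne'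
    have key : ∀ x y X Y : ℝ, y ≠ 0 → Y ≠ 0 →
        y⁻¹ * (x - y - (X - Y)) - y⁻¹ * Y⁻¹ * (X - Y) * (y - Y) = x / y - X / Y := by
      intro x y X Y hy hY
      field_simp
      ring
    exact key _ _ _ _ n1 hZ.ne'
  · rw [← mul_div_assoc, ← mul_div_assoc, ← add_div]
    gcongr
    rw [ratioConst]
    set t := normDiscrepancy D T Q (fun n => F.Z₁ G n - F.Z₂ G n) n
    have hz := abs_nonneg (F.Z₁ G n - F.Z₂ G n)
    set z := |F.Z₁ G n - F.Z₂ G n|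
    calc _ ≤ c ^ n * (normPairConst c a Λ n * (t + z)) +
          c ^ n * c ^ n * (t + z) * Projects.normErrConst c n := by gcongr <;> linarith
      _ = _ := by ring

end PairBounds

end PairErrors

/-! ### Products of independent factors and the multilevel estimator -/

section Products

variable {ι : Type*} [Fintype ι] [DecidableEq ι] {Ω : ι → Type*} [∀ l, MeasurableSpace (Ω l)]
  {μ : (l : ι) → Measure (Ω l)} [∀ l, IsProbabilityMeasure (μ l)]

theorem L2Le.prod_pi {f : (l : ι) → Ω l → ℝ} {r : ι → ℝ} (h : ∀ l, L2Le (μ l) (f l) (r l)) :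
    L2Le (Measure.pi μ) (fun ω => ∏ l, f l (ω l)) (∏ l, r l) := by
  refine L2Le.of_integral_sq_le
    (Finset.measurable_prod _ fun l _ => (h l).meas.comp (measurable_pi_apply l))
    (prod_nonneg fun l _ => (h l).nonneg) ?_ ?_
  · simp_rw [← Finset.prod_pow]
    exact Integrable.fintype_prod_dep (f := fun l x => f l x ^ 2) fun l => (h l).integrable_sq
  · simp_rw [← Finset.prod_pow]
    rw [integral_fintype_prod_eq_prod fun l x => f l x ^ 2]
    exact prod_le_prod (fun l _ => integral_nonneg fun _ => sq_nonneg _) fun l _ =>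
      (h l).integral_sq_le

/-- The coordinates outside `s` carry the constant 1, which has norm 1 under a probability measure.
-/
theorem L2Le.prod_finset {f : (l : ι) → Ω l → ℝ} {r : ι → ℝ} (s : Finset ι)
    (h : ∀ l ∈ s, L2Le (μ l) (f l) (r l)) :
    L2Le (Measure.pi μ) (fun ω => ∏ l ∈ s, f l (ω l)) (∏ l ∈ s, r l) := by
  have := L2Le.prod_pi (μ := μ) (f := fun l x => if l ∈ s then f l x else 1)
    (r := fun l => if l ∈ s then r l else 1) fun l => by
      by_cases hl : l ∈ s
      · simpa [hl] using h l hl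
      · simpa [hl] using L2Le.const (μ := μ l) 1
  simpa [Finset.prod_ite_mem] using this

/-- The error of a product of independent variables. -/
theorem L2Le.prod_sub_prod {X : (l : ι) → Ω l → ℝ} {x y e : ι → ℝ} (s : Finset ι)
    (hX : ∀ l, L2Le (μ l) (X l) (y l)) (hx : ∀ l, |x l| ≤ y l) (hy : ∀ l, 1 ≤ y l)
    (he : ∀ l, L2Le (μ l) (fun ω => X l ω - x l) (e l)) :
    L2Le (Measure.pi μ) (fun ω => ∏ l ∈ s, X l (ω l) - ∏ l ∈ s, x l)
      ((∏ l ∈ s, y l) * ∑ l ∈ s, e l) := by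
  induction s using Finset.induction_on with
  | empty => simpa using L2Le.const (μ := Measure.pi μ) 0
  | insert a s ha ih =>
    -- The new factor is split off: (X_a − x_a)∏X + x_a(∏X − ∏x). The first term is again a product
    -- of functions of independent coordinates, hence the updated family.
    have h1 := L2Le.prod_finset (μ := μ) (f := Function.update X a fun ω => X a ω - x a)
      (r := Function.update y a (e a)) (insert a s) fun l _ => by
        by_cases hl : l = a
        · subst hl; simpa using he l
        · simpa [hl] using hX l
    have h2 := ih.const_mul (x a)
    have hP : 0 ≤ ∏ l ∈ s, y l := prod_nonneg fun l _ => zero_le_one.trans (hy l)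
    refine (h1.add h2).congr (fun ω => ?_) |>.weaken ?_
    · rw [prod_insert ha, prod_insert ha, prod_insert ha, Function.update_self,
        prod_congr rfl fun l hl => by rw [Function.update_of_ne (ne_of_mem_of_not_mem hl ha)]]
      ring
    · rw [prod_insert ha, prod_insert ha, sum_insert ha, Function.update_self,
        prod_congr rfl fun l hl => by rw [Function.update_of_ne (ne_of_mem_of_not_mem hl ha)]]
      have h3 := (he a).nonneg
      have h4 : e a * ∏ l ∈ s, y l ≤ y a * (e a * ∏ l ∈ s, y l) :=
        le_mul_of_one_le_left (by positivity) (hy a)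
      have h5 := mul_le_mul_of_nonneg_right (hx a) ih.nonneg
      linarith

theorem L2Le.mul_prod {α β : Type*} [MeasurableSpace α] [MeasurableSpace β] {μ : Measure α}
    {ν : Measure β} [SFinite μ] [SFinite ν] {f : α → ℝ} {g : β → ℝ} {r s : ℝ} (hf : L2Le μ f r)
    (hg : L2Le ν g s) : L2Le (μ.prod ν) (fun ω => f ω.1 * g ω.2) (r * s) := by
  refine L2Le.of_integral_sq_le ((hf.meas.comp measurable_fst).mul (hg.meas.comp measurable_snd))
    (mul_nonneg hf.nonneg hg.nonneg) ?_ ?_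
  · simp_rw [mul_pow]
    exact hf.integrable_sq.mul_prod hg.integrable_sq
  · simp_rw [mul_pow]
    rw [integral_prod_mul (fun x => f x ^ 2) fun y => g y ^ 2]
    exact mul_le_mul hf.integral_sq_le hg.integral_sq_le (integral_nonneg fun _ => sq_nonneg _)
      (sq_nonneg _)

end Products

section Multilevel

variable {U : Type*} [MetricSpace U] [SecondCountableTopology U] [MeasurableSpace U] [BorelSpace U]

instance {U : Type*} [MeasurableSpace U] (F : Single U) (G : Potentials U) (N : ℕ) [NeZero N] :
    IsProbabilityMeasure (F.law G N) := by
  unfold Single.law; infer_instance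

namespace Model

/-- The error of the multilevel estimator, in terms of the errors of the factors. -/
theorem l2Le_estimator_sub (m : Model U) {n L : ℕ} {N : ℕ → ℕ+} {e₀ z₀ S : ℝ} {e s : ℕ → ℝ}
    (h₀ : L2Le (m.base.law m.G (N 0)) (fun ω => normEst m.G n (N 0) ω - m.base.Z m.G n) e₀)
    (hz : |m.base.Z m.G n| ≤ z₀)
    (h : ∀ l, L2Le ((m.pair l).law m.G (N (l + 1)))
      (fun ω => normEst m.G n (N (l + 1)) (fun p i => (ω p i).1) /
        normEst m.G n (N (l + 1)) (fun p i => (ω p i).2) -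
          (m.pair l).Z₁ m.G n / (m.pair l).Z₂ m.G n) (e l))
    (hx : ∀ l, |(m.pair l).Z₁ m.G n / (m.pair l).Z₂ m.G n| ≤ 1 + s l) (hes : ∀ l, e l ≤ s l)
    (hS : ∑ l ∈ range L, s l ≤ S) :
    L2Le (m.law N L) (fun ω => m.estimator n N L ω - m.target n L)
      (Real.exp (2 * S) * (e₀ + z₀ * ∑ l ∈ range L, e l)) := by
  set x : ℕ → ℝ := fun l => (m.pair l).Z₁ m.G n / (m.pair l).Z₂ m.G n with hxdef
  have hs : ∀ l, 0 ≤ s l := fun l => (h l).nonneg.trans (hes l)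
  set μ : (l : Fin L) → Measure (ℕ → Fin (N (l + 1)) → U × U) := fun l =>
    (m.pair l).law m.G (N (l + 1)) with hμ
  have hprob : ∀ l, IsProbabilityMeasure (μ l) := fun l => by rw [hμ]; infer_instance
  set X : (l : Fin L) → (ℕ → Fin (N (l + 1)) → U × U) → ℝ := fun l ω =>
    normEst m.G n (N (l + 1)) (fun p i => (ω p i).1) /
      normEst m.G n (N (l + 1)) (fun p i => (ω p i).2) with hXdef
  have he : ∀ l : Fin L, L2Le (μ l) (fun ω => X l ω - x l) (e l) := fun l => h l
  -- One `s l` bounds the excess of the limit over 1, the other the error about that limit.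
  have hX : ∀ l : Fin L, L2Le (μ l) (X l) (1 + 2 * s l) := fun l => by
    have h1 := (he l).add (L2Le.const (μ := μ l) (x l))
    refine (h1.congr fun ω => by ring).weaken ?_
    have := hx l
    have := hes l
    change _ + |(m.pair l).Z₁ m.G n / (m.pair l).Z₂ m.G n| ≤ _
    linarith
  have hP := L2Le.prod_pi hX
  have hPx := L2Le.prod_sub_prod (μ := μ) (X := X) (x := fun l => x l) (y := fun l => 1 + 2 * s l)
    (e := fun l => e l) univ hX (fun l => (hx l).trans (by linarith [hs l]))
    (fun l => by linarith [hs l]) he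
  have hprod : ∏ l : Fin L, (1 + 2 * s l) ≤ Real.exp (2 * S) := by
    calc _ ≤ ∏ l : Fin L, Real.exp (2 * s l) := prod_le_prod
          (fun l _ => by linarith [hs l]) fun l _ => by
            have := Real.add_one_le_exp (2 * s l); linarith
      _ = Real.exp (2 * ∑ l ∈ range L, s l) := by
          rw [← Real.exp_sum, ← mul_sum, Fin.sum_univ_eq_sum_range s]
      _ ≤ _ := Real.exp_le_exp.2 (by linarith)
  have hsum : ∑ l : Fin L, e l = ∑ l ∈ range L, e l := Fin.sum_univ_eq_sum_range e L
  have hxp : ∏ l : Fin L, x l = ∏ l ∈ range L, x l := Fin.prod_univ_eq_prod_range x L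
  have hz₀ : 0 ≤ z₀ := (abs_nonneg _).trans hz
  have hsnn : 0 ≤ ∑ l ∈ range L, e l := sum_nonneg fun l _ => (h l).nonneg
  have hlaw : m.law N L = (m.base.law m.G (N 0)).prod (Measure.pi μ) := rfl
  -- The total error is (X₀ − Z)∏X_l + Z(∏X_l − ∏x_l). In the first term level 0 is independent of
  -- the other levels, so the norms multiply.
  have hA : L2Le (m.law N L) (fun ω => (normEst m.G n (N 0) ω.1 - m.base.Z m.G n) *
      ∏ l, X l (ω.2 l)) (e₀ * Real.exp (2 * S)) :=
    (h₀.mul_prod hP).weaken (mul_le_mul_of_nonneg_left hprod h₀.nonneg)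
  have hB : L2Le (m.law N L) (fun ω => ∏ l, X l (ω.2 l) - ∏ l : Fin L, x l)
      (Real.exp (2 * S) * ∑ l ∈ range L, e l) := by
    rw [hsum] at hPx
    have h3 := hPx.weaken (mul_le_mul_of_nonneg_right hprod hsnn)
    have h4 : (m.law N L).map Prod.snd = Measure.pi μ := by
      rw [hlaw]
      exact Measure.map_snd_prod.trans (by simp)
    rw [← h4] at h3
    exact (l2Le_map_iff measurable_snd h3.meas).1 h3
  refine (hA.add (hB.const_mul (m.base.Z m.G n))).congr (fun ω => ?_) |>.weaken ?_
  · rw [target, ← hxp]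
    change _ = normEst m.G n (N 0) ω.1 * ∏ l, X l (ω.2 l) - _
    ring
  · have := mul_le_mul_of_nonneg_right hz hB.nonneg
    linarith

theorem mse_le_of_l2Le (m : Model U) {n L : ℕ} {N : ℕ → ℕ+} {z r : ℝ}
    (h : L2Le (m.law N L) (fun ω => m.estimator n N L ω - z) r) : m.mse n N L z ≤ r ^ 2 :=
  h.integral_sq_le

end Model

end Multilevel

/-! ### Total variation and kernel distances tested on functions -/

section Distances

variable {α : Type*} [MeasurableSpace α] {μ ν : Measure α}

theorem tvDist_nonneg (μ ν : Measure α) : 0 ≤ tvDist μ ν :=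
  Real.sSup_nonneg fun _ ⟨_, _, hr⟩ => hr ▸ abs_nonneg _

theorem abs_sub_le_tvDist [IsProbabilityMeasure μ] [IsProbabilityMeasure ν] {A : Set α}
    (hA : MeasurableSet A) : |μ.real A - ν.real A| ≤ tvDist μ ν := by
  refine le_csSup ⟨1, ?_⟩ ⟨A, hA, rfl⟩
  rintro r ⟨B, _, rfl⟩
  rw [abs_le]
  have h1 := measureReal_le_one (μ := μ) (s := B)
  have h2 := measureReal_le_one (μ := ν) (s := B)
  have h3 := measureReal_nonneg (μ := μ) (s := B)
  have h4 := measureReal_nonneg (μ := ν) (s := B)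
  constructor <;> linarith

/-- Layer cake: both integrals are integrals over t in (0, b] of the masses of the sets {f ≥ t}, and
these masses differ by at most the total variation distance. -/
theorem abs_integral_sub_le_tvDist_of_nonneg [IsProbabilityMeasure μ] [IsProbabilityMeasure ν]
    {f : α → ℝ} {b : ℝ} (hf : Measurable f) (h0 : ∀ x, 0 ≤ f x) (hb0 : 0 ≤ b)
    (hb : ∀ x, f x ≤ b) : |∫ x, f x ∂μ - ∫ x, f x ∂ν| ≤ tvDist μ ν * b := by
  have hi : ∀ (m : Measure α) [IsProbabilityMeasure m], Integrable f m := fun m _ =>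
    (L2Le.of_abs_le hf hb0 fun x => by rw [abs_of_nonneg (h0 x)]; exact hb x).integrable
  have hm : ∀ (m : Measure α) [IsProbabilityMeasure m],
      IntegrableOn (fun t => m.real {a | t ≤ f a}) (Set.Ioc 0 b) := fun m _ => by
    have hanti : Antitone fun t => m.real {a | t ≤ f a} := fun s t hst =>
      measureReal_mono fun a ha => le_trans hst ha
    exact Integrable.of_bound hanti.measurable.aestronglyMeasurable 1 (.of_forall fun t => by
      rw [Real.norm_of_nonneg measureReal_nonneg]; exact measureReal_le_one)
  rw [(hi μ).integral_eq_integral_Ioc_meas_le (.of_forall h0) (.of_forall hb),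
    (hi ν).integral_eq_integral_Ioc_meas_le (.of_forall h0) (.of_forall hb),
    ← integral_sub (hm μ) (hm ν)]
  have h := norm_setIntegral_le_of_norm_le_const (μ := volume) (s := Set.Ioc 0 b)
    (C := tvDist μ ν) (f := fun t => μ.real {a | t ≤ f a} - ν.real {a | t ≤ f a}) (by simp)
    fun t _ => abs_sub_le_tvDist (measurableSet_le measurable_const hf)
  simpa [Real.volume_real_Ioc_of_le hb0] using h

/-- Adding b produces a function with values in [0, 2b] and does not change the difference of the
integrals; this is the origin of the factor 2. -/
theorem abs_integral_sub_le_tvDist [IsProbabilityMeasure μ] [IsProbabilityMeasure ν]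
    {f : α → ℝ} {b : ℝ} (hf : Measurable f) (hb0 : 0 ≤ b) (hb : ∀ x, |f x| ≤ b) :
    |∫ x, f x ∂μ - ∫ x, f x ∂ν| ≤ b * (2 * tvDist μ ν) := by
  have hi : ∀ (m : Measure α) [IsProbabilityMeasure m], Integrable f m := fun m _ =>
    (L2Le.of_abs_le hf hb0 hb).integrable
  have h := abs_integral_sub_le_tvDist_of_nonneg (μ := μ) (ν := ν) (hf.add_const b)
    (b := 2 * b) (fun x => by linarith [(abs_le.1 (hb x)).1]) (by linarith)
    fun x => by linarith [(abs_le.1 (hb x)).2]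
  rw [integral_add (hi μ) (integrable_const b), integral_add (hi ν) (integrable_const b)] at h
  simp only [integral_const, probReal_univ, one_smul, add_sub_add_right_eq_sub] at h
  linarith

variable {U : Type*} [MetricSpace U] [MeasurableSpace U] [BorelSpace U]

theorem kernelDist_nonneg (K Q : Kernel U U) : 0 ≤ kernelDist K Q :=
  Real.sSup_nonneg fun _ ⟨_, _, _, _, hr⟩ => hr ▸ abs_nonneg _

theorem abs_integral_sub_le_kernelDist (K Q : Kernel U U) [IsMarkovKernel K] [IsMarkovKernel Q]
    {φ : U → ℝ} {b : ℝ} (hφ : BoundedLip φ b) (u : U) :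
    |∫ x, φ x ∂(K u) - ∫ x, φ x ∂(Q u)| ≤ b * kernelDist K Q := by
  have hbdd : BddAbove {r | ∃ (φ : U → ℝ) (u : U), (∀ x, |φ x| ≤ 1) ∧ (∃ k, LipschitzWith k φ) ∧
      r = |∫ x, φ x ∂(K u) - ∫ x, φ x ∂(Q u)|} := by
    refine ⟨2, ?_⟩
    rintro r ⟨ψ, v, h1, ⟨k, hk⟩, rfl⟩
    have hm := hk.continuous.measurable
    have a1 := (L2Le.of_abs_le (μ := K v) hm zero_le_one h1).abs_integral_le
    have a2 := (L2Le.of_abs_le (μ := Q v) hm zero_le_one h1).abs_integral_le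
    exact (abs_sub _ _).trans (by linarith)
  rcases hφ.nonneg.eq_or_lt with hb | hb
  · have h0 : φ = fun _ => 0 := funext fun x => by
      have := hφ.le x
      rw [← hb] at this
      exact abs_nonpos_iff.1 this
    rw [h0, ← hb]; simp
  · have h1 : |∫ x, b⁻¹ * φ x ∂(K u) - ∫ x, b⁻¹ * φ x ∂(Q u)| ≤ kernelDist K Q := by
      refine le_csSup hbdd ⟨fun x => b⁻¹ * φ x, u, fun x => ?_, ⟨(b⁻¹ * b).toNNReal, ?_⟩, rfl⟩
      · rw [abs_mul, abs_of_pos (inv_pos.2 hb), inv_mul_le_iff₀ hb, mul_one]; exact hφ.le x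
      · refine LipschitzWith.of_dist_le_mul fun x y => ?_
        rw [Real.coe_toNNReal _ (by positivity), Real.dist_eq, ← mul_sub, abs_mul,
          abs_of_pos (inv_pos.2 hb), mul_assoc]
        exact mul_le_mul_of_nonneg_left (hφ.lip x y) (inv_pos.2 hb).le
    rw [integral_const_mul, integral_const_mul, ← mul_sub, abs_mul, abs_of_pos (inv_pos.2 hb),
      inv_mul_le_iff₀ hb] at h1
    exact h1

end Distances

/-! ### General levels: discrepancies in terms of B̄ -/

section GeneralLevels

variable {U : Type*} [MetricSpace U] [SecondCountableTopology U] [MeasurableSpace U] [BorelSpace U]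

/-- Constants for the assumption (A). -/
structure Model.Regular (m : Model U) (c : ℝ) (Λ : ℕ → ℝ) : Prop where
  bdd : m.G.Bounded c
  lip_val : ∀ p u v, |m.G.val p u - m.G.val p v| ≤ c * dist u v
  lip_step : ∀ l p φ b, BoundedLip φ b → ∀ u v,
    |∫ y, φ y ∂((m.pair l).M₁ p u) - ∫ y, φ y ∂((m.pair l).M₁ p v)| ≤ Λ p * b * dist u v
  lip_nonneg : ∀ p, 0 ≤ Λ p

theorem Model.AssumptionA.exists_regular {m : Model U} (h : m.AssumptionA) :
    ∃ c Λ, m.Regular c Λ := by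
  obtain ⟨⟨c, hc, C, hC, hG⟩, hM⟩ := h
  choose Λ hΛ hM using hM
  have hle : c ≤ max c C := le_max_left _ _
  refine ⟨max c C, Λ, ⟨hc.le.trans hle, fun n u => ?_, fun n u => ?_⟩, fun p u v => ?_,
    fun l p φ b hφ u v => ?_, fun p => (hΛ p).le⟩
  · exact (inv_anti₀ (one_pos.trans hc) hle).trans (hG n u u).1.le
  · exact (hG n u u).2.1.le.trans hle
  · exact (hG p u v).2.2.trans (mul_le_mul_of_nonneg_right (le_max_right _ _) dist_nonneg)
  · exact hM p l _ (by simp) φ b hφ.le ⟨_, hφ.lipschitzWith⟩ u v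

variable {m : Model U} {c : ℝ} {Λ : ℕ → ℝ}

theorem Potentials.Bounded.normConst_le {U : Type*} [MeasurableSpace U] {G : Potentials U}
    {c : ℝ} (hG : G.Bounded c) {μ : Measure U} [IsProbabilityMeasure μ] {M : ℕ → Kernel U U}
    [∀ p, IsMarkovKernel (M p)] (n : ℕ) : normConst G μ M n ≤ c ^ n := by
  induction n with
  | zero => simp [normConst_zero]
  | succ n ih =>
    have := isProbabilityMeasure_predictor (μ := μ) (M := M) hG n
    rw [normConst_succ hG, pow_succ]
    exact mul_le_mul ih (integral_val_le hG _ n)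
      ((inv_pos.2 hG.pos).le.trans (le_integral_val hG _ n)) (pow_pos hG.pos n).le

/-- The ratio of the two normalizing constants of a coupled model. -/
theorem Coupled.abs_ratio_le (F : Coupled U) {G : Potentials U} (hG : G.Bounded c) (n : ℕ) :
    |F.Z₁ G n / F.Z₂ G n| ≤ 1 + c ^ n * |F.Z₁ G n - F.Z₂ G n| := by
  have hZ : 0 < F.Z₂ G n := normConst_pos hG n
  have hZi : (F.Z₂ G n)⁻¹ ≤ c ^ n :=
    inv_le_of_inv_le₀ (pow_pos hG.pos n) (hG.inv_le_normConst n)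
  have h1 : F.Z₁ G n / F.Z₂ G n = 1 + (F.Z₂ G n)⁻¹ * (F.Z₁ G n - F.Z₂ G n) := by
    field_simp; ring
  rw [h1]
  refine (abs_add_le _ _).trans ?_
  rw [abs_one, abs_mul, abs_of_pos (inv_pos.2 hZ)]
  gcongr

variable (κ : ℕ → ℝ)

namespace Coupled

variable (F : Coupled U) (G : Potentials U) (N : ℕ) [NeZero N]

/-- The norm of the truncated distance of a pair of particles at time `p`. -/
def pairDist (p : ℕ) : ℝ :=
  Real.sqrt (∫ ω, (min (dist (ω p 0).1 (ω p 0).2) 1) ^ 2 ∂(F.law G N))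

theorem l2Le_pairDist (p : ℕ) :
    L2Le (F.law G N) (fun ω => min (dist (ω p 0).1 (ω p 0).2) 1) (F.pairDist G N p) := by
  have hm : Measurable fun ω : ℕ → Fin N → U × U => min (dist (ω p 0).1 (ω p 0).2) 1 := by fun_prop
  have h1 : L2Le (F.law G N) (fun ω => min (dist (ω p 0).1 (ω p 0).2) 1) 1 :=
    L2Le.of_abs_le hm zero_le_one fun ω => by
      rw [abs_of_nonneg (le_min dist_nonneg zero_le_one)]; exact min_le_right _ _
  refine L2Le.of_integral_sq_le hm (Real.sqrt_nonneg _) h1.integrable_sq ?_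
  rw [pairDist, Real.sq_sqrt (integral_nonneg fun _ => sq_nonneg _)]

theorem sqrt_B (n : ℕ) : Real.sqrt (F.B G N n) =
    ∑ p ∈ range (n + 1), (F.pairDist G N p + tvDist (F.η₁ G p) (F.η₂ G p)) +
      ∑ p ∈ range n, kernelDist (F.M₁ p) (F.M₂ p) := by
  refine Real.sqrt_sq (add_nonneg (sum_nonneg fun p _ => ?_) (sum_nonneg fun p _ => ?_))
  · exact add_nonneg (Real.sqrt_nonneg _) (tvDist_nonneg _ _)
  · exact kernelDist_nonneg _ _

theorem Bbar_nonneg (hκ : ∀ k, 0 < κ k) (n : ℕ) : 0 ≤ F.Bbar G κ N n := by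
  have hB : ∀ n, 0 ≤ F.B G N n := fun n => sq_nonneg _
  induction n with
  | zero => exact mul_nonneg (hκ 0).le (hB 0)
  | succ n ih =>
    rw [Bbar]
    have := hB n
    have := hκ (n + 1)
    positivity

theorem discrepancy_le_sqrt_B (n : ℕ) :
    discrepancy (F.pairDist G N) (fun p => 2 * tvDist (F.η₁ G p) (F.η₂ G p))
      (fun p => kernelDist (F.M₁ p) (F.M₂ p)) n ≤ 2 * Real.sqrt (F.B G N n) := by
  rw [sqrt_B, discrepancy, mul_add, mul_sum, mul_sum]
  refine add_le_add (sum_le_sum fun p _ => ?_) (sum_le_sum fun p _ => ?_)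
  · have : 0 ≤ F.pairDist G N p := Real.sqrt_nonneg _
    linarith
  · have := kernelDist_nonneg (F.M₁ p) (F.M₂ p)
    linarith

/-- The constants that compare the accumulated discrepancy with `B̄`. -/
def BbarConst (κ : ℕ → ℝ) : ℕ → ℝ
  | 0 => 0
  | n + 1 => (3 + BbarConst κ n) / Real.sqrt (κ (n + 1))

theorem BbarConst_nonneg (n : ℕ) : 0 ≤ BbarConst κ n := by
  induction n with
  | zero => exact le_rfl
  | succ n ih => rw [BbarConst]; positivity

/-- Both sides obey the same kind of recursion. The roots of B and of B̄ and the difference of the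
normalizing constants are each at most the root of the bracket that defines the next B̄. B enters
with factor 2, which explains the 3 in `BbarConst`. The recursion starts at 0 because the estimates
at time 0 are exact. -/
theorem normDiscrepancy_le (hκ : ∀ k, 0 < κ k) (n : ℕ) :
    normDiscrepancy (F.pairDist G N) (fun p => 2 * tvDist (F.η₁ G p) (F.η₂ G p))
      (fun p => kernelDist (F.M₁ p) (F.M₂ p)) (fun n => F.Z₁ G n - F.Z₂ G n) n ≤
        BbarConst κ n * Real.sqrt (F.Bbar G κ N n) := by
  induction n with
  | zero => simp [normDiscrepancy, BbarConst]
  | succ n ih =>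
    have hB : 0 ≤ F.B G N n := sq_nonneg _
    have hBb := F.Bbar_nonneg κ G N hκ n
    have hk := Real.sqrt_pos.2 (hκ (n + 1))
    have hc := BbarConst_nonneg κ n
    set R := F.B G N n + F.Bbar G κ N n + tvDist (F.η₁ G n) (F.η₂ G n) ^ 2 +
      (F.Z₁ G n - F.Z₂ G n) ^ 2 with hR
    have h1 := sq_nonneg (tvDist (F.η₁ G n) (F.η₂ G n))
    have h2 := sq_nonneg (F.Z₁ G n - F.Z₂ G n)
    have h3 : Real.sqrt (F.B G N n) ≤ Real.sqrt R := Real.sqrt_le_sqrt (by linarith)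
    have h4 : Real.sqrt (F.Bbar G κ N n) ≤ Real.sqrt R := Real.sqrt_le_sqrt (by linarith)
    have h5 : |F.Z₁ G n - F.Z₂ G n| ≤ Real.sqrt R := Real.abs_le_sqrt (by linarith)
    rw [normDiscrepancy, BbarConst, Bbar, Real.sqrt_mul (hκ (n + 1)).le]
    calc _ ≤ 2 * Real.sqrt R + BbarConst κ n * Real.sqrt R + Real.sqrt R := by
          have h6 := F.discrepancy_le_sqrt_B G N n
          have h7 := mul_le_mul_of_nonneg_left h4 hc
          linarith
      _ = _ := by field_simp; ring

end Coupled

namespace Model.Regular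

/-- The kernel distance is uniform in the starting point, so the constant weight is enough here. -/
theorem pairBounds (h : m.Regular c Λ) (l : ℕ) (N : ℕ) [NeZero N] :
    PairBounds (m.pair l) m.G N c Λ (fun _ => 1) 1 ((m.pair l).pairDist m.G N)
      (fun p => 2 * tvDist ((m.pair l).η₁ m.G p) ((m.pair l).η₂ m.G p))
      (fun p => kernelDist ((m.pair l).M₁ p) ((m.pair l).M₂ p)) where
  bdd := h.bdd
  lip_val := h.lip_val
  lip_step := h.lip_step l
  lip_nonneg := h.lip_nonneg
  weight := Weight.trivial
  dist_le := (m.pair l).l2Le_pairDist m.G N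
  predictor_le p φ b hφ := by
    have h1 : IsProbabilityMeasure ((m.pair l).η₁ m.G p) := isProbabilityMeasure_predictor h.bdd p
    have h2 : IsProbabilityMeasure ((m.pair l).η₂ m.G p) := isProbabilityMeasure_predictor h.bdd p
    exact abs_integral_sub_le_tvDist hφ.measurable hφ.nonneg hφ.le
  step_le p φ b hφ u := by
    rw [mul_one]; exact abs_integral_sub_le_kernelDist _ _ hφ u
  predictor_nonneg p := mul_nonneg zero_le_two (tvDist_nonneg _ _)
  step_nonneg p := kernelDist_nonneg _ _

theorem ratioConst_nonneg {F : Coupled U} {G : Potentials U} {N : ℕ} [NeZero N]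
    {V : U → ℝ} {a : ℝ} {D T Q : ℕ → ℝ} (h : PairBounds F G N c Λ V a D T Q) (n : ℕ) :
    0 ≤ ratioConst c a Λ n := by
  have hc := h.bdd.pos.le
  have h1 := h.normPairConst_nonneg n
  have h2 := Projects.normErrConst_nonneg hc n
  rw [ratioConst]; positivity

/-- The error of a factor of the multilevel estimator, for general levels. -/
theorem l2Le_ratio_sub (h : m.Regular c Λ) (hκ : ∀ k, 0 < κ k) (n : ℕ) (N : ℕ → ℕ+) (l : ℕ) :
    L2Le ((m.pair l).law m.G (N (l + 1)))
      (fun ω => normEst m.G n (N (l + 1)) (fun p i => (ω p i).1) /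
        normEst m.G n (N (l + 1)) (fun p i => (ω p i).2) -
          (m.pair l).Z₁ m.G n / (m.pair l).Z₂ m.G n)
      (ratioConst c 1 Λ n * (1 + Coupled.BbarConst κ n) *
        (m.levelError κ n N l / Real.sqrt (N (l + 1)))) := by
  refine ((h.pairBounds l (N (l + 1))).l2Le_ratio_sub n).weaken ?_
  have h1 := ratioConst_nonneg (h.pairBounds l (N (l + 1))) n
  have h2 := (m.pair l).normDiscrepancy_le κ m.G (N (l + 1)) hκ n
  have h3 := Coupled.BbarConst_nonneg κ n
  have h4 := Real.sqrt_nonneg ((m.pair l).Bbar m.G κ (N (l + 1)) n)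
  have h5 := abs_nonneg ((m.pair l).Z₁ m.G n - (m.pair l).Z₂ m.G n)
  rw [← mul_div_assoc, mul_assoc]
  gcongr
  rw [levelError]
  nlinarith [mul_nonneg h3 h5]

/-- The error of the multilevel estimator is controlled by the rate as soon as the errors of the
factors are summable. -/
theorem exists_mse_le (h : m.Regular c Λ) (hκ : ∀ k, 0 < κ k) (n : ℕ) (S : ℝ) :
    ∃ C : ℝ, ∀ (L : ℕ) (N : ℕ → ℕ+) (s : ℕ → ℝ),
      (∀ l, L2Le ((m.pair l).law m.G (N (l + 1)))
        (fun ω => normEst m.G n (N (l + 1)) (fun p i => (ω p i).1) /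
          normEst m.G n (N (l + 1)) (fun p i => (ω p i).2) -
            (m.pair l).Z₁ m.G n / (m.pair l).Z₂ m.G n) (s l)) →
      (∀ l, |(m.pair l).Z₁ m.G n / (m.pair l).Z₂ m.G n| ≤ 1 + s l) →
      ∑ l ∈ range L, s l ≤ S → m.mse n N L (m.target n L) ≤ C * m.rate κ n N L ^ 2 := by
  set K := ratioConst c 1 Λ n * (1 + Coupled.BbarConst κ n) with hK
  set E := Projects.normErrConst c n with hE
  have hE0 : 0 ≤ E := Projects.normErrConst_nonneg h.bdd.pos.le n
  have hcn := pow_pos h.bdd.pos n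
  have hK0 : 0 ≤ K := mul_nonneg (ratioConst_nonneg (h.pairBounds 0 1) n)
    (add_nonneg zero_le_one (Coupled.BbarConst_nonneg κ n))
  refine ⟨(Real.exp (2 * S) * (E + c ^ n * K)) ^ 2, fun L N s h1 h2 h3 => ?_⟩
  have hbase : L2Le (m.base.law m.G (N 0)) (fun ω => normEst m.G n (N 0) ω - m.base.Z m.G n)
      (E / Real.sqrt (N 0)) := (m.base.projects (G := m.G) (N := N 0)).l2Le_normEst_sub h.bdd n
  have hz : |m.base.Z m.G n| ≤ c ^ n := by
    rw [abs_of_pos (show 0 < m.base.Z m.G n from normConst_pos h.bdd n)]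
    exact h.bdd.normConst_le n
  have hlev : ∀ l, 0 ≤ m.levelError κ n N l := fun l =>
    add_nonneg (Real.sqrt_nonneg _) (abs_nonneg _)
  -- The bound `s` serves to control the products and need not be related to the rate; the level
  -- errors give the rate and need not be summable. The minimum of the two bounds is still an error
  -- bound and has both properties.
  have hmin : ∀ l, L2Le ((m.pair l).law m.G (N (l + 1)))
        (fun ω => normEst m.G n (N (l + 1)) (fun p i => (ω p i).1) /
          normEst m.G n (N (l + 1)) (fun p i => (ω p i).2) -
            (m.pair l).Z₁ m.G n / (m.pair l).Z₂ m.G n)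
        (min (K * (m.levelError κ n N l / Real.sqrt (N (l + 1)))) (s l)) := fun l => by
    rcases min_choice (K * (m.levelError κ n N l / Real.sqrt (N (l + 1)))) (s l) with h | h' <;>
      rw [‹min _ _ = _›]
    · exact Regular.l2Le_ratio_sub κ ‹m.Regular c Λ› hκ n N l
    · exact h1 l
  have hfin := m.l2Le_estimator_sub hbase hz hmin h2 (fun l => min_le_right _ _) h3
  refine (m.mse_le_of_l2Le hfin).trans ?_
  rw [← mul_pow]
  refine pow_le_pow_left₀ hfin.nonneg ?_ 2
  rw [mul_assoc]
  gcongr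
  set R := ∑ l ∈ range L, m.levelError κ n N l / Real.sqrt (N (l + 1)) with hR
  have hR0 : 0 ≤ R := sum_nonneg fun l _ => div_nonneg (hlev l) (Real.sqrt_nonneg _)
  have hsum : ∑ l ∈ range L, min (K * (m.levelError κ n N l / Real.sqrt (N (l + 1)))) (s l) ≤
      K * R := by
    rw [hR, mul_sum]
    exact sum_le_sum fun l _ => min_le_left _ _
  rw [rate, ← hR]
  have hr0 : 0 ≤ 1 / Real.sqrt (N 0) := by positivity
  calc _ ≤ E / Real.sqrt (N 0) + c ^ n * (K * R) := by gcongr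
    _ ≤ _ := by
      have : E / Real.sqrt (N 0) = E * (1 / Real.sqrt (N 0)) := by ring
      rw [this]
      nlinarith [mul_nonneg hE0 hR0, mul_nonneg (mul_nonneg hcn.le hK0) hr0]

end Model.Regular

theorem Model.AssumptionA.exists_mse_le {m : Model U} (hA : m.AssumptionA) {κ : ℕ → ℝ}
    (hκ : ∀ k, 0 < κ k) (n : ℕ) (S : ℝ) : ∃ C : ℝ, ∀ L : ℕ, ∀ N : ℕ → ℕ+,
      ∑ l ∈ range L, m.levelError κ n N l ≤ S →
        m.mse n N L (m.target n L) ≤ C * m.rate κ n N L ^ 2 := by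
  obtain ⟨c, Λ, h⟩ := hA.exists_regular
  have hcn := pow_pos h.bdd.pos n
  set K := ratioConst c 1 Λ n * (1 + Coupled.BbarConst κ n) with hK
  have hK0 : 0 ≤ K := mul_nonneg (Model.Regular.ratioConst_nonneg (h.pairBounds 0 1) n)
    (add_nonneg zero_le_one (Coupled.BbarConst_nonneg κ n))
  obtain ⟨C, hC⟩ := h.exists_mse_le κ hκ n ((K + c ^ n) * S)
  -- The part `K` covers the error of a factor, as √N ≥ 1, and the part `c ^ n` the distance of its
  -- limit from 1.
  refine ⟨C, fun L N hS => hC L N (fun l => (K + c ^ n) * m.levelError κ n N l) (fun l => ?_)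
    (fun l => ?_) ?_⟩
  · have hlev : 0 ≤ m.levelError κ n N l := add_nonneg (Real.sqrt_nonneg _) (abs_nonneg _)
    refine (h.l2Le_ratio_sub κ hκ n N l).weaken ?_
    have hN : 1 ≤ Real.sqrt (N (l + 1)) := Real.one_le_sqrt.2 (Nat.one_le_cast.2 (N (l + 1)).pos)
    exact mul_le_mul (by linarith) (div_le_self hlev hN) (by positivity) (by positivity)
  · refine ((m.pair l).abs_ratio_le h.bdd n).trans ?_
    have h1 := Real.sqrt_nonneg ((m.pair l).Bbar m.G κ (N (l + 1)) n)
    have h2 := abs_nonneg ((m.pair l).Z₁ m.G n - (m.pair l).Z₂ m.G n)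
    rw [Model.levelError]
    nlinarith [mul_nonneg hK0 h1, mul_nonneg hK0 h2, mul_nonneg hcn.le h1]
  · rw [← mul_sum]
    gcongr

end GeneralLevels

/-! ### Second moments and strong error of the Euler schemes -/

section KernelPowers

variable {α : Type*} [MeasurableSpace α]

theorem lintegral_kernel_pow_le (K : Kernel α α) {f : α → ℝ≥0∞} (hf : Measurable f) {r : ℝ≥0∞}
    (h : ∀ a, ∫⁻ y, f y ∂(K a) ≤ r * f a) (n : ℕ) (a : α) :
    ∫⁻ y, f y ∂((K ^ n) a) ≤ r ^ n * f a := by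
  induction n generalizing a with
  | zero =>
    rw [pow_zero, pow_zero, one_mul]
    change ∫⁻ y, f y ∂(Kernel.id a) ≤ _
    rw [Kernel.id_apply, lintegral_dirac' a hf]
  | succ n ih =>
    rw [pow_succ (M := Kernel α α)]
    change ∫⁻ y, f y ∂(((K ^ n) ∘ₖ K) a) ≤ _
    rw [Kernel.lintegral_comp _ _ _ hf]
    calc _ ≤ ∫⁻ b, r ^ n * f b ∂(K a) := lintegral_mono fun b => ih b
      _ = r ^ n * ∫⁻ b, f b ∂(K a) := lintegral_const_mul _ hf
      _ ≤ r ^ n * (r * f a) := by gcongr; exact h a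
      _ = _ := by rw [pow_succ, mul_assoc]

/-- A Lyapunov function for one step of length `h` yields a bound for `k` steps. -/
theorem lintegral_kernel_pow_le_exp (K : Kernel α α) {f : α → ℝ} (hf : Measurable f)
    (h0 : ∀ a, 0 ≤ f a) {C h : ℝ} (hC : 0 ≤ C) (hh : 0 ≤ h)
    (hK : ∀ a, ∫⁻ y, ENNReal.ofReal (f y) ∂(K a) ≤ ENNReal.ofReal ((1 + C * h) * f a)) (k : ℕ)
    (hk : k * h ≤ 1) (a : α) :
    ∫⁻ y, ENNReal.ofReal (f y) ∂((K ^ k) a) ≤ ENNReal.ofReal (Real.exp C * f a) := by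
  have hCh : 0 ≤ 1 + C * h := by positivity
  refine (lintegral_kernel_pow_le K hf.ennreal_ofReal (r := ENNReal.ofReal (1 + C * h))
    (fun a => ?_) k a).trans ?_
  · rw [← ENNReal.ofReal_mul hCh]; exact hK a
  · rw [← ENNReal.ofReal_pow hCh, ← ENNReal.ofReal_mul (pow_nonneg hCh k)]
    refine ENNReal.ofReal_le_ofReal (mul_le_mul_of_nonneg_right ?_ (h0 a))
    calc (1 + C * h) ^ k ≤ Real.exp (C * h) ^ k :=
          pow_le_pow_left₀ hCh (by linarith [Real.add_one_le_exp (C * h)]) k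
      _ = Real.exp (C * (k * h)) := by rw [← Real.exp_nat_mul]; congr 1; ring
      _ ≤ Real.exp C := Real.exp_le_exp.2 (mul_le_of_le_one_right hC hk)

end KernelPowers

section GaussianSteps

variable {d : ℕ}

/-- The second moment of the standard Gaussian law. -/
def gaussMoment (d : ℕ) : ℝ := ∫ ξ, ‖ξ‖ ^ 2 ∂(stdGaussian (Rd d))

theorem gaussMoment_nonneg (d : ℕ) : 0 ≤ gaussMoment d := integral_nonneg fun _ => sq_nonneg _

/-- The cross term is linear in the centred noise and integrates to zero, so noise of size √h adds
only a term of order h. -/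
theorem lintegral_gauss_le (u : Rd d) (B : Rd d →L[ℝ] Rd d) {h : ℝ} (hh : 0 ≤ h) :
    ∫⁻ ξ, ENNReal.ofReal (‖u + Real.sqrt h • B ξ‖ ^ 2) ∂(stdGaussian (Rd d)) ≤
      ENNReal.ofReal (‖u‖ ^ 2 + h * ‖B‖ ^ 2 * gaussMoment d) := by
  set L : StrongDual ℝ (Rd d) := (innerSL ℝ u).comp B with hL
  have hi2 : Integrable (fun ξ : Rd d => ‖ξ‖ ^ 2) (stdGaussian (Rd d)) :=
    (IsGaussian.memLp_two_id (μ := stdGaussian (Rd d))).integrable_norm_pow (by norm_num)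
  have hi1 : Integrable (fun ξ : Rd d => L ξ) (stdGaussian (Rd d)) :=
    L.integrable_comp IsGaussian.integrable_id
  have hle : ∀ ξ : Rd d, ‖u + Real.sqrt h • B ξ‖ ^ 2 ≤
      ‖u‖ ^ 2 + 2 * Real.sqrt h * L ξ + h * ‖B‖ ^ 2 * ‖ξ‖ ^ 2 := fun ξ => by
    rw [norm_add_sq_real, inner_smul_right, norm_smul, mul_pow, Real.norm_eq_abs, sq_abs,
      Real.sq_sqrt hh]
    have h1 := pow_le_pow_left₀ (norm_nonneg _) (B.le_opNorm ξ) 2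
    rw [mul_pow] at h1
    have h2 := mul_le_mul_of_nonneg_left h1 hh
    have h3 : L ξ = inner ℝ u (B ξ) := rfl
    rw [h3]
    linarith
  have hi12 : Integrable (fun ξ : Rd d => ‖u‖ ^ 2 + 2 * Real.sqrt h * L ξ) (stdGaussian (Rd d)) :=
    (integrable_const _).add (hi1.const_mul _)
  have hi123 : Integrable (fun ξ : Rd d => ‖u‖ ^ 2 + 2 * Real.sqrt h * L ξ +
      h * ‖B‖ ^ 2 * ‖ξ‖ ^ 2) (stdGaussian (Rd d)) := hi12.add (hi2.const_mul _)
  refine (lintegral_mono fun ξ => ENNReal.ofReal_le_ofReal (hle ξ)).trans ?_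
  rw [← ofReal_integral_eq_lintegral_ofReal hi123
    (.of_forall fun ξ => (sq_nonneg _).trans (hle ξ)),
    integral_add hi12 (hi2.const_mul _), integral_add (integrable_const _) (hi1.const_mul _),
    integral_const_mul, integral_const_mul, integral_strongDual_stdGaussian]
  simp [gaussMoment]

variable {s : ℕ}

namespace Diffusion

variable (D : Diffusion d s)

/-- `A` is a Lipschitz constant of the coefficients and a constant of their linear growth. -/
structure CoeffBound (A : ℝ) : Prop where
  nonneg : 0 ≤ A
  a_le : ∀ x, ‖D.a x‖ ≤ A * (1 + ‖x‖)
  b_le : ∀ x, ‖D.b x‖ ≤ A * (1 + ‖x‖)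
  a_lip : ∀ x y, ‖D.a x - D.a y‖ ≤ A * ‖x - y‖
  b_lip : ∀ x y, ‖D.b x - D.b y‖ ≤ A * ‖x - y‖

theorem exists_coeffBound : ∃ A, D.CoeffBound A := by
  obtain ⟨k, hk⟩ := D.lipschitz_a
  obtain ⟨k', hk'⟩ := D.lipschitz_b
  have hk0 : (0 : ℝ) ≤ k := k.2
  have hk0' : (0 : ℝ) ≤ k' := k'.2
  have ha := norm_nonneg (D.a 0)
  have hb := norm_nonneg (D.b 0)
  have hla : ∀ x y, ‖D.a x - D.a y‖ ≤ k * ‖x - y‖ := fun x y => by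
    simpa [dist_eq_norm] using hk.dist_le_mul x y
  have hlb : ∀ x y, ‖D.b x - D.b y‖ ≤ k' * ‖x - y‖ := fun x y => by
    simpa [dist_eq_norm] using hk'.dist_le_mul x y
  refine ⟨k + k' + ‖D.a 0‖ + ‖D.b 0‖, by positivity, fun x => ?_, fun x => ?_, fun x y => ?_,
    fun x y => ?_⟩
  · have h1 := hla x 0
    rw [sub_zero] at h1
    have h2 := norm_sub_norm_le (D.a x) (D.a 0)
    nlinarith [norm_nonneg x, mul_nonneg hk0' (norm_nonneg x), mul_nonneg ha (norm_nonneg x),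
      mul_nonneg hb (norm_nonneg x)]
  · have h1 := hlb x 0
    rw [sub_zero] at h1
    have h2 := norm_sub_norm_le (D.b x) (D.b 0)
    nlinarith [norm_nonneg x, mul_nonneg hk0 (norm_nonneg x), mul_nonneg ha (norm_nonneg x),
      mul_nonneg hb (norm_nonneg x)]
  · exact (hla x y).trans (mul_le_mul_of_nonneg_right (by linarith) (norm_nonneg _))
  · exact (hlb x y).trans (mul_le_mul_of_nonneg_right (by linarith) (norm_nonneg _))

variable {D} {A : ℝ}

theorem CoeffBound.sq_growth (hA : D.CoeffBound A) (x : Rd d) :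
    ‖D.a x‖ ^ 2 ≤ 2 * A ^ 2 * (1 + ‖x‖ ^ 2) ∧ ‖D.b x‖ ^ 2 ≤ 2 * A ^ 2 * (1 + ‖x‖ ^ 2) := by
  have h1 : (A * (1 + ‖x‖)) ^ 2 ≤ 2 * A ^ 2 * (1 + ‖x‖ ^ 2) := by
    nlinarith [mul_nonneg (sq_nonneg A) (sq_nonneg (1 - ‖x‖))]
  exact ⟨(pow_le_pow_left₀ (norm_nonneg _) (hA.a_le x) 2).trans h1,
    (pow_le_pow_left₀ (norm_nonneg _) (hA.b_le x) 2).trans h1⟩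

theorem measurable_eulerMap (D : Diffusion d s) (h : ℝ) (x : Rd d) :
    Measurable fun ξ => D.eulerMap h x ξ :=
  ((D.continuous_eulerMap h).comp (Continuous.prodMk continuous_const continuous_id)).measurable

/-- The constant of the growth of the second moment in one Euler step. -/
def growthConst (A : ℝ) (d : ℕ) : ℝ := 4 * A + 2 * A ^ 2 + 2 * A ^ 2 * gaussMoment d

theorem lintegral_eulerMap_le (hA : D.CoeffBound A) {h : ℝ} (hh : 0 ≤ h) (h1 : h ≤ 1) (x : Rd d) :
    ∫⁻ ξ, ENNReal.ofReal (1 + ‖D.eulerMap h x ξ‖ ^ 2) ∂(stdGaussian (Rd d)) ≤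
      ENNReal.ofReal ((1 + growthConst A d * h) * (1 + ‖x‖ ^ 2)) := by
  have hm := gaussMoment_nonneg d
  have hA0 := hA.nonneg
  obtain ⟨ha, hb⟩ := hA.sq_growth x
  have hx : ‖x + h • D.a x‖ ^ 2 ≤ ‖x‖ ^ 2 + (4 * A + 2 * A ^ 2) * h * (1 + ‖x‖ ^ 2) := by
    have h2 : ‖x + h • D.a x‖ ≤ ‖x‖ + h * ‖D.a x‖ := by
      refine (norm_add_le _ _).trans (le_of_eq ?_)
      rw [norm_smul, Real.norm_of_nonneg hh]
    have h3 := pow_le_pow_left₀ (norm_nonneg _) h2 2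
    have h4 : ‖x‖ * ‖D.a x‖ ≤ A * (2 * (1 + ‖x‖ ^ 2)) := by
      calc _ ≤ ‖x‖ * (A * (1 + ‖x‖)) := mul_le_mul_of_nonneg_left (hA.a_le x) (norm_nonneg _)
        _ = A * (‖x‖ * (1 + ‖x‖)) := by ring
        _ ≤ _ := mul_le_mul_of_nonneg_left (by nlinarith [sq_nonneg (1 - ‖x‖)]) hA0
    have h5 : h ^ 2 * ‖D.a x‖ ^ 2 ≤ h * (2 * A ^ 2 * (1 + ‖x‖ ^ 2)) := by
      have : h ^ 2 ≤ h := by nlinarith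
      gcongr
    nlinarith [mul_le_mul_of_nonneg_left h4 hh]
  have h2 := lintegral_gauss_le (x + h • D.a x) (D.b x) hh
  have h3 : ∀ ξ, ENNReal.ofReal (1 + ‖D.eulerMap h x ξ‖ ^ 2) =
      1 + ENNReal.ofReal (‖x + h • D.a x + Real.sqrt h • D.b x ξ‖ ^ 2) := fun ξ => by
    rw [ENNReal.ofReal_add zero_le_one (sq_nonneg _), ENNReal.ofReal_one]; rfl
  simp_rw [h3]
  rw [lintegral_add_left measurable_const, lintegral_const, measure_univ, mul_one,
    ← ENNReal.ofReal_one]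
  refine (add_le_add_right h2 _).trans ?_
  rw [← ENNReal.ofReal_add zero_le_one (by positivity)]
  refine ENNReal.ofReal_le_ofReal ?_
  rw [growthConst]
  have := mul_le_mul_of_nonneg_left hb (mul_nonneg hh hm)
  nlinarith

/-- One step moves a point by O(√h) in L². In the coupled step this is the error made by freezing
the coarse coefficients over two fine steps. -/
theorem lintegral_eulerMap_sub_le (hA : D.CoeffBound A) {h : ℝ} (hh : 0 ≤ h) (h1 : h ≤ 1)
    (x : Rd d) : ∫⁻ ξ, ENNReal.ofReal (‖D.eulerMap h x ξ - x‖ ^ 2) ∂(stdGaussian (Rd d)) ≤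
      ENNReal.ofReal (2 * A ^ 2 * (1 + gaussMoment d) * h * (1 + ‖x‖ ^ 2)) := by
  have hm := gaussMoment_nonneg d
  obtain ⟨ha, hb⟩ := hA.sq_growth x
  have h2 : ∀ ξ, D.eulerMap h x ξ - x = h • D.a x + Real.sqrt h • D.b x ξ := fun ξ => by
    rw [eulerMap]; abel
  simp_rw [h2]
  refine (lintegral_gauss_le _ _ hh).trans (ENNReal.ofReal_le_ofReal ?_)
  rw [norm_smul, Real.norm_of_nonneg hh, mul_pow]
  have h3 : h ^ 2 * ‖D.a x‖ ^ 2 ≤ h * (2 * A ^ 2 * (1 + ‖x‖ ^ 2)) := by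
    have : h ^ 2 ≤ h := by nlinarith
    gcongr
  have := mul_le_mul_of_nonneg_left hb (mul_nonneg hh hm)
  nlinarith

/-- The Lyapunov function of the coupled Euler schemes. -/
def lyapunov (h : ℝ) (v : Rd d × Rd d) : ℝ := ‖v.1 - v.2‖ ^ 2 + h * (1 + ‖v.1‖ ^ 2)

/-- Only the second fine noise is integrated. The part `p` that is linear in the first noise is left
intact: its own cross term vanishes later, when the first noise is integrated, and estimating it now
would cost an order √h. -/
theorem lintegral_pairMap_snd_le (hA : D.CoeffBound A) {h : ℝ} (hh : 0 ≤ h) (h1 : h ≤ 1)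
    (v : Rd d × Rd d) (ξ : Rd d) :
    ∫⁻ ζ, ENNReal.ofReal (‖(D.pairMap h v (ξ, ζ)).1 - (D.pairMap h v (ξ, ζ)).2‖ ^ 2)
      ∂(stdGaussian (Rd d)) ≤
      ENNReal.ofReal ((1 + h) * ‖v.1 - v.2 + Real.sqrt h • (D.b v.1 - D.b v.2) ξ‖ ^ 2 +
        (16 * A ^ 2 + 2 * A ^ 2 * gaussMoment d) * h * ‖v.1 - v.2‖ ^ 2 +
        (4 * A ^ 2 + 2 * A ^ 2 * gaussMoment d) * h * ‖D.eulerMap h v.1 ξ - v.1‖ ^ 2) := by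
  have hm := gaussMoment_nonneg d
  have hA0 := hA.nonneg
  set x' := D.eulerMap h v.1 ξ with hx'
  set p := v.1 - v.2 + Real.sqrt h • (D.b v.1 - D.b v.2) ξ with hp
  set q := (D.a v.1 - D.a v.2) + (D.a x' - D.a v.2) with hq
  have h2 : ∀ ζ, (D.pairMap h v (ξ, ζ)).1 - (D.pairMap h v (ξ, ζ)).2 =
      (p + h • q) + Real.sqrt h • (D.b x' - D.b v.2) ζ := fun ζ => by
    have h3 : (D.pairMap h v (ξ, ζ)).1 = x' + h • D.a x' + Real.sqrt h • D.b x' ζ := rfl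
    have h4 : (D.pairMap h v (ξ, ζ)).2 =
        v.2 + (2 * h) • D.a v.2 + Real.sqrt h • D.b v.2 (ξ + ζ) := rfl
    have h5 : x' = v.1 + h • D.a v.1 + Real.sqrt h • D.b v.1 ξ := rfl
    rw [h3, h4, hp, hq]
    simp only [sub_apply, map_add]
    nth_rewrite 1 [h5]
    module
  simp_rw [h2]
  refine (lintegral_gauss_le _ _ hh).trans (ENNReal.ofReal_le_ofReal ?_)
  have hxv : ‖x' - v.2‖ ≤ ‖x' - v.1‖ + ‖v.1 - v.2‖ := norm_sub_le_norm_sub_add_norm_sub _ _ _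
  have hqn : ‖q‖ ≤ A * (2 * ‖v.1 - v.2‖ + ‖x' - v.1‖) := by
    refine (norm_add_le _ _).trans ?_
    have h3 := hA.a_lip v.1 v.2
    have h4 := (hA.a_lip x' v.2).trans (mul_le_mul_of_nonneg_left hxv hA0)
    linarith
  have hbn : ‖D.b x' - D.b v.2‖ ^ 2 ≤ A ^ 2 * (2 * ‖x' - v.1‖ ^ 2 + 2 * ‖v.1 - v.2‖ ^ 2) := by
    refine (pow_le_pow_left₀ (norm_nonneg _) ((hA.b_lip x' v.2).trans
      (mul_le_mul_of_nonneg_left hxv hA0)) 2).trans ?_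
    nlinarith [mul_nonneg (sq_nonneg A) (sq_nonneg (‖x' - v.1‖ - ‖v.1 - v.2‖))]
  have hq2 : ‖q‖ ^ 2 ≤ A ^ 2 * (8 * ‖v.1 - v.2‖ ^ 2 + 2 * ‖x' - v.1‖ ^ 2) := by
    refine (pow_le_pow_left₀ (norm_nonneg _) hqn 2).trans ?_
    nlinarith [mul_nonneg (sq_nonneg A) (sq_nonneg (2 * ‖v.1 - v.2‖ - ‖x' - v.1‖))]
  -- Young's inequality 2h‖p‖‖q‖ ≤ h‖p‖² + h‖q‖², together with h² ≤ h.
  have hpq : ‖p + h • q‖ ^ 2 ≤ (1 + h) * ‖p‖ ^ 2 + 2 * h * ‖q‖ ^ 2 := by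
    have h3 : ‖p + h • q‖ ≤ ‖p‖ + h * ‖q‖ := by
      refine (norm_add_le _ _).trans (le_of_eq ?_)
      rw [norm_smul, Real.norm_of_nonneg hh]
    refine (pow_le_pow_left₀ (norm_nonneg _) h3 2).trans ?_
    have h4 : h ^ 2 * ‖q‖ ^ 2 ≤ h * ‖q‖ ^ 2 :=
      mul_le_mul_of_nonneg_right (by nlinarith) (sq_nonneg _)
    nlinarith [mul_nonneg hh (sq_nonneg (‖p‖ - ‖q‖))]
  have e1 := mul_le_mul_of_nonneg_left hq2 (mul_nonneg zero_le_two hh)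
  have e2 := mul_le_mul_of_nonneg_left hbn (mul_nonneg hh hm)
  linarith

/-- The constant of the growth of the Lyapunov function in one coupled step. -/
def pairGrowthConst (A : ℝ) (d : ℕ) : ℝ :=
  1 + 2 * A ^ 2 * gaussMoment d + 16 * A ^ 2 + 2 * A ^ 2 * gaussMoment d +
    (4 * A ^ 2 + 2 * A ^ 2 * gaussMoment d) * (2 * A ^ 2 * (1 + gaussMoment d)) +
    2 * growthConst A d + growthConst A d ^ 2

theorem lyapunov_nonneg {h : ℝ} (hh : 0 ≤ h) (v : Rd d × Rd d) : 0 ≤ lyapunov h v := by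
  unfold lyapunov; positivity

theorem measurable_lyapunov (h : ℝ) : Measurable (lyapunov (d := d) h) := by
  unfold lyapunov; fun_prop

/-- The squared distance grows by a factor 1 + O(h) and receives a source h‖x' − x‖², whose mean is
O(h)·h(1 + ‖x‖²). The second summand of `lyapunov` absorbs exactly this source, so the bound is
purely multiplicative and iterates without an additive term. -/
theorem lintegral_pairKernel_le (hA : D.CoeffBound A) {h : ℝ} (hh : 0 ≤ h) (h1 : h ≤ 1)
    (v : Rd d × Rd d) : ∫⁻ w, ENNReal.ofReal (lyapunov h w) ∂(D.pairKernel h v) ≤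
      ENNReal.ofReal ((1 + pairGrowthConst A d * h) * lyapunov h v) := by
  have hm := gaussMoment_nonneg d
  have hA0 := hA.nonneg
  have hp' : Measurable fun ξ => D.pairMap h v ξ :=
    ((D.continuous_pairMap h).comp (Continuous.prodMk continuous_const continuous_id)).measurable
  have hl := (measurable_lyapunov (d := d) h).ennreal_ofReal
  have hE := D.measurable_eulerMap h v.1
  set m := gaussMoment d with hm_def
  set g := growthConst A d with hg
  have hg0 : 0 ≤ g := by rw [hg, growthConst]; positivity
  set c₁ := 16 * A ^ 2 + 2 * A ^ 2 * m with hc₁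
  set c₂ := 4 * A ^ 2 + 2 * A ^ 2 * m with hc₂
  have hc₁0 : 0 ≤ c₁ := by positivity
  have hc₂0 : 0 ≤ c₂ := by positivity
  set δ := ‖v.1 - v.2‖ ^ 2 with hδ
  set W := 1 + ‖v.1‖ ^ 2 with hW
  have hδ0 : 0 ≤ δ := sq_nonneg _
  have hW0 : 0 ≤ W := by positivity
  rw [D.pairKernel_apply, lintegral_map hl hp', lintegral_prod
    (fun a => ENNReal.ofReal (lyapunov h (D.pairMap h v a))) (hl.comp hp').aemeasurable]
  have hin : ∀ ξ, ∫⁻ ζ, ENNReal.ofReal (lyapunov h (D.pairMap h v (ξ, ζ))) ∂(stdGaussian (Rd d)) ≤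
      ENNReal.ofReal (1 + h) *
        ENNReal.ofReal (‖v.1 - v.2 + Real.sqrt h • (D.b v.1 - D.b v.2) ξ‖ ^ 2) +
      (ENNReal.ofReal (c₁ * h * δ) +
      (ENNReal.ofReal (c₂ * h) * ENNReal.ofReal (‖D.eulerMap h v.1 ξ - v.1‖ ^ 2) +
      ENNReal.ofReal (h * (1 + g * h)) * ENNReal.ofReal (1 + ‖D.eulerMap h v.1 ξ‖ ^ 2))) := by
    intro ξ
    have hm1 : Measurable fun ζ => ENNReal.ofReal
        (‖(D.pairMap h v (ξ, ζ)).1 - (D.pairMap h v (ξ, ζ)).2‖ ^ 2) := by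
      have := hp'.comp (measurable_prodMk_left (x := ξ))
      exact ((this.fst.sub this.snd).norm.pow_const 2).ennreal_ofReal
    have hm2 : Measurable fun ζ => ENNReal.ofReal (1 + ‖D.eulerMap h (D.eulerMap h v.1 ξ) ζ‖ ^ 2) :=
      (((D.measurable_eulerMap h _).norm.pow_const 2).const_add 1).ennreal_ofReal
    have h2 : ∀ ζ, ENNReal.ofReal (lyapunov h (D.pairMap h v (ξ, ζ))) =
        ENNReal.ofReal (‖(D.pairMap h v (ξ, ζ)).1 - (D.pairMap h v (ξ, ζ)).2‖ ^ 2) +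
        ENNReal.ofReal h * ENNReal.ofReal (1 + ‖D.eulerMap h (D.eulerMap h v.1 ξ) ζ‖ ^ 2) := by
      intro ζ
      rw [← ENNReal.ofReal_mul hh, ← ENNReal.ofReal_add (sq_nonneg _) (by positivity)]
      rfl
    simp_rw [h2]
    rw [lintegral_add_left hm1, lintegral_const_mul _ hm2]
    refine (add_le_add (lintegral_pairMap_snd_le hA hh h1 v ξ)
      (mul_le_mul_right (lintegral_eulerMap_le hA hh h1 _) _)).trans (le_of_eq ?_)
    rw [← ENNReal.ofReal_mul hh, ← ENNReal.ofReal_mul (by positivity),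
      ← ENNReal.ofReal_mul (by positivity), ← ENNReal.ofReal_mul (by positivity),
      ← ENNReal.ofReal_add (by positivity) (by positivity),
      ← ENNReal.ofReal_add (by positivity) (by positivity),
      ← ENNReal.ofReal_add (by positivity) (by positivity),
      ← ENNReal.ofReal_add (by positivity) (by positivity)]
    congr 1
    ring
  refine (lintegral_mono hin).trans ?_
  have hmp : Measurable fun ξ : Rd d =>
      ENNReal.ofReal (‖v.1 - v.2 + Real.sqrt h • (D.b v.1 - D.b v.2) ξ‖ ^ 2) := by fun_prop
  have hme : Measurable fun ξ : Rd d => ENNReal.ofReal (‖D.eulerMap h v.1 ξ - v.1‖ ^ 2) :=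
    ((hE.sub_const _).norm.pow_const 2).ennreal_ofReal
  have hmw : Measurable fun ξ : Rd d => ENNReal.ofReal (1 + ‖D.eulerMap h v.1 ξ‖ ^ 2) :=
    ((hE.norm.pow_const 2).const_add 1).ennreal_ofReal
  rw [lintegral_add_left (hmp.const_mul _), lintegral_add_left measurable_const,
    lintegral_add_left (hme.const_mul _), lintegral_const_mul _ hmp, lintegral_const_mul _ hme,
    lintegral_const_mul _ hmw, lintegral_const, measure_univ, mul_one]
  have e1 := lintegral_gauss_le (v.1 - v.2) (D.b v.1 - D.b v.2) hh
  have e2 := lintegral_eulerMap_sub_le hA hh h1 v.1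
  have e3 := lintegral_eulerMap_le hA hh h1 v.1
  refine (add_le_add (mul_le_mul_right e1 _) (add_le_add le_rfl
    (add_le_add (mul_le_mul_right e2 _) (mul_le_mul_right e3 _)))).trans ?_
  rw [← ENNReal.ofReal_mul (by positivity), ← ENNReal.ofReal_mul (by positivity),
    ← ENNReal.ofReal_mul (by positivity), ← ENNReal.ofReal_add (by positivity) (by positivity),
    ← ENNReal.ofReal_add (by positivity) (by positivity),
    ← ENNReal.ofReal_add (by positivity) (by positivity)]
  refine ENNReal.ofReal_le_ofReal ?_
  have hb : ‖D.b v.1 - D.b v.2‖ ^ 2 ≤ A ^ 2 * δ := by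
    have := pow_le_pow_left₀ (norm_nonneg _) (hA.b_lip v.1 v.2) 2
    rwa [mul_pow] at this
  have f1 : (1 + h) * (δ + h * ‖D.b v.1 - D.b v.2‖ ^ 2 * m) ≤ δ + (1 + 2 * A ^ 2 * m) * h * δ := by
    have g1 : h * ‖D.b v.1 - D.b v.2‖ ^ 2 * m ≤ h * (A ^ 2 * δ) * m := by gcongr
    have g2 : 0 ≤ h * (A ^ 2 * δ) * m := by positivity
    nlinarith [mul_nonneg hh g2, mul_le_mul_of_nonneg_right h1 g2]
  have f2 : h * (1 + g * h) * ((1 + g * h) * W) ≤ h * W + (2 * g + g ^ 2) * h * (h * W) := by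
    have g1 : h ^ 2 ≤ h := by nlinarith
    have g2 := mul_le_mul_of_nonneg_right g1 (by positivity : 0 ≤ g ^ 2 * (h * W))
    linarith
  have f3 : (1 + pairGrowthConst A d * h) * lyapunov h v = δ + h * W +
      ((1 + 2 * A ^ 2 * m) + c₁ + c₂ * (2 * A ^ 2 * (1 + m)) + 2 * g + g ^ 2) * h * δ +
      ((1 + 2 * A ^ 2 * m) + c₁ + c₂ * (2 * A ^ 2 * (1 + m)) + 2 * g + g ^ 2) * h * (h * W) := by
    rw [pairGrowthConst, lyapunov]; ring
  rw [f3]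
  have p1 : 0 ≤ (c₂ * (2 * A ^ 2 * (1 + m)) + 2 * g + g ^ 2) * h * δ := by positivity
  have p2 : 0 ≤ ((1 + 2 * A ^ 2 * m) + c₁) * h * (h * W) := by positivity
  linarith

theorem growthConst_nonneg (hA : D.CoeffBound A) : 0 ≤ growthConst A d := by
  have := hA.nonneg
  have := gaussMoment_nonneg d
  unfold growthConst; positivity

theorem pairGrowthConst_nonneg (hA : D.CoeffBound A) : 0 ≤ pairGrowthConst A d := by
  have := hA.nonneg
  have := gaussMoment_nonneg d
  have := growthConst_nonneg hA
  unfold pairGrowthConst; positivity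

theorem h_pos (l : ℕ) : 0 < h l := by unfold h; positivity

theorem h_le_one (l : ℕ) : h l ≤ 1 := inv_le_one_of_one_le₀ (one_le_pow₀ one_le_two)

theorem pow_mul_h (l : ℕ) : (2 : ℝ) ^ l * h l = 1 := mul_inv_cancel₀ (by positivity)

/-- Stability of the second moments of the Euler schemes and strong error of the coupled schemes,
uniformly in the level. -/
structure EulerBound (D : Diffusion d s) (K : ℝ) : Prop where
  one_le : 1 ≤ K
  moment_le : ∀ l x, ∫⁻ y, ENNReal.ofReal (1 + ‖y‖ ^ 2) ∂(D.Q l x) ≤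
    ENNReal.ofReal (K * (1 + ‖x‖ ^ 2))
  pair_le : ∀ l v, ∫⁻ w, ENNReal.ofReal (lyapunov (h (l + 1)) w) ∂(D.coupledQ l v) ≤
    ENNReal.ofReal (K * lyapunov (h (l + 1)) v)

theorem exists_eulerBound (D : Diffusion d s) : ∃ K, D.EulerBound K := by
  obtain ⟨A, hA⟩ := D.exists_coeffBound
  have hg := growthConst_nonneg hA
  have hp := pairGrowthConst_nonneg hA
  -- A single constant for both bounds: each exponent is nonnegative, so their sum dominates both.
  refine ⟨Real.exp (growthConst A d + pairGrowthConst A d), Real.one_le_exp (by positivity),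
    fun l x => ?_, fun l v => ?_⟩
  · refine (lintegral_kernel_pow_le_exp (D.eulerKernel (h l)) (f := fun y => 1 + ‖y‖ ^ 2)
      (by fun_prop) (fun _ => by positivity) hg (h_pos l).le (fun x => ?_) (2 ^ l)
      (by push_cast; exact (pow_mul_h l).le) x).trans (ENNReal.ofReal_le_ofReal ?_)
    · rw [D.eulerKernel_apply, lintegral_map (by fun_prop) (D.measurable_eulerMap _ _)]
      exact lintegral_eulerMap_le hA (h_pos l).le (h_le_one l) x
    · exact mul_le_mul_of_nonneg_right (Real.exp_le_exp.2 (by linarith)) (by positivity)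
  · refine (lintegral_kernel_pow_le_exp (D.pairKernel (h (l + 1))) (measurable_lyapunov _)
      (lyapunov_nonneg (h_pos _).le) hp (h_pos _).le
      (lintegral_pairKernel_le hA (h_pos _).le (h_le_one _)) (2 ^ l) ?_ v).trans
      (ENNReal.ofReal_le_ofReal ?_)
    -- A coupled step contains two fine steps, so `2 ^ l` of them with step `h (l + 1)` give a
    -- product of only 1/2, which is within the allowed 1.
    · have := pow_mul_h (l + 1)
      rw [pow_succ] at this
      push_cast
      nlinarith [mul_pos (pow_pos (zero_lt_two (α := ℝ)) l) (h_pos (l + 1))]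
    · exact mul_le_mul_of_nonneg_right (Real.exp_le_exp.2 (by linarith))
        (lyapunov_nonneg (h_pos _).le _)

end Diffusion

end GaussianSteps

/-! ### Couplings that stay close under coupled resampling -/

section WeightDifference

variable {N : ℕ} [NeZero N]

/-- A difference of normalized weights is (g₁ − g₂)/∑g₁ plus w₂ times (∑g₂ − ∑g₁)/∑g₁. After
summation both parts are at most ∑|g₁ − g₂|/∑g₁. -/
theorem one_sub_sum_min_weight_le {g₁ g₂ : Fin N → ℝ} (h₁ : ∀ i, 0 < g₁ i) (h₂ : ∀ i, 0 < g₂ i) :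
    1 - ∑ i, min (weight g₁ i) (weight g₂ i) ≤ 2 * (∑ i, |g₁ i - g₂ i|) / ∑ i, g₁ i := by
  have p₁ : 0 < ∑ i, g₁ i := sum_pos (fun i _ => h₁ i) univ_nonempty
  have p₂ : 0 < ∑ i, g₂ i := sum_pos (fun i _ => h₂ i) univ_nonempty
  have hs : |∑ i, g₁ i - ∑ i, g₂ i| ≤ ∑ i, |g₁ i - g₂ i| := by
    rw [← sum_sub_distrib]; exact abs_sum_le_sum_abs _ _
  have h : ∀ i, weight g₁ i - min (weight g₁ i) (weight g₂ i) ≤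
      |g₁ i - g₂ i| / (∑ j, g₁ j) +
        g₂ i / (∑ j, g₂ j) * (|∑ j, g₁ j - ∑ j, g₂ j| / ∑ j, g₁ j) := by
    intro i
    have e : weight g₁ i - weight g₂ i = (g₁ i - g₂ i) / (∑ j, g₁ j) +
        g₂ i / (∑ j, g₂ j) * (-(∑ j, g₁ j - ∑ j, g₂ j) / ∑ j, g₁ j) := by
      unfold weight; field_simp; ring
    have hn : 0 ≤ g₂ i / ∑ j, g₂ j := div_nonneg (h₂ i).le p₂.le
    rcases min_cases (weight g₁ i) (weight g₂ i) with ⟨hm, _⟩ | ⟨hm, _⟩ <;> rw [hm]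
    · rw [sub_self]; positivity
    · rw [e]
      gcongr
      · exact le_abs_self _
      · exact neg_le_abs _
  calc _ = ∑ i, (weight g₁ i - min (weight g₁ i) (weight g₂ i)) := by
        rw [sum_sub_distrib, sum_weight h₁]
    _ ≤ ∑ i, (|g₁ i - g₂ i| / (∑ j, g₁ j) +
        g₂ i / (∑ j, g₂ j) * (|∑ j, g₁ j - ∑ j, g₂ j| / ∑ j, g₁ j)) := sum_le_sum fun i _ => h i
    _ = ((∑ i, |g₁ i - g₂ i|) + |∑ j, g₁ j - ∑ j, g₂ j|) / ∑ j, g₁ j := by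
        rw [sum_add_distrib, ← sum_mul, ← sum_div, ← sum_div, div_self p₂.ne', one_mul, add_div]
    _ ≤ _ := by gcongr; linarith

end WeightDifference

section CloseCouplings

variable {U : Type*} [MetricSpace U] [SecondCountableTopology U] [MeasurableSpace U] [BorelSpace U]

/-- The truncated distance of the two coordinates of a pair. -/
def truncDist (v : U × U) : ℝ := min (dist v.1 v.2) 1

theorem truncDist_nonneg (v : U × U) : 0 ≤ truncDist v := le_min dist_nonneg zero_le_one

theorem truncDist_le_one (v : U × U) : truncDist v ≤ 1 := min_le_right _ _

theorem measurable_truncDist : Measurable (truncDist (U := U)) := by unfold truncDist; fun_prop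

theorem BoundedLip.abs_integral_map_sub_le {P : Measure (U × U)} [IsProbabilityMeasure P] {r : ℝ}
    (hr : 0 ≤ r) (hP : ∫⁻ v, ENNReal.ofReal (truncDist v) ∂P ≤ ENNReal.ofReal r) {φ : U → ℝ}
    {b : ℝ} (hφ : BoundedLip φ b) :
    |∫ u, φ u ∂(P.map Prod.fst) - ∫ u, φ u ∂(P.map Prod.snd)| ≤ 2 * b * r := by
  have hm := hφ.measurable
  have hb := hφ.nonneg
  have hi : ∀ π : U × U → U, Measurable π → Integrable (fun v => φ (π v)) P := fun π hπ =>
    (L2Le.of_abs_le (hm.comp hπ) hb fun v => hφ.le _).integrable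
  have ht : Integrable (truncDist (U := U)) P :=
    (L2Le.of_abs_le measurable_truncDist zero_le_one fun v => by
      rw [abs_of_nonneg (truncDist_nonneg v)]; exact truncDist_le_one v).integrable
  rw [← ofReal_integral_eq_lintegral_ofReal ht (.of_forall truncDist_nonneg),
    ENNReal.ofReal_le_ofReal_iff hr] at hP
  rw [integral_map measurable_fst.aemeasurable hm.aestronglyMeasurable,
    integral_map measurable_snd.aemeasurable hm.aestronglyMeasurable,
    ← integral_sub (hi _ measurable_fst) (hi _ measurable_snd)]
  calc _ ≤ ∫ v, |φ v.1 - φ v.2| ∂P := abs_integral_le_integral_abs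
    _ ≤ ∫ v, 2 * b * truncDist v ∂P :=
        integral_mono ((hi _ measurable_fst).sub (hi _ measurable_snd)).abs (ht.const_mul _)
          fun v => hφ.abs_sub_le v.1 v.2
    _ ≤ _ := by rw [integral_const_mul]; gcongr

/-- The pairs of a coupled model stay at distance of order `q`. -/
structure CloseCoupling (F : Coupled U) (G : Potentials U) (c : ℝ) (Λ : ℕ → ℝ) (V : U → ℝ)
    (a K q : ℝ) : Prop where
  bdd : G.Bounded c
  lip_val : ∀ p u v, |G.val p u - G.val p v| ≤ c * dist u v
  lip_step : ∀ p φ b, BoundedLip φ b → ∀ u v,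
    |∫ y, φ y ∂(F.M₁ p u) - ∫ y, φ y ∂(F.M₁ p v)| ≤ Λ p * b * dist u v
  lip_nonneg : ∀ p, 0 ≤ Λ p
  weight_fst : Weight (F.init.map Prod.fst) F.M₁ V a
  weight_snd : Weight (F.init.map Prod.snd) F.M₂ V a
  nonneg : 0 ≤ K
  q_nonneg : 0 ≤ q
  q_le_one : q ≤ 1
  init_le : ∫⁻ v, ENNReal.ofReal (truncDist v) ∂F.init ≤ ENNReal.ofReal (K * q)
  step_le : ∀ p v, ∫⁻ w, ENNReal.ofReal (truncDist w) ∂(F.M p v) ≤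
    ENNReal.ofReal (K * (truncDist v + q * V v.1))

/-- The constants of the difference of the unnormalized measures of a close coupling. -/
def flowConst (c : ℝ) (Λ : ℕ → ℝ) (a K : ℝ) : ℕ → ℝ
  | 0 => 2 * K
  | p + 1 => flowConst c Λ a K p * (c * (Λ p + 1)) + c ^ p * (c * (2 * K) * moment c a p)

/-- The constants of the distance of the particles of a pair of a close coupling. -/
def distConst (c a K : ℝ) : ℕ → ℝ
  | 0 => K
  | p + 1 => c ^ 2 * ((K + 4) * distConst c a K p + K * moment c a p)

namespace CloseCoupling

variable {F : Coupled U} {G : Potentials U} {N : ℕ} [NeZero N] {c : ℝ} {Λ : ℕ → ℝ}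
  {V : U → ℝ} {a K q : ℝ}

/-- The coupled kernel is started on the diagonal at (u, u): its two marginals are the kernels to be
compared, and its truncated distance is at most K q V(u) in mean. -/
theorem abs_step_sub_le (h : CloseCoupling F G c Λ V a K q) (p : ℕ) {φ : U → ℝ} {b : ℝ}
    (hφ : BoundedLip φ b) (u : U) :
    |∫ y, φ y ∂(F.M₁ p u) - ∫ y, φ y ∂(F.M₂ p u)| ≤ b * (2 * K * q) * V u := by
  have hV := h.weight_fst.pos u
  have h1 := h.step_le p (u, u)
  have h2 : truncDist (u, u) = 0 := by simp [truncDist]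
  rw [h2, zero_add] at h1
  have hK := h.nonneg
  have hq := h.q_nonneg
  have h3 := hφ.abs_integral_map_sub_le (by positivity) h1
  rw [F.map_fst, F.map_snd] at h3
  exact h3.trans (le_of_eq (by ring))

theorem flowConst_nonneg (h : CloseCoupling F G c Λ V a K q) (p : ℕ) :
    0 ≤ flowConst c Λ a K p := by
  have hK := h.nonneg
  have hc := h.bdd.pos.le
  induction p with
  | zero => rw [flowConst]; positivity
  | succ p ih =>
    have h1 := h.weight_fst.moment_nonneg h.bdd p
    have h2 := h.lip_nonneg p
    rw [flowConst]; positivity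

/-- The unnormalized flow is linear, so one step splits in two: the two flows are compared on `G_p
M₁(φ)`, which is again bounded and Lipschitz, and the transitions are compared under the coarse
flow, where the weight `V` is integrable. -/
theorem abs_unnormalized_sub_le (h : CloseCoupling F G c Λ V a K q) (p : ℕ) :
    ∀ {φ : U → ℝ} {b : ℝ}, BoundedLip φ b →
      |∫ u, φ u ∂(unnormalized G (F.init.map Prod.fst) F.M₁ p) -
        ∫ u, φ u ∂(unnormalized G (F.init.map Prod.snd) F.M₂ p)| ≤
          b * (flowConst c Λ a K p * q) := by
  have hK := h.nonneg
  have hq := h.q_nonneg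
  have hc := h.bdd.pos.le
  induction p with
  | zero =>
    intro φ b hφ
    refine (hφ.abs_integral_map_sub_le (by positivity) h.init_le).trans (le_of_eq ?_)
    rw [flowConst]; ring
  | succ p ih =>
    intro φ b hφ
    have hb := hφ.nonneg
    have hΛ := h.lip_nonneg p
    have hm := hφ.measurable
    have i1 := isFiniteMeasure_unnormalized (μ := F.init.map Prod.fst) (M := F.M₁) h.bdd (p + 1)
    have i2 := isFiniteMeasure_unnormalized (μ := F.init.map Prod.snd) (M := F.M₂) h.bdd (p + 1)
    have i3 := isFiniteMeasure_unnormalized (μ := F.init.map Prod.snd) (M := F.M₂) h.bdd p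
    have hi : ∀ (ν : Measure U) [IsFiniteMeasure ν], Integrable φ ν := fun ν _ =>
      .of_bound hm.aestronglyMeasurable b (.of_forall hφ.le)
    rw [integral_unnormalized_succ p (hi _), integral_unnormalized_succ p (hi _)]
    have hM : ∀ u, |∫ y, φ y ∂(F.M₁ p u)| ≤ b := fun u => PairBounds.abs_integral_le hφ
    have hf : BoundedLip (fun u => G.val p u * ∫ y, φ y ∂(F.M₁ p u)) (c * (Λ p + 1) * b) := by
      refine ⟨by positivity, fun u => ?_, fun u v => ?_⟩
      · rw [abs_mul]
        calc _ ≤ c * b := mul_le_mul (h.bdd.abs_le p u) (hM u) (abs_nonneg _) hc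
          _ ≤ _ := by nlinarith [mul_nonneg (mul_nonneg hc hΛ) hb]
      · have e : ∀ g g' m m' : ℝ, g * m - g' * m' = g * (m - m') + m' * (g - g') := by
          intros; ring
        rw [e]
        refine (abs_add_le _ _).trans ?_
        rw [abs_mul, abs_mul]
        calc _ ≤ c * (Λ p * b * dist u v) + b * (c * dist u v) := by
              gcongr
              exacts [h.bdd.abs_le p u, h.lip_step p φ b hφ u v, hM v, h.lip_val p u v]
          _ = _ := by ring
    have hdm : Measurable fun u => G.val p u * (∫ y, φ y ∂(F.M₁ p u) - ∫ y, φ y ∂(F.M₂ p u)) :=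
      (G.measurable p).mul (hm.stronglyMeasurable.integral_kernel.measurable.sub
        hm.stronglyMeasurable.integral_kernel.measurable)
    have hd : WeightLe V (fun u => G.val p u * (∫ y, φ y ∂(F.M₁ p u) - ∫ y, φ y ∂(F.M₂ p u)))
        (c * (b * (2 * K * q))) := ⟨hdm, by positivity, fun u => by
      rw [abs_mul, mul_assoc]
      exact mul_le_mul (h.bdd.abs_le p u) (h.abs_step_sub_le p hφ u) (abs_nonneg _) hc⟩
    have hdi := (integrable_unnormalized_iff h.bdd p).1
      (h.weight_snd.integrable_predictor h.bdd hd p)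
    have hfi : Integrable (fun u => G.val p u * ∫ y, φ y ∂(F.M₁ p u))
        (unnormalized G (F.init.map Prod.snd) F.M₂ p) :=
      .of_bound hf.measurable.aestronglyMeasurable _ (.of_forall hf.le)
    have hsplit : ∫ u, G.val p u * ∫ y, φ y ∂(F.M₂ p u)
          ∂(unnormalized G (F.init.map Prod.snd) F.M₂ p) =
        ∫ u, G.val p u * ∫ y, φ y ∂(F.M₁ p u) ∂(unnormalized G (F.init.map Prod.snd) F.M₂ p) -
        ∫ u, G.val p u * (∫ y, φ y ∂(F.M₁ p u) - ∫ y, φ y ∂(F.M₂ p u))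
          ∂(unnormalized G (F.init.map Prod.snd) F.M₂ p) := by
      rw [← integral_sub hfi hdi]
      exact integral_congr_ae (.of_forall fun u => by ring)
    rw [hsplit, ← sub_add]
    refine (abs_add_le _ _).trans ((add_le_add (ih hf) (d := c ^ p *
      (c * (b * (2 * K * q)) * moment c a p)) ?_).trans (le_of_eq ?_))
    · rw [integral_unnormalized h.bdd, abs_mul,
        abs_of_pos (normConst_pos (μ := F.init.map Prod.snd) (M := F.M₂) h.bdd p)]
      exact mul_le_mul (h.bdd.normConst_le p) (h.weight_snd.abs_integral_predictor_le h.bdd hd p)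
        (abs_nonneg _) (pow_nonneg hc p)
    · rw [flowConst]; ring

theorem abs_Z_sub_le (h : CloseCoupling F G c Λ V a K q) (p : ℕ) :
    |F.Z₁ G p - F.Z₂ G p| ≤ flowConst c Λ a K p * q := by
  have h1 := h.abs_unnormalized_sub_le p (φ := fun _ => 1) (b := 1)
    ⟨zero_le_one, by simp, fun u v => by simp [dist_nonneg]⟩
  simpa [Coupled.Z₁, Coupled.Z₂, normConst] using h1

theorem abs_predictor_sub_le (h : CloseCoupling F G c Λ V a K q) (p : ℕ) {φ : U → ℝ} {b : ℝ}
    (hφ : BoundedLip φ b) :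
    |∫ u, φ u ∂(F.η₁ G p) - ∫ u, φ u ∂(F.η₂ G p)| ≤
      b * (2 * c ^ p * flowConst c Λ a K p * q) := by
  have hf := h.flowConst_nonneg p
  have hq := h.q_nonneg
  have hb := hφ.nonneg
  have hc := pow_pos h.bdd.pos p
  have hZ : 0 < F.Z₁ G p := normConst_pos h.bdd p
  have hZi : (F.Z₁ G p)⁻¹ ≤ c ^ p := inv_le_of_inv_le₀ hc (h.bdd.inv_le_normConst p)
  have i2 : IsProbabilityMeasure (F.η₂ G p) := isProbabilityMeasure_predictor h.bdd p
  have h1 := h.abs_unnormalized_sub_le p hφ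
  have e1 : ∫ u, φ u ∂(unnormalized G (F.init.map Prod.fst) F.M₁ p) =
      F.Z₁ G p * ∫ u, φ u ∂(F.η₁ G p) := integral_unnormalized h.bdd p φ
  have e2 : ∫ u, φ u ∂(unnormalized G (F.init.map Prod.snd) F.M₂ p) =
      F.Z₂ G p * ∫ u, φ u ∂(F.η₂ G p) := integral_unnormalized h.bdd p φ
  rw [e1, e2] at h1
  have h2 := PairBounds.abs_integral_le (ν := F.η₂ G p) hφ
  have h3 := h.abs_Z_sub_le p
  have e3 : ∫ u, φ u ∂(F.η₁ G p) - ∫ u, φ u ∂(F.η₂ G p) = (F.Z₁ G p)⁻¹ *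
      ((F.Z₁ G p * ∫ u, φ u ∂(F.η₁ G p) - F.Z₂ G p * ∫ u, φ u ∂(F.η₂ G p)) -
        (F.Z₁ G p - F.Z₂ G p) * ∫ u, φ u ∂(F.η₂ G p)) := by
    field_simp; ring
  rw [e3, abs_mul, abs_of_pos (inv_pos.2 hZ)]
  calc _ ≤ c ^ p * (b * (flowConst c Λ a K p * q) + flowConst c Λ a K p * q * b) := by
        gcongr
        refine (abs_sub _ _).trans (add_le_add h1 ?_)
        rw [abs_mul]
        gcongr
    _ = _ := by ring

/-- With a common ancestor the kernel keeps the pair close. The remaining mass of the coupling is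
itself at most of the order of the average truncated distance, and on it the distance is bounded by
1. -/
theorem lintegral_coupledMoveKernel_le (h : CloseCoupling F G c Λ V a K q) (p : ℕ)
    (x : Fin N → U × U) :
    ∫⁻ v, ENNReal.ofReal (truncDist v) ∂(coupledMoveKernel G p N (F.M p) x) ≤
      ∑ i, ENNReal.ofReal (c ^ 2 / N * ((K + 4) * truncDist (x i) + K * q * V (x i).1)) := by
  have hN : (0 : ℝ) < N := by exact_mod_cast Nat.pos_of_neZero N
  have hc := h.bdd.pos
  have hK := h.nonneg
  have hq := h.q_nonneg
  have ht := fun i => truncDist_nonneg (x i)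
  have hV := fun i => (h.weight_fst.pos (x i).1).le
  set w₁ := weight fun j => G.val p (x j).1 with hw₁
  set w₂ := weight fun j => G.val p (x j).2 with hw₂
  have n₁ : ∀ i, 0 ≤ w₁ i := weight_nonneg fun j => G.pos p (x j).1
  have n₂ : ∀ i, 0 ≤ w₂ i := weight_nonneg fun j => G.pos p (x j).2
  have s₁ : ∑ i, w₁ i = 1 := sum_weight fun j => G.pos p (x j).1
  have s₂ : ∑ i, w₂ i = 1 := sum_weight fun j => G.pos p (x j).2
  have hmn : ∀ i, 0 ≤ min (w₁ i) (w₂ i) := fun i => le_min (n₁ i) (n₂ i)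
  have hr : 0 ≤ 1 - ∑ i, min (w₁ i) (w₂ i) := by
    rw [sub_nonneg, ← s₁]; exact sum_le_sum fun i _ => min_le_left _ _
  set I : Fin N × Fin N → ℝ≥0∞ := fun k =>
    ∫⁻ v, ENNReal.ofReal (truncDist v) ∂(F.M p ((x k.1).1, (x k.2).2)) with hI
  have hI1 : ∀ k, I k ≤ 1 := fun k => by
    refine (lintegral_mono fun v => ENNReal.ofReal_le_ofReal (truncDist_le_one v)).trans ?_
    simp
  have hI2 : ∀ i, I (i, i) ≤ ENNReal.ofReal (K * (truncDist (x i) + q * V (x i).1)) := fun i =>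
    h.step_le p (x i)
  set d : Fin N × Fin N → ℝ := fun k => if k.1 = k.2 then min (w₁ k.1) (w₂ k.1) else 0 with hd
  have hd0 : ∀ k, 0 ≤ d k := fun k => by
    simp only [hd]; split_ifs
    exacts [hmn _, le_rfl]
  have hrest : ∀ k, 0 ≤ couplingProb w₁ w₂ k - d k := fun k => by
    rw [couplingProb, hd, add_sub_cancel_left]
    refine mul_nonneg hr (mul_nonneg (div_nonneg (sub_nonneg.2 (min_le_left _ _))
      (sum_nonneg fun i _ => sub_nonneg.2 (min_le_left _ _)))
      (div_nonneg (sub_nonneg.2 (min_le_right _ _))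
      (sum_nonneg fun i _ => sub_nonneg.2 (min_le_right _ _))))
  have hdsum : ∑ k, d k = ∑ i, min (w₁ i) (w₂ i) := by
    rw [Fintype.sum_prod_type]; simp [hd]
  have hsum : ∑ k, (couplingProb w₁ w₂ k - d k) = 1 - ∑ i, min (w₁ i) (w₂ i) := by
    rw [sum_sub_distrib, sum_couplingProb s₁ s₂, hdsum]
  -- The 4 is the 2 of the weight comparison times the 2 of `BoundedLip.abs_sub_le`; one `c` comes
  -- from the Lipschitz bound and one from the lower bound of the sum of potentials.
  have hrle : 1 - ∑ i, min (w₁ i) (w₂ i) ≤ ∑ i, c ^ 2 / N * (4 * truncDist (x i)) := by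
    refine (one_sub_sum_min_weight_le (fun j => G.pos p (x j).1) fun j => G.pos p (x j).2).trans ?_
    have hS : N * c⁻¹ ≤ ∑ j, G.val p (x j).1 := by
      have := Finset.card_nsmul_le_sum univ (fun j => G.val p (x j).1) c⁻¹
        fun j _ => h.bdd.lower p _
      simpa using this
    have hg : ∀ i, |G.val p (x i).1 - G.val p (x i).2| ≤ 2 * c * truncDist (x i) := fun i =>
      BoundedLip.abs_sub_le ⟨hc.le, h.bdd.abs_le p, h.lip_val p⟩ _ _
    calc _ ≤ 2 * (∑ i, 2 * c * truncDist (x i)) / (N * c⁻¹) := by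
          gcongr with i
          · exact mul_nonneg zero_le_two (sum_nonneg fun i _ => mul_nonneg (by positivity) (ht i))
          · exact hg i
      _ = _ := by rw [← mul_sum, ← mul_sum, ← mul_sum]; field_simp; ring
  rw [lintegral_coupledMoveKernel]
  calc _ = ∑ k, (ENNReal.ofReal (d k) * I k +
          ENNReal.ofReal (couplingProb w₁ w₂ k - d k) * I k) := by
        refine sum_congr rfl fun k _ => ?_
        rw [← add_mul, ← ENNReal.ofReal_add (hd0 k) (hrest k), add_sub_cancel]
    _ ≤ ∑ k, ENNReal.ofReal (d k) * I k + ∑ k, ENNReal.ofReal (couplingProb w₁ w₂ k - d k) := by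
        rw [sum_add_distrib]
        gcongr with k
        exact mul_le_of_le_one_right' (hI1 k)
    _ = ∑ i, ENNReal.ofReal (min (w₁ i) (w₂ i)) * I (i, i) +
          ENNReal.ofReal (1 - ∑ i, min (w₁ i) (w₂ i)) := by
        rw [← ENNReal.ofReal_sum_of_nonneg fun k _ => hrest k, hsum, Fintype.sum_prod_type]
        congr 1
        refine sum_congr rfl fun i _ => ?_
        rw [sum_eq_single i]
        · simp [hd]
        · intro j _ hj
          simp [hd, hj.symm]
        · simp
    _ ≤ ∑ i, ENNReal.ofReal (c ^ 2 / N * (K * (truncDist (x i) + q * V (x i).1))) +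
          ∑ i, ENNReal.ofReal (c ^ 2 / N * (4 * truncDist (x i))) := by
        refine add_le_add (sum_le_sum fun i _ => ?_) ?_
        · rw [ENNReal.ofReal_mul (by positivity)]
          refine mul_le_mul' (ENNReal.ofReal_le_ofReal ((min_le_left _ _).trans ?_)) (hI2 i)
          exact h.bdd.weight_le p (fun j => (x j).1) i
        · rw [← ENNReal.ofReal_sum_of_nonneg fun i _ =>
            mul_nonneg (by positivity) (mul_nonneg (by positivity) (ht i))]
          exact ENNReal.ofReal_le_ofReal hrle
    _ = _ := by
        rw [← sum_add_distrib]
        refine sum_congr rfl fun i _ => ?_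
        have := ht i
        have := hV i
        rw [← ENNReal.ofReal_add (by positivity) (by positivity)]
        congr 1
        ring

theorem distConst_nonneg (h : CloseCoupling F G c Λ V a K q) (p : ℕ) : 0 ≤ distConst c a K p := by
  have hK := h.nonneg
  induction p with
  | zero => exact hK
  | succ p ih =>
    have := h.weight_fst.moment_nonneg h.bdd p
    rw [distConst]; positivity

/-- The recursion closes in L¹: the probability of separating the ancestors is linear in the mean
distance. The sum over ancestors cancels 1/N since all pairs have the same law, and the mean of `V`
is bounded by its L² norm. -/
theorem lintegral_truncDist_le (h : CloseCoupling F G c Λ V a K q) (p : ℕ) (i : Fin N) :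
    ∫⁻ ω, ENNReal.ofReal (truncDist (ω p i)) ∂(F.law G N) ≤
      ENNReal.ofReal (distConst c a K p * q) := by
  have hN : (0 : ℝ) < N := by exact_mod_cast Nat.pos_of_neZero N
  have hc := h.bdd.pos
  have hK := h.nonneg
  have hq := h.q_nonneg
  have htm := (measurable_truncDist (U := U)).ennreal_ofReal
  rw [F.law_eq_systemLaw]
  induction p generalizing i with
  | zero =>
    rw [← lintegral_map (g := fun ω : ℕ → Fin N → U × U => ω 0 i) htm (by fun_prop),
      systemLaw_map_zero]
    exact h.init_le
  | succ p ih =>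
    rw [← lintegral_map (g := fun ω : ℕ → Fin N → U × U => ω (p + 1) i) htm (by fun_prop),
      systemLaw_map_succ, Measure.lintegral_bind (Kernel.aemeasurable _) htm.aemeasurable,
      lintegral_map htm.lintegral_kernel (by fun_prop)]
    have hd := h.distConst_nonneg p
    have hm := h.weight_fst.moment_nonneg h.bdd p
    have hVm := h.weight_fst.meas
    have hVi : ∀ i : Fin N, ∫⁻ ω, ENNReal.ofReal (V (ω p i).1)
        ∂(systemLaw F.init fun p => coupledMoveKernel G p N (F.M p)) ≤
          ENNReal.ofReal (moment c a p) := fun i => by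
      have h1 := (F.projects_fst (G := G) (N := N)).l2Le_weight h.bdd h.weight_fst p i
      rw [← ofReal_integral_eq_lintegral_ofReal h1.integrable
        (.of_forall fun ω => (h.weight_fst.pos _).le)]
      exact ENNReal.ofReal_le_ofReal ((le_abs_self _).trans h1.abs_integral_le)
    have hm1 : ∀ i, Measurable fun ω : ℕ → Fin N → U × U => ENNReal.ofReal (truncDist (ω p i)) :=
      fun i => htm.comp (g := fun v => ENNReal.ofReal (truncDist v)) (by fun_prop)
    have hm2 : ∀ i, Measurable fun ω : ℕ → Fin N → U × U => ENNReal.ofReal (V (ω p i).1) :=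
      fun i => (hVm.comp (by fun_prop)).ennreal_ofReal
    calc _ ≤ ∫⁻ ω, ∑ i, (ENNReal.ofReal (c ^ 2 / N * (K + 4)) * ENNReal.ofReal (truncDist (ω p i)) +
            ENNReal.ofReal (c ^ 2 / N * (K * q)) * ENNReal.ofReal (V (ω p i).1))
            ∂(systemLaw F.init fun p => coupledMoveKernel G p N (F.M p)) := by
          refine lintegral_mono fun ω => (h.lintegral_coupledMoveKernel_le p (ω p)).trans
            (sum_le_sum fun i _ => le_of_eq ?_)
          have h1 := truncDist_nonneg (ω p i)
          have h2 := (h.weight_fst.pos (ω p i).1).le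
          rw [← ENNReal.ofReal_mul (by positivity), ← ENNReal.ofReal_mul (by positivity),
            ← ENNReal.ofReal_add (by positivity) (by positivity)]
          congr 1
          ring
      _ ≤ ∑ i : Fin N, (ENNReal.ofReal (c ^ 2 / N * (K + 4)) *
            ENNReal.ofReal (distConst c a K p * q) +
            ENNReal.ofReal (c ^ 2 / N * (K * q)) * ENNReal.ofReal (moment c a p)) := by
          have hm3 : ∀ i, Measurable fun ω : ℕ → Fin N → U × U =>
              ENNReal.ofReal (c ^ 2 / N * (K + 4)) * ENNReal.ofReal (truncDist (ω p i)) +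
                ENNReal.ofReal (c ^ 2 / N * (K * q)) * ENNReal.ofReal (V (ω p i).1) := fun i =>
            ((hm1 i).const_mul _).add ((hm2 i).const_mul _)
          rw [lintegral_finsetSum _ fun i _ => hm3 i]
          refine sum_le_sum fun i _ => ?_
          rw [lintegral_add_left ((hm1 i).const_mul _), lintegral_const_mul _ (hm1 i),
            lintegral_const_mul _ (hm2 i)]
          gcongr
          exacts [ih i, hVi i]
      _ = _ := by
          rw [sum_const, card_univ, Fintype.card_fin, nsmul_eq_mul,
            ← ENNReal.ofReal_mul (by positivity), ← ENNReal.ofReal_mul (by positivity),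
            ← ENNReal.ofReal_add (by positivity) (by positivity), ← ENNReal.ofReal_natCast,
            ← ENNReal.ofReal_mul hN.le, distConst]
          congr 1
          field_simp

/-- The truncated distance is at most 1, so its square is at most itself. The square root of the L¹
bound is what reduces the order from q = h^{1/2} to h^{1/4}. -/
theorem l2Le_truncDist (h : CloseCoupling F G c Λ V a K q) (p : ℕ) :
    L2Le (F.law G N) (fun ω => min (dist (ω p 0).1 (ω p 0).2) 1)
      (Real.sqrt (distConst c a K p) * Real.sqrt q) := by
  refine ⟨by fun_prop, by positivity, ?_⟩
  rw [mul_pow, Real.sq_sqrt (h.distConst_nonneg p), Real.sq_sqrt h.q_nonneg]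
  refine (lintegral_mono fun ω => ENNReal.ofReal_le_ofReal ?_).trans
    (h.lintegral_truncDist_le (N := N) p 0)
  have h1 := truncDist_nonneg (ω p 0)
  have h2 := truncDist_le_one (ω p 0)
  change truncDist (ω p 0) ^ 2 ≤ truncDist (ω p 0)
  nlinarith

theorem q_le_sqrt (h : CloseCoupling F G c Λ V a K q) : q ≤ Real.sqrt q :=
  Real.le_sqrt_of_sq_le (by nlinarith [h.q_nonneg, h.q_le_one])

/-- The distance of the particles is of order √q, while predictors and transitions differ only by
order q ≤ √q on bounded Lipschitz functions, so √q governs everything. -/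
theorem pairBounds (h : CloseCoupling F G c Λ V a K q) :
    PairBounds F G N c Λ V a (fun p => Real.sqrt (distConst c a K p) * Real.sqrt q)
      (fun p => 2 * c ^ p * flowConst c Λ a K p * q) (fun _ => 2 * K * q) where
  bdd := h.bdd
  lip_val := h.lip_val
  lip_step := h.lip_step
  lip_nonneg := h.lip_nonneg
  weight := h.weight_snd
  dist_le := h.l2Le_truncDist
  predictor_le p _ _ hφ := h.abs_predictor_sub_le p hφ
  step_le p _ _ hφ u := h.abs_step_sub_le p hφ u
  predictor_nonneg p := by
    have := h.flowConst_nonneg p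
    have := h.bdd.pos
    have := h.q_nonneg
    positivity
  step_nonneg _ := by
    have := h.nonneg
    have := h.q_nonneg
    positivity

end CloseCoupling

theorem discrepancy_le_mul {D T Q D' T' Q' : ℕ → ℝ} {r : ℝ} (hD : ∀ p, D p ≤ D' p * r)
    (hT : ∀ p, T p ≤ T' p * r) (hQ : ∀ p, Q p ≤ Q' p * r) (n : ℕ) :
    discrepancy D T Q n ≤ discrepancy D' T' Q' n * r := by
  unfold discrepancy
  rw [add_mul, sum_mul, sum_mul]
  refine add_le_add (sum_le_sum fun p _ => ?_) (sum_le_sum fun p _ => hQ p)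
  rw [add_mul]
  exact add_le_add (hD p) (hT p)

theorem normDiscrepancy_le_mul {D T Q z D' T' Q' z' : ℕ → ℝ} {r : ℝ} (hD : ∀ p, D p ≤ D' p * r)
    (hT : ∀ p, T p ≤ T' p * r) (hQ : ∀ p, Q p ≤ Q' p * r) (hz : ∀ p, |z p| ≤ |z' p| * r) (n : ℕ) :
    normDiscrepancy D T Q z n ≤ normDiscrepancy D' T' Q' z' n * r := by
  induction n with
  | zero => simp [normDiscrepancy]
  | succ n ih =>
    rw [normDiscrepancy, normDiscrepancy, add_mul, add_mul]
    exact add_le_add (add_le_add (discrepancy_le_mul hD hT hQ n) ih) (hz n)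

/-- The constants of the error of a factor of the multilevel estimator, for close couplings. -/
def closeConst (c : ℝ) (Λ : ℕ → ℝ) (a K : ℝ) (n : ℕ) : ℝ :=
  |ratioConst c a Λ n| * (normDiscrepancy (fun p => Real.sqrt (distConst c a K p))
    (fun p => 2 * c ^ p * flowConst c Λ a K p) (fun _ => 2 * K) (flowConst c Λ a K) n +
      flowConst c Λ a K n) + c ^ n * flowConst c Λ a K n

namespace CloseCoupling

variable {F : Coupled U} {G : Potentials U} {N : ℕ} [NeZero N] {c : ℝ} {Λ : ℕ → ℝ}
  {V : U → ℝ} {a K q : ℝ}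

theorem abs_Z_sub_le_sqrt (h : CloseCoupling F G c Λ V a K q) (p : ℕ) :
    |F.Z₁ G p - F.Z₂ G p| ≤ flowConst c Λ a K p * Real.sqrt q :=
  (h.abs_Z_sub_le p).trans (mul_le_mul_of_nonneg_left h.q_le_sqrt (h.flowConst_nonneg p))

theorem normDiscrepancy_nonneg (h : CloseCoupling F G c Λ V a K q) (n : ℕ) :
    0 ≤ normDiscrepancy (fun p => Real.sqrt (distConst c a K p))
      (fun p => 2 * c ^ p * flowConst c Λ a K p) (fun _ => 2 * K) (flowConst c Λ a K) n := by
  have hK := h.nonneg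
  have hc := h.bdd.pos
  induction n with
  | zero => exact le_rfl
  | succ n ih =>
    rw [normDiscrepancy]
    refine add_nonneg (add_nonneg (add_nonneg (sum_nonneg fun p _ => ?_)
      (sum_nonneg fun p _ => ?_)) ih) (abs_nonneg _)
    · have := h.flowConst_nonneg p
      positivity
    · positivity

theorem closeConst_nonneg (h : CloseCoupling F G c Λ V a K q) (n : ℕ) :
    0 ≤ closeConst c Λ a K n := by
  have h1 := h.normDiscrepancy_nonneg n
  have h2 := h.flowConst_nonneg n
  have h3 := h.bdd.pos
  unfold closeConst; positivity

theorem l2Le_ratio_sub (h : CloseCoupling F G c Λ V a K q) (n : ℕ) :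
    L2Le (F.law G N) (fun ω => normEst G n N (fun p i => (ω p i).1) /
      normEst G n N (fun p i => (ω p i).2) - F.Z₁ G n / F.Z₂ G n)
      (closeConst c Λ a K n * Real.sqrt q / Real.sqrt N) := by
  refine (h.pairBounds.l2Le_ratio_sub n).weaken ?_
  have hq := h.q_nonneg
  have hK := h.nonneg
  have hc := h.bdd.pos
  have hs := Real.sqrt_nonneg q
  have h1 := normDiscrepancy_le_mul (r := Real.sqrt q)
    (D := fun p => Real.sqrt (distConst c a K p) * Real.sqrt q)
    (T := fun p => 2 * c ^ p * flowConst c Λ a K p * q) (Q := fun _ => 2 * K * q)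
    (z := fun n => F.Z₁ G n - F.Z₂ G n) (D' := fun p => Real.sqrt (distConst c a K p))
    (T' := fun p => 2 * c ^ p * flowConst c Λ a K p) (Q' := fun _ => 2 * K)
    (z' := flowConst c Λ a K) (fun p => le_rfl)
    (fun p => mul_le_mul_of_nonneg_left h.q_le_sqrt (by
      have := h.flowConst_nonneg p
      positivity))
    (fun p => mul_le_mul_of_nonneg_left h.q_le_sqrt (by positivity))
    (fun p => by
      rw [abs_of_nonneg (h.flowConst_nonneg p)]; exact h.abs_Z_sub_le_sqrt p) n
  have h2 := h.abs_Z_sub_le_sqrt n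
  have h3 := Model.Regular.ratioConst_nonneg (h.pairBounds (N := N)) n
  have h4 := h.flowConst_nonneg n
  refine div_le_div_of_nonneg_right ?_ (Real.sqrt_nonneg _)
  rw [closeConst, abs_of_nonneg h3]
  have h5 := mul_le_mul_of_nonneg_left (add_le_add h1 h2) h3
  have h6 : 0 ≤ c ^ n * flowConst c Λ a K n * Real.sqrt q := by positivity
  linarith

/-- The last summand of `closeConst` is there for this bound, so that one constant serves for the
error of a factor and for the distance of its limit from 1. -/
theorem abs_ratio_le (h : CloseCoupling F G c Λ V a K q) (n : ℕ) :
    |F.Z₁ G n / F.Z₂ G n| ≤ 1 + closeConst c Λ a K n * Real.sqrt q := by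
  refine (F.abs_ratio_le h.bdd n).trans ?_
  have hc := pow_pos h.bdd.pos n
  have h1 := mul_le_mul_of_nonneg_left (h.abs_Z_sub_le_sqrt n) hc.le
  have h2 := h.normDiscrepancy_nonneg n
  have h3 := h.flowConst_nonneg n
  have h4 : 0 ≤ |ratioConst c a Λ n| * (normDiscrepancy (fun p => Real.sqrt (distConst c a K p))
    (fun p => 2 * c ^ p * flowConst c Λ a K p) (fun _ => 2 * K) (flowConst c Λ a K) n +
      flowConst c Λ a K n) * Real.sqrt q := by positivity
  rw [closeConst]
  linarith

end CloseCoupling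

end CloseCouplings

/-! ### Decay of the errors over the Euler levels -/

/-- The twelfth root of `1 / 2`. -/
def rootHalf : ℝ := (1 / 2 : ℝ) ^ ((12 : ℕ) : ℝ)⁻¹

theorem rootHalf_pos : 0 < rootHalf := Real.rpow_pos_of_pos (by norm_num) _

theorem rootHalf_pow : rootHalf ^ 12 = 1 / 2 :=
  Real.rpow_inv_natCast_pow (by norm_num) (by norm_num)

theorem rootHalf_lt_one : rootHalf < 1 := by
  by_contra! h
  have := one_le_pow₀ (n := 12) h
  rw [rootHalf_pow] at this
  norm_num at this

theorem inv_two_pow_eq (l : ℕ) : ((2 : ℝ) ^ l)⁻¹ = rootHalf ^ (12 * l) := by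
  rw [pow_mul, rootHalf_pow, one_div, inv_pow]

theorem sum_rootHalf_le (n : ℕ) :
    ∑ l ∈ range n, rootHalf ^ (3 * (l + 1)) ≤ (1 - rootHalf)⁻¹ := by
  have h1 := sub_pos.2 rootHalf_lt_one
  have h2 := rootHalf_pos
  calc _ ≤ ∑ l ∈ range n, rootHalf ^ l :=
        sum_le_sum fun l _ => pow_le_pow_of_le_one h2.le rootHalf_lt_one.le (by omega)
    _ ≤ _ := by
        rw [← one_div, le_div_iff₀ h1, geom_sum_mul_neg]
        linarith [pow_pos h2 n]

namespace Diffusion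

variable {d s : ℕ} (D : Diffusion d s)

/-- The left side is √q for q = √h. In terms of the twelfth root, the error exponent 1/4, the
allocation exponent 5/6 and the cost exponent 1 are all natural numbers: 3, 10 and 12. -/
theorem sqrt_sqrt_h (l : ℕ) : Real.sqrt (Real.sqrt (h l)) = rootHalf ^ (3 * l) := by
  have h1 : h l = ((rootHalf ^ (3 * l)) ^ 2) ^ 2 := by
    rw [h, inv_two_pow_eq, ← pow_mul, ← pow_mul]; congr 1; ring
  have h2 := pow_pos rootHalf_pos (3 * l)
  rw [h1, Real.sqrt_sq (by positivity), Real.sqrt_sq h2.le]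

theorem lintegral_coupled_init (l : ℕ) {f : Rd d × Rd d → ℝ≥0∞} (hf : Measurable f) :
    ∫⁻ v, f v ∂(D.coupled l).init = ∫⁻ x, ∫⁻ v, f v ∂(D.coupledQ l (x, x)) ∂D.init := by
  change ∫⁻ v, f v ∂((D.init.map fun x => (x, x)).bind (D.coupledQ l)) = _
  rw [Measure.lintegral_bind (Kernel.aemeasurable _) hf.aemeasurable,
    lintegral_map hf.lintegral_kernel (by fun_prop)]

theorem lintegral_single_init (l : ℕ) {f : Rd d → ℝ≥0∞} (hf : Measurable f) :
    ∫⁻ v, f v ∂(D.single l).init = ∫⁻ x, ∫⁻ v, f v ∂(D.Q l x) ∂D.init :=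
  Measure.lintegral_bind (Kernel.aemeasurable _) hf.aemeasurable

theorem coupled_init_map_fst (l : ℕ) :
    (D.coupled l).init.map Prod.fst = (D.single (l + 1)).init := by
  refine Measure.ext_of_lintegral _ fun f hf => ?_
  rw [lintegral_map hf measurable_fst, D.lintegral_coupled_init l (by fun_prop),
    D.lintegral_single_init _ hf]
  refine lintegral_congr fun x => ?_
  rw [← lintegral_map hf measurable_fst, D.coupledQ_map_fst]

theorem coupled_init_map_snd (l : ℕ) : (D.coupled l).init.map Prod.snd = (D.single l).init := by
  refine Measure.ext_of_lintegral _ fun f hf => ?_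
  rw [lintegral_map hf measurable_snd, D.lintegral_coupled_init l (by fun_prop),
    D.lintegral_single_init _ hf]
  refine lintegral_congr fun x => ?_
  rw [← lintegral_map hf measurable_snd, D.coupledQ_map_snd]

theorem coupled_Z₁ (l n : ℕ) : (D.coupled l).Z₁ D.potentials n = D.likelihood (l + 1) n := by
  unfold Coupled.Z₁; rw [coupled_init_map_fst]; rfl

theorem coupled_Z₂ (l n : ℕ) : (D.coupled l).Z₂ D.potentials n = D.likelihood l n := by
  unfold Coupled.Z₂; rw [coupled_init_map_snd]; rfl

/-- The coarse marginal model of each pair is the fine marginal model of the level below, including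
the initial law, so the product of ratios telescopes down to level 0. -/
theorem target_eq_likelihood {c : ℝ} (hG : D.potentials.Bounded c) (n L : ℕ) :
    D.model.target n L = D.likelihood L n := by
  have hpos : ∀ l, 0 < D.likelihood l n := fun l => normConst_pos hG n
  induction L with
  | zero => simp [Model.target]; rfl
  | succ L ih =>
    have h1 : D.model.target n (L + 1) =
        D.model.target n L * ((D.coupled L).Z₁ D.potentials n / (D.coupled L).Z₂ D.potentials n) := by
      simp only [Model.target, prod_range_succ, mul_assoc]; rfl
    rw [h1, ih, coupled_Z₁, coupled_Z₂, mul_div_cancel₀ _ (hpos L).ne']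

/-- The weight for the Euler schemes. -/
def sqrtWeight (u : Rd d) : ℝ := Real.sqrt (1 + ‖u‖ ^ 2)

theorem sq_sqrtWeight (u : Rd d) : sqrtWeight u ^ 2 = 1 + ‖u‖ ^ 2 := Real.sq_sqrt (by positivity)

theorem measurable_sqrtWeight : Measurable (sqrtWeight (d := d)) := by unfold sqrtWeight; fun_prop

theorem sqrtWeight_nonneg (u : Rd d) : 0 ≤ sqrtWeight u := Real.sqrt_nonneg _

/-- The second moment of the initial law, increased by one. -/
def initMoment : ℝ := ∫ x, (1 + ‖x‖ ^ 2) ∂D.init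

theorem integrable_init : Integrable (fun x => 1 + ‖x‖ ^ 2) D.init := by
  have h := D.moments 2 (by norm_num)
  have h2 : (fun x : Rd d => ‖x‖ ^ (2 : ℝ)) = fun x => ‖x‖ ^ 2 := by
    ext x; exact_mod_cast Real.rpow_natCast ‖x‖ 2
  rw [h2] at h
  exact (integrable_const _).add h

theorem lintegral_init : ∫⁻ x, ENNReal.ofReal (1 + ‖x‖ ^ 2) ∂D.init =
    ENNReal.ofReal D.initMoment :=
  (ofReal_integral_eq_lintegral_ofReal D.integrable_init (.of_forall fun _ => by positivity)).symm

theorem one_le_initMoment : 1 ≤ D.initMoment := by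
  have h := integral_mono (integrable_const 1) D.integrable_init fun x => by
    change (1 : ℝ) ≤ 1 + ‖x‖ ^ 2
    nlinarith [sq_nonneg ‖x‖]
  rwa [integral_const, probReal_univ, one_smul] at h

variable {D} {K : ℝ}

theorem EulerBound.weight (hK : D.EulerBound K) (l : ℕ) :
    Weight (D.single l).init (fun _ => D.Q l) sqrtWeight (Real.sqrt (K * D.initMoment)) := by
  have hK1 := hK.one_le
  have hm := D.one_le_initMoment
  have hsq := (measurable_sqrtWeight (d := d)).pow_const 2 |>.ennreal_ofReal
  refine ⟨fun u => Real.one_le_sqrt.2 (by nlinarith [sq_nonneg ‖u‖]),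
    ⟨measurable_sqrtWeight, Real.sqrt_nonneg _, ?_⟩,
    fun _ u => ⟨measurable_sqrtWeight, mul_nonneg (Real.sqrt_nonneg _) (sqrtWeight_nonneg _), ?_⟩⟩
  · rw [Real.sq_sqrt (by positivity), D.lintegral_single_init l hsq,
      ENNReal.ofReal_mul (by positivity), ← D.lintegral_init,
      ← lintegral_const_mul _ (by fun_prop)]
    refine lintegral_mono fun x => ?_
    simp_rw [sq_sqrtWeight]
    rw [← ENNReal.ofReal_mul (by positivity)]
    exact hK.moment_le l x
  · rw [mul_pow, Real.sq_sqrt (by positivity)]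
    simp_rw [sq_sqrtWeight]
    refine (hK.moment_le l u).trans (ENNReal.ofReal_le_ofReal ?_)
    have : 0 ≤ 1 + ‖u‖ ^ 2 := by positivity
    gcongr
    exact le_mul_of_one_le_right (by positivity) hm

/-- For points at distance at most 1, Cauchy-Schwarz reduces to the Lyapunov bound, and √(|x − y|² +
h V²) ≤ |x − y| + √h V. For distant points the right side is at least 1, since K ≥ 1. -/
theorem EulerBound.lintegral_truncDist_le (hK : D.EulerBound K) (l : ℕ) (v : Rd d × Rd d) :
    ∫⁻ w, ENNReal.ofReal (truncDist w) ∂(D.coupledQ l v) ≤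
      ENNReal.ofReal (K * (truncDist v + Real.sqrt (h (l + 1)) * sqrtWeight v.1)) := by
  have hK1 := hK.one_le
  have hV := sqrtWeight_nonneg v.1
  have hq := Real.sqrt_nonneg (h (l + 1))
  have ht := truncDist_nonneg v
  have hl := lyapunov_nonneg (h_pos (l + 1)).le v
  rcases le_total (dist v.1 v.2) 1 with hd | hd
  · have h1 : L2Le (D.coupledQ l v) truncDist (Real.sqrt (K * lyapunov (h (l + 1)) v)) := by
      refine ⟨measurable_truncDist, Real.sqrt_nonneg _, ?_⟩
      rw [Real.sq_sqrt (by positivity)]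
      refine (lintegral_mono fun w => ENNReal.ofReal_le_ofReal ?_).trans (hK.pair_le l v)
      have h2 : truncDist w ≤ ‖w.1 - w.2‖ := by rw [← dist_eq_norm]; exact min_le_left _ _
      have h3 := pow_le_pow_left₀ (truncDist_nonneg w) h2 2
      have h4 : 0 ≤ h (l + 1) * (1 + ‖w.1‖ ^ 2) := mul_nonneg (h_pos _).le (by positivity)
      rw [lyapunov]
      linarith
    rw [← ofReal_integral_eq_lintegral_ofReal h1.integrable (.of_forall truncDist_nonneg)]
    refine ENNReal.ofReal_le_ofReal ((le_abs_self _).trans (h1.abs_integral_le.trans ?_))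
    have h5 : lyapunov (h (l + 1)) v ≤ (truncDist v + Real.sqrt (h (l + 1)) * sqrtWeight v.1) ^ 2 := by
      have h6 : truncDist v = ‖v.1 - v.2‖ := by rw [← dist_eq_norm]; exact min_eq_left hd
      have h7 : h (l + 1) * (1 + ‖v.1‖ ^ 2) = (Real.sqrt (h (l + 1)) * sqrtWeight v.1) ^ 2 := by
        rw [mul_pow, Real.sq_sqrt (h_pos _).le, sq_sqrtWeight]
      rw [lyapunov, h7, ← h6]
      nlinarith [mul_nonneg ht (mul_nonneg hq hV)]
    refine Real.sqrt_le_iff.2 ⟨by positivity, ?_⟩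
    rw [mul_pow]
    exact mul_le_mul (by nlinarith) h5 hl (by positivity)
  · have h1 : truncDist v = 1 := min_eq_right hd
    refine (lintegral_mono fun w => ENNReal.ofReal_le_ofReal (truncDist_le_one w)).trans ?_
    rw [lintegral_const, measure_univ, mul_one, h1]
    exact ENNReal.ofReal_le_ofReal (by nlinarith [mul_nonneg hq hV])

/-- The strong error gives q = √h. Initial pairs start from the diagonal, so only the term √h V
contributes; integrating it over the law of X₀ is the reason for the extra factor in the constant.
-/
theorem EulerBound.closeCoupling (hK : D.EulerBound K) {c : ℝ} {Λ : ℕ → ℝ}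
    (hR : D.model.Regular c Λ) (l : ℕ) :
    CloseCoupling (D.coupled l) D.potentials c Λ sqrtWeight (Real.sqrt (K * D.initMoment))
      (K * Real.sqrt (K * D.initMoment)) (Real.sqrt (h (l + 1))) := by
  have hK1 := hK.one_le
  have hm := D.one_le_initMoment
  have ha : 1 ≤ Real.sqrt (K * D.initMoment) := Real.one_le_sqrt.2 (by nlinarith)
  have hq := Real.sqrt_nonneg (h (l + 1))
  have hKa : K ≤ K * Real.sqrt (K * D.initMoment) := le_mul_of_one_le_right (by positivity) ha
  refine ⟨hR.bdd, hR.lip_val, hR.lip_step l, hR.lip_nonneg, ?_, ?_, by positivity, hq,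
    Real.sqrt_le_one.2 (h_le_one _), ?_, fun p v => ?_⟩
  · rw [coupled_init_map_fst]; exact hK.weight (l + 1)
  · rw [coupled_init_map_snd]; exact hK.weight l
  · have hV : L2Le D.init sqrtWeight (Real.sqrt (K * D.initMoment)) := by
      refine ⟨measurable_sqrtWeight, Real.sqrt_nonneg _, ?_⟩
      simp_rw [sq_sqrtWeight]
      rw [Real.sq_sqrt (by positivity), D.lintegral_init]
      exact ENNReal.ofReal_le_ofReal (le_mul_of_one_le_left (by positivity) hK1)
    rw [D.lintegral_coupled_init l measurable_truncDist.ennreal_ofReal]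
    calc _ ≤ ∫⁻ x, ENNReal.ofReal (K * Real.sqrt (h (l + 1))) * ENNReal.ofReal (sqrtWeight x)
            ∂D.init := by
          refine lintegral_mono fun x => (hK.lintegral_truncDist_le l (x, x)).trans ?_
          have h2 : truncDist (x, x) = 0 := by simp [truncDist]
          rw [h2, zero_add, ← ENNReal.ofReal_mul (by positivity), mul_assoc]
      _ = ENNReal.ofReal (K * Real.sqrt (h (l + 1))) *
            ENNReal.ofReal (∫ x, sqrtWeight x ∂D.init) := by
          rw [lintegral_const_mul _ measurable_sqrtWeight.ennreal_ofReal,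
            ofReal_integral_eq_lintegral_ofReal hV.integrable (.of_forall sqrtWeight_nonneg)]
      _ ≤ _ := by
          rw [← ENNReal.ofReal_mul (by positivity)]
          refine ENNReal.ofReal_le_ofReal ?_
          have h3 := (le_abs_self _).trans hV.abs_integral_le
          calc _ ≤ K * Real.sqrt (h (l + 1)) * Real.sqrt (K * D.initMoment) := by gcongr
            _ = _ := by ring
  · refine (hK.lintegral_truncDist_le l v).trans (ENNReal.ofReal_le_ofReal ?_)
    have h1 := truncDist_nonneg v
    have h2 := sqrtWeight_nonneg v.1
    gcongr

variable (D) in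
/-- The error of the factors of the multilevel estimator, for Euler levels. -/
theorem exists_ratio_bound {c : ℝ} {Λ : ℕ → ℝ} (hR : D.model.Regular c Λ) (n : ℕ) :
    ∃ E, 0 ≤ E ∧ (∀ (N : ℕ → ℕ+) l, L2Le ((D.model.pair l).law D.model.G (N (l + 1)))
      (fun ω => normEst D.model.G n (N (l + 1)) (fun p i => (ω p i).1) /
        normEst D.model.G n (N (l + 1)) (fun p i => (ω p i).2) -
          (D.model.pair l).Z₁ D.model.G n / (D.model.pair l).Z₂ D.model.G n)
      (E * rootHalf ^ (3 * (l + 1)) / Real.sqrt (N (l + 1)))) ∧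
    ∀ l, |(D.model.pair l).Z₁ D.model.G n / (D.model.pair l).Z₂ D.model.G n| ≤
      1 + E * rootHalf ^ (3 * (l + 1)) := by
  obtain ⟨K, hK⟩ := D.exists_eulerBound
  refine ⟨_, (hK.closeCoupling hR 0).closeConst_nonneg n, fun N l => ?_, fun l => ?_⟩
  · have h1 := (hK.closeCoupling hR l).l2Le_ratio_sub (N := N (l + 1)) n
    rw [sqrt_sqrt_h] at h1
    exact h1
  · have h1 := (hK.closeCoupling hR l).abs_ratio_le n
    rw [sqrt_sqrt_h] at h1
    exact h1

theorem ratio_bound_weaken {E : ℝ} (hE : 0 ≤ E) (N : ℕ → ℕ+) (l : ℕ) :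
    E * rootHalf ^ (3 * (l + 1)) / Real.sqrt (N (l + 1)) ≤ E * rootHalf ^ (3 * (l + 1)) := by
  have hN : 1 ≤ Real.sqrt (N (l + 1)) := Real.one_le_sqrt.2 (Nat.one_le_cast.2 (N (l + 1)).pos)
  exact div_le_self (mul_nonneg hE (pow_pos rootHalf_pos _).le) hN

variable (D) in
-- Summability of the factor errors comes from the geometric decay h_l^{1/4}, uniformly in `L` and
-- the numbers of particles, and not from the level errors, which enter only through the rate.
theorem exists_mse_le_rate (hA : D.model.AssumptionA) {κ : ℕ → ℝ} (hκ : ∀ k, 0 < κ k) (n : ℕ) :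
    ∃ C : ℝ, ∀ (L : ℕ) (N : ℕ → ℕ+),
      D.model.mse n N L (D.model.target n L) ≤ C * D.model.rate κ n N L ^ 2 := by
  obtain ⟨c, Λ, hR⟩ := hA.exists_regular
  obtain ⟨E, hE, h1, h2⟩ := D.exists_ratio_bound hR n
  obtain ⟨C, hC⟩ := hR.exists_mse_le κ hκ n (E * (1 - rootHalf)⁻¹)
  refine ⟨C, fun L N => hC L N (fun l => E * rootHalf ^ (3 * (l + 1)))
    (fun l => (h1 N l).weaken (ratio_bound_weaken hE N l)) h2 ?_⟩
  rw [← mul_sum]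
  exact mul_le_mul_of_nonneg_left (sum_rootHalf_le L) hE

end Diffusion

/-! ### Allocation of the particles and cost -/

theorem geom_sum_le_mul_last {s : ℝ} (hs : 1 < s) (L : ℕ) :
    ∑ l ∈ range (L + 1), s ^ l ≤ s / (s - 1) * s ^ L := by
  have h1 := sub_pos.2 hs
  rw [geom_sum_eq hs.ne', div_mul_eq_mul_div, pow_succ']
  gcongr
  linarith

theorem two_pow_ceil_le {ε : ℝ} (h0 : 0 < ε) (h1 : ε < 1) :
    (2 : ℝ) ^ ⌈Real.logb 2 (1 / ε)⌉₊ ≤ 2 / ε := by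
  have h2 : 0 ≤ Real.logb 2 (1 / ε) :=
    Real.logb_nonneg one_lt_two ((one_le_div h0).2 h1.le)
  rw [← Real.rpow_natCast]
  calc _ ≤ (2 : ℝ) ^ (Real.logb 2 (1 / ε) + 1) :=
        Real.rpow_le_rpow_of_exponent_le one_le_two (Nat.ceil_lt_add_one h2).le
    _ = _ := by
        rw [Real.rpow_add two_pos, Real.rpow_logb two_pos (by norm_num) (by positivity),
          Real.rpow_one]
        ring

/-- Numbers of particles for which the error of the multilevel estimator is at most `ε`. -/
theorem exists_allocation {C : ℝ} (hC : 0 < C) : ∃ B : ℝ, ∀ ε : ℝ, 0 < ε → ε < 1 →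
    ∃ N : ℕ → ℕ+,
      cost N ⌈Real.logb 2 (1 / ε)⌉₊ ≤ B * ε ^ (-(5 / 2) : ℝ) ∧
      C * ∑ l ∈ range (⌈Real.logb 2 (1 / ε)⌉₊ + 1), rootHalf ^ (3 * l) / Real.sqrt (N l) ≤ ε := by
  have hr := rootHalf_pos
  have hr1 := rootHalf_lt_one
  -- s = 2^{1/6}. For the optimal allocation both the error and, up to rounding, the cost of level l
  -- are proportional to s^l, so the finest level dominates the two geometric sums.
  set s : ℝ := (rootHalf ^ 2)⁻¹ with hs_def
  have hs : 1 < s := (one_lt_inv₀ (by positivity)).2 (pow_lt_one₀ hr.le hr1 two_ne_zero)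
  have hs0 : 0 < s := one_pos.trans hs
  set c₁ := s / (s - 1) with hc₁
  have hc₁0 : 0 < c₁ := div_pos hs0 (sub_pos.2 hs)
  -- The first summand is the cost of the unrounded numbers; the 4 pays for rounding up, as ∑ 2^l ≤
  -- 2·2^L ≤ 4/ε.
  refine ⟨2 * C ^ 2 * c₁ ^ 3 + 4, fun ε h0 h1 => ?_⟩
  set L := ⌈Real.logb 2 (1 / ε)⌉₊ with hL
  -- Chosen so that the total error bound C·c₁·s^L/A is exactly ε.
  set A := C * c₁ * s ^ L / ε with hA
  have hA0 : 0 < A := by positivity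
  have hpos : ∀ l, 0 < A ^ 2 * rootHalf ^ (10 * l) := fun l => by positivity
  -- N_l is proportional to h_l^{5/6}: minimizing ∑ N_l/h_l for a given ∑ h_l^{1/4} N_l^{-1/2}
  -- forces N_l^{3/2} to be proportional to h_l^{5/4}.
  refine ⟨fun l => ⟨⌈A ^ 2 * rootHalf ^ (10 * l)⌉₊, Nat.ceil_pos.2 (hpos l)⟩, ?_, ?_⟩
  · have h2 : ∀ l, (⌈A ^ 2 * rootHalf ^ (10 * l)⌉₊ : ℝ) * (Diffusion.h l)⁻¹ ≤
        A ^ 2 * s ^ l + 2 ^ l := fun l => by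
      have e1 : (Diffusion.h l)⁻¹ = (2 : ℝ) ^ l := by rw [Diffusion.h, inv_inv]
      have e2 : rootHalf ^ (10 * l) * (2 : ℝ) ^ l = s ^ l := by
        rw [← inv_inv ((2 : ℝ) ^ l), inv_two_pow_eq, hs_def, inv_pow, ← pow_mul,
          show 12 * l = 10 * l + 2 * l by ring, pow_add]
        field_simp
      rw [e1]
      calc _ ≤ (A ^ 2 * rootHalf ^ (10 * l) + 1) * (2 : ℝ) ^ l := by
            gcongr
            exact (Nat.ceil_lt_add_one (hpos l).le).le
        _ = _ := by rw [add_mul, mul_assoc, e2, one_mul]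
    set t := Real.sqrt ε with ht
    have ht0 : 0 < t := Real.sqrt_pos.2 h0
    have ht1 : t ≤ 1 := Real.sqrt_le_one.2 h1.le
    have hε : ε = t ^ 2 := (Real.sq_sqrt h0.le).symm
    have hrp : ε ^ (-(5 / 2) : ℝ) = (t ^ 5)⁻¹ := by
      rw [Real.rpow_neg h0.le, ht, Real.sqrt_eq_rpow, ← Real.rpow_natCast, ← Real.rpow_mul h0.le]
      norm_num
    have h3 : (2 : ℝ) ^ L ≤ 2 / t ^ 2 := hε ▸ two_pow_ceil_le h0 h1
    -- s^{3L} = 2^{L/2} is of order ε^{-1/2}. Multiplied by ε^{-2} from A², it yields the cost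
    -- ε^{-5/2}.
    have h4 : (s ^ L) ^ 3 ≤ 2 / t := by
      refine (pow_le_pow_iff_left₀ (by positivity) (by positivity) two_ne_zero).1 ?_
      have e1 : ((s ^ L) ^ 3) ^ 2 = (2 : ℝ) ^ L := by
        rw [← inv_inv ((2 : ℝ) ^ L), inv_two_pow_eq, hs_def, inv_pow, inv_pow, inv_pow, ← pow_mul,
          ← pow_mul, ← pow_mul]
        congr 2; ring
      rw [e1, div_pow]
      refine h3.trans ?_
      gcongr
      norm_num
    have h5 := geom_sum_le_mul_last hs L
    have h6 := geom_sum_le_mul_last one_lt_two L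
    calc cost _ L ≤ ∑ l ∈ range (L + 1), (A ^ 2 * s ^ l + 2 ^ l) := sum_le_sum fun l _ => h2 l
      _ = A ^ 2 * ∑ l ∈ range (L + 1), s ^ l + ∑ l ∈ range (L + 1), (2 : ℝ) ^ l := by
          rw [sum_add_distrib, mul_sum]
      _ ≤ A ^ 2 * (c₁ * s ^ L) + 2 / (2 - 1) * 2 ^ L := by gcongr
      _ = C ^ 2 * c₁ ^ 3 * (s ^ L) ^ 3 / t ^ 4 + 2 * 2 ^ L := by
          rw [hA, hε]; field_simp; ring
      _ ≤ C ^ 2 * c₁ ^ 3 * (2 / t) / t ^ 4 + 2 * (2 / t ^ 2) := by gcongr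
      _ ≤ C ^ 2 * c₁ ^ 3 * (2 / t) / t ^ 4 + 2 * (2 / t ^ 5) := by
          have : t ^ 5 ≤ t ^ 2 := pow_le_pow_of_le_one ht0.le ht1 (by norm_num)
          gcongr
      _ = _ := by rw [hrp]; field_simp; ring
  · have h2 : ∀ l, rootHalf ^ (3 * l) / Real.sqrt ⌈A ^ 2 * rootHalf ^ (10 * l)⌉₊ ≤ s ^ l / A := by
      intro l
      have e1 : A * rootHalf ^ (5 * l) ≤ Real.sqrt ⌈A ^ 2 * rootHalf ^ (10 * l)⌉₊ := by
        refine Real.le_sqrt_of_sq_le (le_trans (le_of_eq ?_) (Nat.le_ceil _))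
        rw [mul_pow, ← pow_mul]; congr 2; ring
      calc _ ≤ rootHalf ^ (3 * l) / (A * rootHalf ^ (5 * l)) := by gcongr
        _ = _ := by
            rw [hs_def, inv_pow, ← pow_mul, show 5 * l = 3 * l + 2 * l by ring, pow_add]
            field_simp
    calc _ ≤ C * ∑ l ∈ range (L + 1), s ^ l / A :=
          mul_le_mul_of_nonneg_left (sum_le_sum fun l _ => h2 l) hC.le
      _ ≤ C * (c₁ * s ^ L / A) := by
          rw [← sum_div]
          gcongr
          exact geom_sum_le_mul_last hs L
      _ = ε := by rw [hA]; field_simp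

namespace Diffusion

variable {d s : ℕ} (D : Diffusion d s)

/-- The explicit factor errors h_l^{1/4}/√N_l are used here instead of the rate with B̄. The L²
error about the level-L likelihood is at most ε, and passing to another reference z adds a constant.
-/
theorem exists_cost_le (hA : D.model.AssumptionA) (n : ℕ) :
    ∃ C : ℝ, ∀ ε : ℝ, 0 < ε → ε < 1 →
      ∃ L : ℕ, L = ⌈Real.logb 2 (1 / ε)⌉₊ ∧ ∃ N : ℕ → ℕ+,
        cost N L ≤ C * ε ^ (-(5 / 2) : ℝ) ∧
        ∀ z : ℝ, D.model.mse n N L z ≤ (ε + |D.likelihood L n - z|) ^ 2 := by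
  obtain ⟨c, Λ, hR⟩ := hA.exists_regular
  obtain ⟨E, hE, h1, h2⟩ := D.exists_ratio_bound hR n
  set E₀ := Projects.normErrConst c n with hE₀
  have hE₀0 : 0 ≤ E₀ := Projects.normErrConst_nonneg hR.bdd.pos.le n
  have hcn := pow_pos hR.bdd.pos n
  set X := Real.exp (2 * (E * (1 - rootHalf)⁻¹)) with hX
  have hX0 : 0 < X := Real.exp_pos _
  -- The first two summands are the constants of level 0 and of the higher levels, which the
  -- allocation treats as one sum; the 1 only makes the constant positive.
  obtain ⟨B, hB⟩ := exists_allocation (C := X * (E₀ + c ^ n * E + 1)) (by positivity)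
  refine ⟨B, fun ε hε0 hε1 => ⟨_, rfl, ?_⟩⟩
  obtain ⟨N, hN, herr⟩ := hB ε hε0 hε1
  set L := ⌈Real.logb 2 (1 / ε)⌉₊
  refine ⟨N, hN, fun z => ?_⟩
  have hbase : L2Le (D.model.base.law D.model.G (N 0))
      (fun ω => normEst D.model.G n (N 0) ω - D.model.base.Z D.model.G n)
      (E₀ / Real.sqrt (N 0)) :=
    (D.model.base.projects (G := D.model.G) (N := N 0)).l2Le_normEst_sub hR.bdd n
  have hz : |D.model.base.Z D.model.G n| ≤ c ^ n := by
    rw [abs_of_pos (show 0 < D.model.base.Z D.model.G n from normConst_pos hR.bdd n)]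
    exact hR.bdd.normConst_le n
  have hfin := D.model.l2Le_estimator_sub hbase hz (h1 N) h2 (ratio_bound_weaken hE N)
    (S := E * (1 - rootHalf)⁻¹) (L := L) (by
      rw [← mul_sum]
      exact mul_le_mul_of_nonneg_left (sum_rootHalf_le L) hE)
  have hle : X * (E₀ / Real.sqrt (N 0) + c ^ n *
      ∑ l ∈ range L, E * rootHalf ^ (3 * (l + 1)) / Real.sqrt (N (l + 1))) ≤ ε := by
    refine le_trans ?_ herr
    rw [mul_assoc, sum_range_succ']
    set R := ∑ l ∈ range L, rootHalf ^ (3 * (l + 1)) / Real.sqrt (N (l + 1)) with hRdef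
    have hR0 : 0 ≤ R := sum_nonneg fun l _ =>
      div_nonneg (pow_pos rootHalf_pos _).le (Real.sqrt_nonneg _)
    have hr0 : 0 ≤ 1 / Real.sqrt (N 0) := by positivity
    have e1 : ∑ l ∈ range L, E * rootHalf ^ (3 * (l + 1)) / Real.sqrt (N (l + 1)) = E * R := by
      rw [hRdef, mul_sum]; exact sum_congr rfl fun l _ => by ring
    have e2 : E₀ / Real.sqrt (N 0) = E₀ * (1 / Real.sqrt (N 0)) := by ring
    have e3 := mul_nonneg hcn.le hE
    rw [e1, e2, mul_zero, pow_zero]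
    gcongr
    nlinarith [mul_nonneg hE₀0 hR0, mul_nonneg e3 hr0]
  rw [D.target_eq_likelihood hR.bdd] at hfin
  have : IsProbabilityMeasure (D.model.law N L) := by
    unfold Model.law Single.law
    infer_instance
  refine D.model.mse_le_of_l2Le (((hfin.weaken hle).add
    (L2Le.const (D.likelihood L n - z))).congr fun ω => ?_)
  ring

end Diffusion

end MLPF

end

theorem mainTheorem3 {U : Type*} [MetricSpace U] [SecondCountableTopology U] [MeasurableSpace U]
    [BorelSpace U] :
    (∀ m : MLPF.Model U, m.AssumptionA → ∀ κ : ℕ → ℝ, (∀ k, 0 < κ k) →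
      ∀ n : ℕ, 1 ≤ n → ∀ S : ℝ, ∃ C : ℝ, ∀ L : ℕ, 1 ≤ L → ∀ N : ℕ → ℕ+,
        ∑ l ∈ Finset.range L, m.levelError κ n N l ≤ S →
          m.mse n N L (m.target n L) ≤ C * m.rate κ n N L ^ 2) ∧
    (∀ (d s : ℕ) (D : MLPF.Diffusion d s), D.model.AssumptionA →
      (∀ κ : ℕ → ℝ, (∀ k, 0 < κ k) → ∀ n : ℕ, 1 ≤ n →
        ∃ C : ℝ, ∀ L : ℕ, 1 ≤ L → ∀ N : ℕ → ℕ+,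
          D.model.mse n N L (D.model.target n L) ≤ C * D.model.rate κ n N L ^ 2) ∧
      (∀ n : ℕ, 1 ≤ n → ∃ C : ℝ, ∀ ε : ℝ, 0 < ε → ε < 1 →
        ∃ L : ℕ, L = ⌈Real.logb 2 (1 / ε)⌉₊ ∧ ∃ N : ℕ → ℕ+,
          MLPF.cost N L ≤ C * ε ^ (-(5 / 2) : ℝ) ∧
          ∀ z : ℝ, D.model.mse n N L z ≤ (ε + |D.likelihood L n - z|) ^ 2)) := by
  refine ⟨fun m hA κ hκ n _ S => ?_, fun d s D hA => ⟨fun κ hκ n _ => ?_, fun n _ =>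
    D.exists_cost_le hA n⟩⟩
  · obtain ⟨C, hC⟩ := hA.exists_mse_le hκ n S
    exact ⟨C, fun L _ N => hC L N⟩
  · obtain ⟨C, hC⟩ := D.exists_mse_le_rate hA hκ n
    exact ⟨C, fun L _ N => hC L N⟩
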